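/- Let $d\ge 0$, let $A$ be a real $d\times d$ matrix and let $s,\sigma>0$ satisfy $s+\sigma\ge1$. For $h>0$ let $\mathcal S_{s;h}^\sigma(\mathbf R^d)$ be the Banach space of all $f\in C^\infty(\mathbf R^d)$ (complex valued) with finite norm $$\|f\|_{\mathcal S_{s;h}^\sigma}=\sup_{\alpha,\beta\in\mathbf N^d}\ \sup_{x\in\mathbf R^d}\frac{|x^\alpha\partial^\beta f(x)|}{h^{|\alpha|+|\beta|}\,\alpha!^{s}\,\beta!^{\sigma}},$$ let $\mathcal S_s^\sigma(\mathbf R^d)=\bigcup_{h>0}\mathcal S_{s;h}^\sigma(\mathbf R^d)$ be the Gelfand–Shilov space with the (locally convex) inductive limit topology, and let $(\mathcal S_s^\sigma)'(\mathbf R^d)$ be its dual with the strong topology. A function $f\in\mathcal S_s^\sigma(\mathbf R^d)$ is identified with the functional $g\mapsto\int_{\mathbf R^d} f(x)g(x)\,dx$ in $(\mathcal S_s^\sigma)'(\mathbf R^d)$. Let $a\in\Gamma^{\sigma,s}_{s,\sigma;0}(\mathbf R^{2d})$, that is, $a\in C^\infty(\mathbf R^{2d})$ and there is $h>0$ such that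 for every $r>0$ there is $C>0$ with $$|\partial_x^\alpha\partial_\xi^\beta a(x,\xi)|\le C\,h^{|\alpha+\beta|}\,\alpha!^{\sigma}\,\beta!^{s}\,e^{r(|x|^{1/s}+|\xi|^{1/\sigma})}\qquad\text{for all }\alpha,\beta\in\mathbf N^d,\ x,\xi\in\mathbf R^d.$$ For $f\in\mathcal S_s^\sigma(\mathbf R^d)$ let $\operatorname{Op}_A(a)f$ be given by the distribution kernel $K(x,y)=(2\pi)^{-d/2}(\mathscr F_2^{-1}a)(x-A(x-y),x-y)$, that is, for $g\in\mathcal S_s^\sigma(\mathbf R^d)$, $$\langle \operatorname{Op}_A(a)f,g\rangle=\langle K,g\otimes f\rangle=(2\pi)^{-d}\iint_{\mathbf R^{2d}} a(z,\xi)\Big(\int_{\mathbf R^d} g(z+Aw)\,f(z+Aw-w)\,e^{i\langle w,\xi\rangle}\,dw\Big)\,dz\,d\xi .$$ Then the integral over $(z,\xi)$ is absolutely convergent for all $f,g\in\mathcal S_s^\sigma(\mathbf R^d)$, and $\operatorname{Op}_A(a)$ is continuous on $\mathcal S_s^\sigma(\mathbf R^d)$ and on $(\mathcal S_s^\sigma)'(\mathbf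 R^d)$. More precisely: 1. there is a continuous linear map $T$ on $\mathcal S_s^\sigma(\mathbf R^d)$ with $\int (Tf)g\,dx=\langle\operatorname{Op}_A(a)f,g\rangle$ for all $f,g\in\mathcal S_s^\sigma(\mathbf R^d)$; 2. there is a continuous linear map $R$ on $\mathcal S_s^\sigma(\mathbf R^d)$ (the transposed operator) with $\int f\,(Rg)\,dx=\langle\operatorname{Op}_A(a)f,g\rangle$ for all $f,g\in\mathcal S_s^\sigma(\mathbf R^d)$, and a continuous linear map $T'$ on $(\mathcal S_s^\sigma)'(\mathbf R^d)$ which extends $T$ and is given by $\langle T'u,g\rangle=\langle u,Rg\rangle$ for $u\in(\mathcal S_s^\sigma)'(\mathbf R^d)$, $g\in\mathcal S_s^\sigma(\mathbf R^d)$. -/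

import Mathlib

namespace GelfandShilov

open MeasureTheory
open scoped ContDiff Topology

/-! ### Multi-indices and iterated partial derivatives -/

/-- `EuclideanSpace ℝ (Fin d)`, that is `𝐑ᵈ` with the Euclidean norm and Lebesgue measure. -/
abbrev E (d : ℕ) : Type := EuclideanSpace ℝ (Fin d)

/-- The length `|α|` of a multi-index. -/
def len {d : ℕ} (α : Fin d → ℕ) : ℕ := ∑ i, α i

/-- The factorial `α!` of a multi-index, as a real number. -/
noncomputable def fact {d : ℕ} (α : Fin d → ℕ) : ℝ := ∏ i, ((α i).factorial : ℝ)

/-- The monomial `x ^ α`. -/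
noncomputable def monom {d : ℕ} (α : Fin d → ℕ) (x : E d) : ℝ := ∏ i, x i ^ α i

section Derivatives

variable {V : Type*} [NormedAddCommGroup V] [NormedSpace ℝ V]

/-- The derivative of `f` in the direction `v`. -/
noncomputable def dirDeriv (v : V) (f : V → ℂ) : V → ℂ := fun x => fderiv ℝ f x v

/-- `∂^α f = ∂₁^{α₁} ⋯ ∂_d^{α_d} f`, where `∂ᵢ` is the derivative in the direction `e i`. -/
noncomputable def multiDeriv {d : ℕ} (e : Fin d → V) (α : Fin d → ℕ) (f : V → ℂ) : V → ℂ :=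
  (List.finRange d).foldr (fun i g => (dirDeriv (e i))^[α i] g) f

theorem contDiff_dirDeriv (v : V) {f : V → ℂ} (hf : ContDiff ℝ ∞ f) :
    ContDiff ℝ ∞ (dirDeriv v f) :=
  (hf.fderiv_right (m := ∞) (by simp)).clm_apply contDiff_const

theorem dirDeriv_add (v : V) {f g : V → ℂ} (hf : ContDiff ℝ ∞ f) (hg : ContDiff ℝ ∞ g) :
    dirDeriv v (f + g) = dirDeriv v f + dirDeriv v g := by
  funext x
  simp only [dirDeriv, Pi.add_apply]
  rw [fderiv_add (hf.differentiable (by simp) x) (hg.differentiable (by simp) x)]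
  rfl

theorem dirDeriv_smul (v : V) (c : ℂ) {f : V → ℂ} (hf : ContDiff ℝ ∞ f) :
    dirDeriv v (c • f) = c • dirDeriv v f := by
  funext x
  simp only [dirDeriv, Pi.smul_apply]
  rw [fderiv_const_smul (hf.differentiable (by simp) x)]
  rfl

theorem contDiff_iterate (v : V) (n : ℕ) {f : V → ℂ} (hf : ContDiff ℝ ∞ f) :
    ContDiff ℝ ∞ ((dirDeriv v)^[n] f) := by
  induction n with
  | zero => exact hf
  | succ n ih => rw [Function.iterate_succ_apply']; exact contDiff_dirDeriv v ih

theorem iterate_add (v : V) (n : ℕ) {f g : V → ℂ} (hf : ContDiff ℝ ∞ f) (hg : ContDiff ℝ ∞ g) :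
    (dirDeriv v)^[n] (f + g) = (dirDeriv v)^[n] f + (dirDeriv v)^[n] g := by
  induction n with
  | zero => rfl
  | succ n ih =>
    simp only [Function.iterate_succ_apply', ih]
    exact dirDeriv_add v (contDiff_iterate v n hf) (contDiff_iterate v n hg)

theorem iterate_smul (v : V) (n : ℕ) (c : ℂ) {f : V → ℂ} (hf : ContDiff ℝ ∞ f) :
    (dirDeriv v)^[n] (c • f) = c • (dirDeriv v)^[n] f := by
  induction n with
  | zero => rfl
  | succ n ih =>
    simp only [Function.iterate_succ_apply', ih]
    exact dirDeriv_smul v c (contDiff_iterate v n hf)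

theorem contDiff_foldr {d : ℕ} (e : Fin d → V) (α : Fin d → ℕ) (l : List (Fin d)) {f : V → ℂ}
    (hf : ContDiff ℝ ∞ f) :
    ContDiff ℝ ∞ (l.foldr (fun i g => (dirDeriv (e i))^[α i] g) f) := by
  induction l with
  | nil => exact hf
  | cons i l ih => exact contDiff_iterate _ _ ih

theorem multiDeriv_add {d : ℕ} (e : Fin d → V) (α : Fin d → ℕ) {f g : V → ℂ}
    (hf : ContDiff ℝ ∞ f) (hg : ContDiff ℝ ∞ g) :
    multiDeriv e α (f + g) = multiDeriv e α f + multiDeriv e α g := by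
  unfold multiDeriv
  induction List.finRange d with
  | nil => rfl
  | cons i l ih =>
    simp only [List.foldr_cons]
    rw [ih, iterate_add _ _ (contDiff_foldr e α l hf) (contDiff_foldr e α l hg)]

theorem multiDeriv_smul {d : ℕ} (e : Fin d → V) (α : Fin d → ℕ) (c : ℂ) {f : V → ℂ}
    (hf : ContDiff ℝ ∞ f) :
    multiDeriv e α (c • f) = c • multiDeriv e α f := by
  unfold multiDeriv
  induction List.finRange d with
  | nil => rfl
  | cons i l ih =>
    simp only [List.foldr_cons]
    rw [ih, iterate_smul _ _ _ (contDiff_foldr e α l hf)]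

theorem multiDeriv_zero_index {d : ℕ} (e : Fin d → V) (f : V → ℂ) :
    multiDeriv e 0 f = f := by
  unfold multiDeriv
  induction List.finRange d with
  | nil => rfl
  | cons i l ih => simp only [List.foldr_cons, ih]; rfl

end Derivatives

/-- The coordinate directions of `𝐑ᵈ`. -/
noncomputable def stdDir (d : ℕ) : Fin d → E d := fun i => EuclideanSpace.single i 1

/-! ### Gelfand–Shilov spaces -/

/-- `|x^α ∂^β f(x)| / (h^{|α|+|β|} α!^s β!^σ)`. -/
noncomputable def gsQuot {d : ℕ} (s σ h : ℝ) (f : E d → ℂ)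
    (p : (Fin d → ℕ) × (Fin d → ℕ) × E d) : ℝ :=
  |monom p.1 p.2.2| * ‖multiDeriv (stdDir d) p.2.1 f p.2.2‖ /
    (h ^ (len p.1 + len p.2.1) * fact p.1 ^ s * fact p.2.1 ^ σ)

/-- `f` is smooth and `|x^α ∂^β f(x)| ≤ C h^{|α|+|β|} α!^s β!^σ` for some constant `C`. -/
def IsGS {d : ℕ} (s σ h : ℝ) (f : E d → ℂ) : Prop :=
  ContDiff ℝ ∞ f ∧ BddAbove (Set.range (gsQuot s σ h f))

theorem fact_pos {d : ℕ} (α : Fin d → ℕ) : 0 < fact α :=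
  Finset.prod_pos fun i _ => by exact_mod_cast (α i).factorial_pos

theorem gsDenom_pos {d : ℕ} (s σ : ℝ) {h : ℝ} (hh : 0 < h) (α β : Fin d → ℕ) :
    0 < h ^ (len α + len β) * fact α ^ s * fact β ^ σ :=
  mul_pos (mul_pos (pow_pos hh _) (Real.rpow_pos_of_pos (fact_pos α) _))
    (Real.rpow_pos_of_pos (fact_pos β) _)

theorem gsQuot_nonneg {d : ℕ} (s σ : ℝ) {h : ℝ} (hh : 0 < h) (f : E d → ℂ)
    (p : (Fin d → ℕ) × (Fin d → ℕ) × E d) : 0 ≤ gsQuot s σ h f p :=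
  div_nonneg (by positivity) (gsDenom_pos s σ hh _ _).le

theorem gsQuot_add_le {d : ℕ} (s σ : ℝ) {h : ℝ} (hh : 0 < h) {f g : E d → ℂ}
    (hf : ContDiff ℝ ∞ f) (hg : ContDiff ℝ ∞ g) (p : (Fin d → ℕ) × (Fin d → ℕ) × E d) :
    gsQuot s σ h (f + g) p ≤ gsQuot s σ h f p + gsQuot s σ h g p := by
  unfold gsQuot
  rw [multiDeriv_add _ _ hf hg, ← add_div, ← mul_add]
  have := gsDenom_pos s σ hh p.1 p.2.1
  gcongr
  exact norm_add_le _ _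

theorem gsQuot_smul {d : ℕ} (s σ h : ℝ) (c : ℂ) {f : E d → ℂ}
    (hf : ContDiff ℝ ∞ f) (p : (Fin d → ℕ) × (Fin d → ℕ) × E d) :
    gsQuot s σ h (c • f) p = ‖c‖ * gsQuot s σ h f p := by
  unfold gsQuot
  rw [multiDeriv_smul _ _ _ hf, Pi.smul_apply, norm_smul]
  ring

theorem gsQuot_zero {d : ℕ} (s σ h : ℝ) (p : (Fin d → ℕ) × (Fin d → ℕ) × E d) :
    gsQuot s σ h (0 : E d → ℂ) p = 0 := by
  have := gsQuot_smul s σ h 0 (contDiff_const (c := (0 : ℂ))) p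
  simpa using this

theorem gsQuot_mono {d : ℕ} (s σ : ℝ) {h h' : ℝ} (hh : 0 < h) (hle : h ≤ h') (f : E d → ℂ)
    (p : (Fin d → ℕ) × (Fin d → ℕ) × E d) : gsQuot s σ h' f p ≤ gsQuot s σ h f p := by
  unfold gsQuot
  have := gsDenom_pos s σ hh p.1 p.2.1
  have h1 := (Real.rpow_pos_of_pos (fact_pos p.1) s).le
  have h2 := (Real.rpow_pos_of_pos (fact_pos p.2.1) σ).le
  gcongr

theorem IsGS.add {d : ℕ} {s σ h : ℝ} (hh : 0 < h) {f g : E d → ℂ} (hf : IsGS s σ h f)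
    (hg : IsGS s σ h g) : IsGS s σ h (f + g) := by
  obtain ⟨B, hB⟩ := hf.2
  obtain ⟨C, hC⟩ := hg.2
  refine ⟨hf.1.add hg.1, B + C, ?_⟩
  rintro _ ⟨p, rfl⟩
  exact (gsQuot_add_le s σ hh hf.1 hg.1 p).trans (add_le_add (hB ⟨p, rfl⟩) (hC ⟨p, rfl⟩))

theorem IsGS.smul {d : ℕ} {s σ h : ℝ} (c : ℂ) {f : E d → ℂ} (hf : IsGS s σ h f) :
    IsGS s σ h (c • f) := by
  obtain ⟨B, hB⟩ := hf.2
  refine ⟨hf.1.const_smul c, ‖c‖ * B, ?_⟩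
  rintro _ ⟨p, rfl⟩
  rw [gsQuot_smul _ _ _ _ hf.1]
  exact mul_le_mul_of_nonneg_left (hB ⟨p, rfl⟩) (norm_nonneg c)

theorem isGS_zero {d : ℕ} (s σ h : ℝ) : IsGS s σ h (0 : E d → ℂ) := by
  refine ⟨contDiff_const, 0, ?_⟩
  rintro _ ⟨p, rfl⟩
  rw [gsQuot_zero]

theorem IsGS.mono {d : ℕ} {s σ h h' : ℝ} (hh : 0 < h) (hle : h ≤ h') {f : E d → ℂ}
    (hf : IsGS s σ h f) : IsGS s σ h' f := by
  obtain ⟨B, hB⟩ := hf.2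
  refine ⟨hf.1, B, ?_⟩
  rintro _ ⟨p, rfl⟩
  exact (gsQuot_mono s σ hh hle f p).trans (hB ⟨p, rfl⟩)

/-- The functions of `𝒮_{s;h}^σ(𝐑ᵈ)`, as a space of functions without topology. -/
def stepSubmodule (d : ℕ) (s σ : ℝ) (h : Set.Ioi (0 : ℝ)) : Submodule ℂ (E d → ℂ) where
  carrier := {f | IsGS s σ h f}
  add_mem' hf hg := IsGS.add h.2 hf hg
  zero_mem' := isGS_zero s σ h
  smul_mem' c _ hf := IsGS.smul c hf

/-- The functions of `𝒮_s^σ(𝐑ᵈ) = ⋃_{h>0} 𝒮_{s;h}^σ(𝐑ᵈ)`, without topology. -/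
def gsSubmodule (d : ℕ) (s σ : ℝ) : Submodule ℂ (E d → ℂ) where
  carrier := {f | ∃ h : ℝ, 0 < h ∧ IsGS s σ h f}
  add_mem' := by
    rintro f g ⟨h, hh, hf⟩ ⟨k, hk, hg⟩
    exact ⟨max h k, lt_max_of_lt_left hh, IsGS.add (lt_max_of_lt_left hh)
      (hf.mono hh (le_max_left _ _)) (hg.mono hk (le_max_right _ _))⟩
  zero_mem' := ⟨1, one_pos, isGS_zero s σ 1⟩
  smul_mem' c f := fun ⟨h, hh, hf⟩ => ⟨h, hh, IsGS.smul c hf⟩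

/-- The Banach space `𝒮_{s;h}^σ(𝐑ᵈ)`. -/
def Step (d : ℕ) (s σ : ℝ) (h : Set.Ioi (0 : ℝ)) : Type := ↥(stepSubmodule d s σ h)

/-- The Gelfand–Shilov space `𝒮_s^σ(𝐑ᵈ)`. -/
def Space (d : ℕ) (s σ : ℝ) : Type := ↥(gsSubmodule d s σ)

section Instances

variable {d : ℕ} {s σ : ℝ} {h : Set.Ioi (0 : ℝ)}

noncomputable instance : AddCommGroup (Step d s σ h) :=
  inferInstanceAs (AddCommGroup ↥(stepSubmodule d s σ h))
noncomputable instance : Module ℂ (Step d s σ h) :=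
  inferInstanceAs (Module ℂ ↥(stepSubmodule d s σ h))
noncomputable instance : AddCommGroup (Space d s σ) :=
  inferInstanceAs (AddCommGroup ↥(gsSubmodule d s σ))
noncomputable instance : Module ℂ (Space d s σ) :=
  inferInstanceAs (Module ℂ ↥(gsSubmodule d s σ))
noncomputable instance : Module ℝ (Space d s σ) :=
  inferInstanceAs (Module ℝ ↥(gsSubmodule d s σ))
instance : IsScalarTower ℝ ℂ (Space d s σ) :=
  inferInstanceAs (IsScalarTower ℝ ℂ ↥(gsSubmodule d s σ))

instance : CoeFun (Step d s σ h) (fun _ => E d → ℂ) := ⟨fun f => Subtype.val f⟩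
instance : CoeFun (Space d s σ) (fun _ => E d → ℂ) := ⟨fun f => Subtype.val f⟩

/-- `‖f‖ = sup_{α, β, x} |x^α ∂^β f(x)| / (h^{|α|+|β|} α!^s β!^σ)`. -/
noncomputable instance : Norm (Step d s σ h) := ⟨fun f => ⨆ p, gsQuot s σ h f p⟩

theorem Step.norm_def (f : Step d s σ h) : ‖f‖ = ⨆ p, gsQuot s σ h f p := rfl

theorem Step.gsQuot_le (f : Step d s σ h) (p : (Fin d → ℕ) × (Fin d → ℕ) × E d) :
    gsQuot s σ h f p ≤ ‖f‖ := le_ciSup f.2.2 p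

theorem Step.core (d : ℕ) (s σ : ℝ) (h : Set.Ioi (0 : ℝ)) :
    NormedSpace.Core ℂ (Step d s σ h) where
  norm_nonneg f := Real.iSup_nonneg fun p => gsQuot_nonneg s σ h.2 _ p
  norm_smul c f := by
    rw [Step.norm_def, Step.norm_def, Real.mul_iSup_of_nonneg (norm_nonneg c)]
    exact iSup_congr fun p => gsQuot_smul s σ h c f.2.1 p
  norm_triangle f g := ciSup_le fun p =>
    (gsQuot_add_le s σ h.2 f.2.1 g.2.1 p).trans (add_le_add (f.gsQuot_le p) (g.gsQuot_le p))
  norm_eq_zero_iff f := by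
    constructor
    · intro hf
      refine Subtype.ext (funext fun x => ?_)
      have h1 := f.gsQuot_le (0, 0, x)
      rw [hf] at h1
      simp only [gsQuot, multiDeriv_zero_index, monom, fact, len] at h1
      have h2 : f x = 0 := by simpa using h1
      exact h2
    · rintro rfl
      rw [Step.norm_def]
      have : ∀ p, gsQuot s σ h ((0 : Step d s σ h) : E d → ℂ) p = 0 := gsQuot_zero s σ h
      simp [this]

noncomputable instance : NormedAddCommGroup (Step d s σ h) :=
  NormedAddCommGroup.ofCore (Step.core d s σ h)
noncomputable instance : NormedSpace ℂ (Step d s σ h) :=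
  NormedSpace.ofCore (Step.core d s σ h)

end Instances

/-- The inclusion `𝒮_{s;h}^σ(𝐑ᵈ) → 𝒮_s^σ(𝐑ᵈ)`. -/
def incl (d : ℕ) (s σ : ℝ) (h : Set.Ioi (0 : ℝ)) : Step d s σ h →ₗ[ℂ] Space d s σ where
  toFun f := ⟨f, h, h.2, f.2⟩
  map_add' _ _ := rfl
  map_smul' _ _ := rfl

/-- The (locally convex) inductive limit topology: the strongest locally convex vector space
topology on `𝒮_s^σ(𝐑ᵈ)` for which the inclusions of `𝒮_{s;h}^σ(𝐑ᵈ)`, `h > 0`, are continuous. -/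
noncomputable instance (d : ℕ) (s σ : ℝ) : TopologicalSpace (Space d s σ) :=
  sInf {t | (∀ h, Continuous[inferInstance, t] (incl d s σ h)) ∧
    @IsTopologicalAddGroup _ t _ ∧ @ContinuousSMul ℂ _ _ _ t ∧ @LocallyConvexSpace ℝ _ _ _ _ _ t}

section Topology

variable {d : ℕ} {s σ : ℝ}

instance : IsTopologicalAddGroup (Space d s σ) := topologicalAddGroup_sInf fun _ ht => ht.2.1
instance : ContinuousSMul ℂ (Space d s σ) := continuousSMul_sInf fun _ ht => ht.2.2.1
instance : LocallyConvexSpace ℝ (Space d s σ) := .sInf fun _ ht => ht.2.2.2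

theorem continuous_incl (h : Set.Ioi (0 : ℝ)) : Continuous (incl d s σ h) := by
  rw [continuous_sInf_rng]
  exact fun t ht => ht.1 h

theorem continuous_of_comp_incl {F : Type*} [AddCommGroup F] [Module ℂ F] [Module ℝ F]
    [IsScalarTower ℝ ℂ F] [t : TopologicalSpace F] [IsTopologicalAddGroup F] [ContinuousSMul ℂ F]
    [LocallyConvexSpace ℝ F] (L : Space d s σ →ₗ[ℂ] F)
    (hL : ∀ h, Continuous (L ∘ₗ incl d s σ h)) : Continuous L := by
  rw [continuous_iff_le_induced]
  refine sInf_le ⟨fun h => ?_, topologicalAddGroup_induced L, continuousSMul_induced L,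
    LocallyConvexSpace.induced (L.restrictScalars ℝ)⟩
  rw [continuous_induced_rng]
  exact hL h

end Topology

/-! ### The embedding into the dual -/

section Embedding

variable {d : ℕ} {s σ : ℝ}

theorem monom_single (n : ℕ) (i : Fin d) (x : E d) : monom (Pi.single i n) x = x i ^ n := by
  unfold monom
  rw [Finset.prod_eq_single i]
  · simp
  · intro j _ hj
    simp [hj]
  · simp

theorem exists_monom_bound (f : Space d s σ) (α : Fin d → ℕ) :
    ∃ C : ℝ, ∀ x, |monom α x| * ‖f x‖ ≤ C := by
  obtain ⟨h, hh, hf⟩ := f.2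
  obtain ⟨B, hB⟩ := hf.2
  refine ⟨B * (h ^ (len α + len (0 : Fin d → ℕ)) * fact α ^ s * fact (0 : Fin d → ℕ) ^ σ),
    fun x => ?_⟩
  have := hB ⟨(α, 0, x), rfl⟩
  simp only [gsQuot, multiDeriv_zero_index] at this
  rwa [div_le_iff₀ (gsDenom_pos s σ hh _ _)] at this

theorem Space.continuous_coe (f : Space d s σ) : Continuous (f : E d → ℂ) := by
  obtain ⟨h, hh, hf⟩ := f.2
  exact hf.1.continuous

theorem Space.integrable (f : Space d s σ) : Integrable (f : E d → ℂ) := by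
  have hx : ∀ x : E d, ‖x‖ ≤ ∑ i, |x i| := by
    intro x
    calc ‖x‖ = ‖∑ i, x i • EuclideanSpace.single i (1 : ℝ)‖ := by
          congr 1
          ext j
          simp [Finset.sum_apply, Pi.single_apply]
      _ ≤ ∑ i, ‖x i • EuclideanSpace.single i (1 : ℝ)‖ := norm_sum_le _ _
      _ = ∑ i, |x i| := by simp [norm_smul]
  choose C hC using fun i => exists_monom_bound f (Pi.single i (d + 1))
  obtain ⟨C0, hC0⟩ := exists_monom_bound f 0
  have hC0' : ∀ x, ‖f x‖ ≤ C0 := by simpa [monom] using hC0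
  have hC' : ∀ i x, |x i| ^ (d + 1) * ‖f x‖ ≤ C i := by
    intro i x
    have := hC i x
    rwa [monom_single, abs_pow] at this
  set K : ℝ := 2 ^ d * (C0 + d ^ d * ∑ i, C i) with hK
  have key : ∀ x, (1 + ‖x‖) ^ (d + 1) * ‖f x‖ ≤ K := by
    intro x
    have h1 : (1 + ‖x‖) ^ (d + 1) ≤ 2 ^ d * (1 + ‖x‖ ^ (d + 1)) := by
      simpa using add_pow_le (zero_le_one' ℝ) (norm_nonneg x) (d + 1)
    have h2 : ‖x‖ ^ (d + 1) ≤ d ^ d * ∑ i, |x i| ^ (d + 1) := by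
      refine (pow_le_pow_left₀ (norm_nonneg x) (hx x) _).trans ?_
      simpa using pow_sum_le_card_mul_sum_pow (s := Finset.univ) (f := fun i => |x i|)
        (fun i _ => abs_nonneg (x i)) d
    calc (1 + ‖x‖) ^ (d + 1) * ‖f x‖
        ≤ (2 ^ d * (1 + d ^ d * ∑ i, |x i| ^ (d + 1))) * ‖f x‖ := by
          gcongr
          exact h1.trans (by gcongr)
      _ = 2 ^ d * (‖f x‖ + d ^ d * ∑ i, |x i| ^ (d + 1) * ‖f x‖) := by
          rw [← Finset.sum_mul]; ring
      _ ≤ K := by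
          rw [hK]
          gcongr with i
          · exact hC0' x
          · exact hC' i x
  have hint : Integrable (fun x : E d => K * (1 + ‖x‖) ^ (-((d : ℝ) + 1))) :=
    (integrable_one_add_norm (by simp)).const_mul K
  refine hint.mono' f.continuous_coe.aestronglyMeasurable (Filter.Eventually.of_forall fun x => ?_)
  have hpos : (0 : ℝ) < 1 + ‖x‖ := by positivity
  rw [Real.rpow_neg hpos.le, ← div_eq_mul_inv, le_div_iff₀ (Real.rpow_pos_of_pos hpos _)]
  have : ((d : ℝ) + 1) = ((d + 1 : ℕ) : ℝ) := by push_cast; ring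
  rw [this, Real.rpow_natCast, mul_comm]
  exact key x

theorem Step.norm_apply_le {h : Set.Ioi (0 : ℝ)} (g : Step d s σ h) (x : E d) :
    ‖g x‖ ≤ ‖g‖ := by
  have := g.gsQuot_le (0, 0, x)
  simp only [gsQuot, multiDeriv_zero_index, monom, fact, len] at this
  simpa using this

theorem Space.integrable_mul (f g : Space d s σ) : Integrable (fun x => f x * g x) := by
  obtain ⟨C, hC⟩ := exists_monom_bound g 0
  exact f.integrable.mul_bdd (c := C) g.continuous_coe.aestronglyMeasurable
    (Filter.Eventually.of_forall fun x => by simpa [monom] using hC x)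

/-- The linear form `g ↦ ∫ f(x) g(x) dx`. -/
noncomputable def pairing (f : Space d s σ) : Space d s σ →ₗ[ℂ] ℂ where
  toFun g := ∫ x, f x * g x
  map_add' g₁ g₂ := by
    rw [← integral_add (f.integrable_mul g₁) (f.integrable_mul g₂)]
    exact integral_congr_ae (Filter.Eventually.of_forall fun x => mul_add _ _ _)
  map_smul' c g := by
    rw [RingHom.id_apply, smul_eq_mul, ← integral_const_mul]
    exact integral_congr_ae (Filter.Eventually.of_forall fun x => mul_left_comm _ _ _)

theorem continuous_pairing (f : Space d s σ) : Continuous (pairing f) := by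
  refine continuous_of_comp_incl _ fun h => ?_
  refine AddMonoidHomClass.continuous_of_bound _ (∫ x, ‖f x‖) fun g => ?_
  calc ‖∫ x, f x * g x‖ ≤ ∫ x, ‖f x‖ * ‖g‖ := by
        refine norm_integral_le_of_norm_le (f.integrable.norm.mul_const _)
          (Filter.Eventually.of_forall fun x => ?_)
        rw [norm_mul]
        exact mul_le_mul_of_nonneg_left (g.norm_apply_le x) (norm_nonneg _)
    _ = (∫ x, ‖f x‖) * ‖g‖ := integral_mul_const _ _

/-- The embedding of `𝒮_s^σ` into its dual: `f` acts by `g ↦ ∫ f(x) g(x) dx`. -/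
noncomputable def toDual (f : Space d s σ) : StrongDual ℂ (Space d s σ) :=
  ⟨pairing f, continuous_pairing f⟩

end Embedding

/-! ### Symbols and pseudo-differential operators -/

/-- The directions of the first (space) variable of `𝐑ᵈ × 𝐑ᵈ`. -/
noncomputable def dirX (d : ℕ) : Fin d → E d × E d := fun i => (stdDir d i, 0)

/-- The directions of the second (frequency) variable of `𝐑ᵈ × 𝐑ᵈ`. -/
noncomputable def dirXi (d : ℕ) : Fin d → E d × E d := fun i => (0, stdDir d i)

/-- The symbol class `Γ_{s,σ;0}^{σ,s}(𝐑²ᵈ)`: smooth `a` such that for some `h > 0` and every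
`r > 0`, `|∂_x^α ∂_ξ^β a(x,ξ)| ≤ C h^{|α|+|β|} α!^σ β!^s exp(r(|x|^{1/s} + |ξ|^{1/σ}))`. -/
def IsSymbol {d : ℕ} (s σ : ℝ) (a : E d × E d → ℂ) : Prop :=
  ContDiff ℝ ∞ a ∧ ∃ h : ℝ, 0 < h ∧ ∀ r : ℝ, 0 < r → ∃ C : ℝ,
    ∀ (α β : Fin d → ℕ) (x ξ : E d),
      ‖multiDeriv (dirX d) α (multiDeriv (dirXi d) β a) (x, ξ)‖ ≤
        C * (h ^ (len α + len β) * fact α ^ σ * fact β ^ s *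
          Real.exp (r * (‖x‖ ^ (1 / s) + ‖ξ‖ ^ (1 / σ))))

/-- The inverse Fourier transform with respect to the second variable,
`(ℱ₂⁻¹Φ)(z,ξ) = (2π)^{-d/2} ∫ Φ(z,w) e^{i⟨w,ξ⟩} dw`. -/
noncomputable def invFourier₂ {d : ℕ} (Φ : E d × E d → ℂ) (p : E d × E d) : ℂ :=
  (((2 * Real.pi) ^ (-(d : ℝ) / 2) : ℝ) : ℂ) *
    ∫ w : E d, Φ (p.1, w) * Complex.exp (Complex.I * (inner ℝ w p.2 : ℝ))

/-- `Ψ ∘ κ⁻¹`, where `κ(x,y) = (x - A(x-y), x-y)`, so that `κ⁻¹(z,w) = (z + Aw, z + Aw - w)`.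
The map `κ` preserves Lebesgue measure. -/
noncomputable def pull {d : ℕ} (A : Matrix (Fin d) (Fin d) ℝ) (Ψ : E d × E d → ℂ) :
    E d × E d → ℂ :=
  fun p => Ψ (p.1 + A.toEuclideanLin p.2, p.1 + A.toEuclideanLin p.2 - p.2)

/-- The action `⟨K, Ψ⟩` on a test function `Ψ` of the distribution kernel
`K(x,y) = (2π)^{-d/2} (ℱ₂⁻¹a)(x - A(x-y), x-y)` of `Op_A(a)`, with the partial Fourier transform
and the linear change of variables of a distribution defined by transposition. -/
noncomputable def kernelAction {d : ℕ} (A : Matrix (Fin d) (Fin d) ℝ) (a Ψ : E d × E d → ℂ) : ℂ :=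
  (((2 * Real.pi) ^ (-(d : ℝ) / 2) : ℝ) : ℂ) *
    ∫ p : E d × E d, a p * invFourier₂ (pull A Ψ) p

/-- `⟨Op_A(a)f, g⟩ = ⟨K, g ⊗ f⟩`: the value at the test function `g` of the distribution
`Op_A(a)f`. -/
noncomputable def opAction {d : ℕ} (A : Matrix (Fin d) (Fin d) ℝ) (a : E d × E d → ℂ)
    (f g : E d → ℂ) : ℂ :=
  kernelAction A a (fun q => g q.1 * f q.2)

/-- `κ(x,y) = (x - A(x-y), x-y)` is inverse to the map used in `pull`. -/
theorem pull_apply {d : ℕ} (A : Matrix (Fin d) (Fin d) ℝ) (Ψ : E d × E d → ℂ) (x y : E d) :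
    pull A Ψ (x - A.toEuclideanLin (x - y), x - y) = Ψ (x, y) := by
  simp [pull]

end GelfandShilov

namespace GelfandShilov

open MeasureTheory
open scoped ContDiff Topology

/-! ### Scalar estimates -/

/-! The change of variables z = x - Aw in the action of the kernel leads to the formula
(Op_A(a)f)(x) = (2π)^{-d} ∫ (∫ a(x - Aw, ξ) f(x - w) e^{i⟨w,ξ⟩} dw) dξ, an iterated integral. The
inner integral is `ampl`, the whole expression is `opFun`.

Convergence. A function lies in the Gelfand–Shilov space exactly when its derivatives satisfy Gevrey
bounds of order σ with a common factor e^{-c|x|^{1/s}} (`gsBound_of_gsQuot_le`,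
`GSBound.gsQuot_le`). The w-derivatives of order n of a(x - Aw, ξ) f(x - w) are then of size H^n
n!^σ, and integration by parts gives decay e^{-ρ|ξ|^{1/σ}} of the inner integral, where ρ depends on
H but not on the growth exponent r of the symbol (`norm_ampl_le`). The symbol class fixes h before
r, so r can be taken small compared with c and ρ afterwards, and the growth of a is absorbed. What
remains is a bound of Op_A(a)f by C e^{ε|x|^{1/s}}, with ε as small as desired.

Decay. It comes from two commutation rules, ∂_i Op(b)g = Op(∂_{x_i}b)g + Op(b)∂_i g
(`differentiable_opFun`) and x_i Op(b)g = i Op(∂_{ξ_i}b)g + Op(b)(x_i g) (`coord_mul_opFun`). By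
iteration, x_j^k ∂^L Op(a)f is a sum of 2^{k+|L|} terms of the same kind, each bounded by a
geometric factor times k!^s |L|!^σ e^{ε|x|^{1/s}}. Such moments force a factor e^{-R|x|^{1/s}} with
R independent of ε, which beats the growth once ε ≤ R/2 (`exists_gsBound_opFun`). The bounds are
linear in the constant of f, so each step space is mapped boundedly into another one, and continuity
for the inductive limit follows.

Duality. Fubini's theorem identifies ∫ (Op_A(a)f) g with the action of the kernel
(`integral_opFun_mul`). Exchanging f and g in that action replaces A by I - A and a(z, ξ) by a(z,
-ξ) (`opPair_transpose`), so the transposed operator belongs to the same class. Its adjoint is the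
operator on the dual. -/

/-- The rate of exponential decay obtained from moments growing like `H ^ n * n! ^ s`. -/
noncomputable def rate (s H : ℝ) : ℝ := s / 2 * (1 / H) ^ (1 / s)

theorem rate_pos {s H : ℝ} (hs : 0 < s) (hH : 0 < H) : 0 < rate s H := by
  unfold rate; positivity

/-- With u = (t/H)^{1/s}, the s-th root of the hypothesis reads (u^n/n!) M^{1/s} ≤ X^{1/s}.
Weighting by 2^{-n} and summing over n gives e^{u/2} M^{1/s} ≤ 2 X^{1/s}, and the s-th power of this
is the claim. The weights account for the 1/2 in `rate` and for the factor 2^s. -/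
theorem le_exp_of_moments {s H t M X : ℝ} (hs : 0 < s) (hH : 0 < H) (ht : 0 ≤ t) (hM : 0 ≤ M)
    (hm : ∀ n : ℕ, t ^ n * M ≤ X * (H ^ n * (n.factorial : ℝ) ^ s)) :
    M ≤ X * 2 ^ s * Real.exp (-rate s H * t ^ (1 / s)) := by
  have hX : 0 ≤ X := by simpa using hM.trans (by simpa using hm 0)
  set u := (t / H) ^ (1 / s) with hu
  have hu0 : 0 ≤ u := by positivity
  have hus : u ^ s = t / H := by
    rw [hu, ← Real.rpow_mul (by positivity), one_div_mul_cancel hs.ne', Real.rpow_one]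
  have hrate : rate s H * t ^ (1 / s) = s * (u / 2) := by
    rw [hu, rate, div_eq_mul_one_div t H, Real.mul_rpow ht (by positivity)]; ring
  have h1 : ∀ n : ℕ, u ^ n / n.factorial * M ^ (1 / s) ≤ X ^ (1 / s) := by
    intro n
    have hf : (0 : ℝ) < n.factorial := by exact_mod_cast n.factorial_pos
    have h2 : (u ^ n / n.factorial) ^ s * M ≤ X := by
      rw [Real.div_rpow (by positivity) hf.le, ← Real.rpow_natCast u n, ← Real.rpow_mul hu0,
        mul_comm (n : ℝ) s, Real.rpow_mul hu0, hus, Real.rpow_natCast, div_pow, div_mul_eq_mul_div,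
        div_le_iff₀ (by positivity), div_mul_eq_mul_div, div_le_iff₀ (by positivity)]
      calc t ^ n * M ≤ _ := hm n
        _ = _ := by ring
    have h3 := Real.rpow_le_rpow (by positivity) h2 (by positivity : 0 ≤ 1 / s)
    rwa [Real.mul_rpow (by positivity) hM, ← Real.rpow_mul (by positivity),
      mul_one_div_cancel hs.ne', Real.rpow_one] at h3
  have h4 : Real.exp (u / 2) * M ^ (1 / s) ≤ 2 * X ^ (1 / s) := by
    have hsum : HasSum (fun n : ℕ => (u / 2) ^ n / n.factorial * M ^ (1 / s))
        (Real.exp (u / 2) * M ^ (1 / s)) := by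
      refine HasSum.mul_right _ ?_
      rw [Real.exp_eq_exp_ℝ]
      exact NormedSpace.expSeries_div_hasSum_exp (u / 2)
    have hgeo : HasSum (fun n : ℕ => (1 / 2 : ℝ) ^ n * X ^ (1 / s)) (2 * X ^ (1 / s)) :=
      hasSum_geometric_two.mul_right _
    refine hasSum_le (fun n => ?_) hsum hgeo
    calc (u / 2) ^ n / n.factorial * M ^ (1 / s)
        = (1 / 2 : ℝ) ^ n * (u ^ n / n.factorial * M ^ (1 / s)) := by
          rw [div_pow, div_pow, one_pow]; ring
      _ ≤ _ := by gcongr; exact h1 n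
  have h5 := Real.rpow_le_rpow (by positivity) h4 hs.le
  rw [Real.mul_rpow (by positivity) (by positivity), Real.mul_rpow (by positivity) (by positivity),
    ← Real.rpow_mul hM, ← Real.rpow_mul hX, one_div_mul_cancel hs.ne', Real.rpow_one, Real.rpow_one,
    ← Real.exp_mul] at h5
  rw [neg_mul, hrate, Real.exp_neg, ← div_eq_mul_inv, le_div_iff₀ (Real.exp_pos _)]
  calc M * Real.exp (s * (u / 2)) = Real.exp (u / 2 * s) * M := by ring_nf
    _ ≤ _ := h5
    _ = _ := by ring

/-- Converse tool: u^k/k! ≤ e^u raised to the power s, where u = (c/s) t^{1/s} is chosen so that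
(e^u)^s = e^{c t^{1/s}}. -/
theorem pow_le_factorial_mul_exp {s c t : ℝ} (hs : 0 < s) (hc : 0 < c) (ht : 0 ≤ t) (k : ℕ) :
    t ^ k ≤ ((s / c) ^ s) ^ k * (k.factorial : ℝ) ^ s * Real.exp (c * t ^ (1 / s)) := by
  set u := c / s * t ^ (1 / s) with hu
  have hu0 : 0 ≤ u := by positivity
  have hus : u ^ s * (s / c) ^ s = t := by
    rw [← Real.mul_rpow hu0 (by positivity), hu]
    have : c / s * t ^ (1 / s) * (s / c) = t ^ (1 / s) := by field_simp
    rw [this, ← Real.rpow_mul ht, one_div_mul_cancel hs.ne', Real.rpow_one]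
  have hf : (0 : ℝ) < k.factorial := by exact_mod_cast k.factorial_pos
  have h1 := Real.pow_div_factorial_le_exp u hu0 k
  rw [div_le_iff₀ hf] at h1
  have h2 := Real.rpow_le_rpow (by positivity) h1 hs.le
  rw [Real.mul_rpow (by positivity) hf.le, ← Real.exp_mul, ← Real.rpow_natCast u k,
    ← Real.rpow_mul hu0, mul_comm (k : ℝ) s, Real.rpow_mul hu0, Real.rpow_natCast] at h2
  have h3 : u * s = c * t ^ (1 / s) := by rw [hu]; field_simp
  rw [h3] at h2
  calc t ^ k = ((s / c) ^ s) ^ k * (u ^ s) ^ k := by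
        rw [← mul_pow, mul_comm, hus]
    _ ≤ ((s / c) ^ s) ^ k * (Real.exp (c * t ^ (1 / s)) * (k.factorial : ℝ) ^ s) := by gcongr
    _ = _ := by ring

/-- Since t ↦ t^{1/s} is not subadditive for s < 1, the sum is replaced by twice the maximum. -/
theorem rpow_le_of_le_mul_add {s K t a b : ℝ} (hs : 0 < s) (hK : 0 ≤ K) (ht : 0 ≤ t) (ha : 0 ≤ a)
    (hb : 0 ≤ b) (h : t ≤ K * (a + b)) :
    t ^ (1 / s) ≤ (2 * K) ^ (1 / s) * (a ^ (1 / s) + b ^ (1 / s)) := by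
  have hm : t ≤ 2 * K * max a b := by
    have := le_max_left a b
    have := le_max_right a b
    nlinarith
  calc t ^ (1 / s) ≤ (2 * K * max a b) ^ (1 / s) := Real.rpow_le_rpow ht hm (by positivity)
    _ = (2 * K) ^ (1 / s) * max a b ^ (1 / s) :=
        Real.mul_rpow (by positivity) (le_max_of_le_left ha)
    _ ≤ _ := by
        gcongr
        rcases max_choice a b with h | h <;> rw [h]
        · exact le_add_of_nonneg_right (by positivity)
        · exact le_add_of_nonneg_left (by positivity)

/-- `n! ^ s` as a real number. -/
noncomputable def facPow (s : ℝ) (n : ℕ) : ℝ := (n.factorial : ℝ) ^ s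

theorem facPow_pos (s : ℝ) (n : ℕ) : 0 < facPow s n :=
  Real.rpow_pos_of_pos (by exact_mod_cast n.factorial_pos) s

@[simp] theorem facPow_zero (s : ℝ) : facPow s 0 = 1 := by simp [facPow]

theorem facPow_mul_le {s : ℝ} (hs : 0 < s) (m n : ℕ) :
    facPow s m * facPow s n ≤ facPow s (m + n) := by
  unfold facPow
  rw [← Real.mul_rpow (by positivity) (by positivity)]
  refine Real.rpow_le_rpow (by positivity) ?_ hs.le
  exact_mod_cast Nat.le_of_dvd (Nat.factorial_pos _) (Nat.factorial_mul_factorial_dvd_factorial_add m n)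

/-- A binomial coefficient of order m + n is at most 2^{m+n}. This is the price of separating the
derivatives already taken from those still to come. -/
theorem facPow_add_le {s : ℝ} (hs : 0 < s) (m n : ℕ) :
    facPow s (m + n) ≤ (2 ^ s) ^ (m + n) * (facPow s m * facPow s n) := by
  unfold facPow
  rw [← Real.mul_rpow (by positivity) (by positivity), ← Real.rpow_natCast (2 ^ s),
    ← Real.rpow_mul (by positivity), mul_comm s, Real.rpow_mul (by positivity), Real.rpow_natCast,
    ← Real.mul_rpow (by positivity) (by positivity)]
  refine Real.rpow_le_rpow (by positivity) ?_ hs.le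
  have h1 := Nat.add_choose_mul_factorial_mul_factorial m n
  have h2 := Nat.choose_le_two_pow (m + n) n
  have : (m + n).factorial ≤ 2 ^ (m + n) * (m.factorial * n.factorial) := by
    rw [← h1, mul_assoc]
    gcongr
  exact_mod_cast this

/-- The exponential is dominated by a multiple of (1 + |x|)^{-(d+1)}, by the case k = d + 1 of
`pow_le_factorial_mul_exp`. -/
theorem integrable_exp_neg_rpow {d : ℕ} {s c : ℝ} (hs : 0 < s) (hc : 0 < c) :
    Integrable (fun x : E d => Real.exp (-c * ‖x‖ ^ (1 / s))) := by
  set K : ℝ := 2 ^ d * (1 + ((s / c) ^ s) ^ (d + 1) * ((d + 1).factorial : ℝ) ^ s)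
  have hint : Integrable (fun x : E d => K * (1 + ‖x‖) ^ (-((d : ℝ) + 1))) :=
    (integrable_one_add_norm (by simp)).const_mul K
  have hcont : Continuous (fun x : E d => Real.exp (-c * ‖x‖ ^ (1 / s))) :=
    Real.continuous_exp.comp (continuous_const.mul
      (continuous_norm.rpow_const fun x => Or.inr (by positivity)))
  refine hint.mono' hcont.aestronglyMeasurable (Filter.Eventually.of_forall fun x => ?_)
  have hpos : (0 : ℝ) < 1 + ‖x‖ := by positivity
  rw [Real.norm_of_nonneg (Real.exp_pos _).le, Real.rpow_neg hpos.le, ← div_eq_mul_inv,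
    le_div_iff₀ (Real.rpow_pos_of_pos hpos _)]
  have : ((d : ℝ) + 1) = ((d + 1 : ℕ) : ℝ) := by push_cast; ring
  rw [this, Real.rpow_natCast, mul_comm, neg_mul, Real.exp_neg, ← div_eq_mul_inv,
    div_le_iff₀ (Real.exp_pos _)]
  have h1 : (1 + ‖x‖) ^ (d + 1) ≤ 2 ^ d * (1 + ‖x‖ ^ (d + 1)) := by
    simpa using add_pow_le (zero_le_one' ℝ) (norm_nonneg x) (d + 1)
  have h2 := pow_le_factorial_mul_exp hs hc (norm_nonneg x) (d + 1)
  have h3 : 1 ≤ Real.exp (c * ‖x‖ ^ (1 / s)) := Real.one_le_exp (by positivity)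
  calc (1 + ‖x‖) ^ (d + 1) ≤ 2 ^ d * (1 + ‖x‖ ^ (d + 1)) := h1
    _ ≤ 2 ^ d * (Real.exp (c * ‖x‖ ^ (1 / s)) +
        ((s / c) ^ s) ^ (d + 1) * ((d + 1).factorial : ℝ) ^ s * Real.exp (c * ‖x‖ ^ (1 / s))) := by
        gcongr
    _ = _ := by simp only [K]; ring

/-- The largest coordinate controls the norm. The alternative x = 0 takes care of d = 0, where no
coordinate exists, and d + 1 in place of d keeps the factor positive. -/
theorem norm_le_mul_coord {d : ℕ} (x : E d) : x = 0 ∨ ∃ i, ‖x‖ ≤ (d + 1) * |x i| := by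
  rcases isEmpty_or_nonempty (Fin d) with he | hne
  · left; ext i; exact he.elim i
  · right
    obtain ⟨i, hi⟩ := Finite.exists_max fun i => |x i|
    refine ⟨i, ?_⟩
    calc ‖x‖ = ‖∑ i, x i • EuclideanSpace.single i (1 : ℝ)‖ := by
          congr 1
          ext j
          simp [Finset.sum_apply, Pi.single_apply]
      _ ≤ ∑ i, ‖x i • EuclideanSpace.single i (1 : ℝ)‖ := norm_sum_le _ _
      _ = ∑ i, |x i| := by simp [norm_smul]
      _ ≤ ∑ _j : Fin d, |x i| := Finset.sum_le_sum fun j _ => hi j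
      _ = d * |x i| := by simp
      _ ≤ _ := by gcongr; simp

/-- The moments of the norm reduce to those of its dominant coordinate. The bound `h0` is required
separately because `hm` is empty when d = 0. -/
theorem le_exp_of_coord_moments {d : ℕ} {s H M X : ℝ} (hs : 0 < s) (hH : 0 < H) (x : E d)
    (hM : 0 ≤ M) (h0 : M ≤ X) (hm : ∀ (i : Fin d) (n : ℕ), |x i| ^ n * M ≤ X * (H ^ n * facPow s n)) :
    M ≤ X * 2 ^ s * Real.exp (-rate s ((d + 1) * H) * ‖x‖ ^ (1 / s)) := by
  refine le_exp_of_moments hs (by positivity) (norm_nonneg x) hM fun n => ?_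
  have hX := hM.trans h0
  rcases norm_le_mul_coord x with rfl | ⟨i, hi⟩
  · rcases n with _ | n
    · simpa using h0
    · simp only [norm_zero, zero_pow (Nat.succ_ne_zero n), zero_mul]; positivity
  · calc ‖x‖ ^ n * M ≤ ((d + 1) * |x i|) ^ n * M := by gcongr
      _ = (d + 1) ^ n * (|x i| ^ n * M) := by rw [mul_pow]; ring
      _ ≤ (d + 1) ^ n * (X * (H ^ n * facPow s n)) := mul_le_mul_of_nonneg_left (hm i n) (by positivity)
      _ = _ := by rw [mul_pow, facPow]; ring

/-! ### Directional derivatives along words -/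

section Words

variable {V W : Type*} [NormedAddCommGroup V] [NormedSpace ℝ V] [NormedAddCommGroup W]
  [NormedSpace ℝ W] {d : ℕ}

theorem dirDeriv_comm (u v : V) {f : V → ℂ} (hf : ContDiff ℝ ∞ f) :
    dirDeriv u (dirDeriv v f) = dirDeriv v (dirDeriv u f) := by
  have hd : Differentiable ℝ (fderiv ℝ f) :=
    (hf.fderiv_right (m := ∞) (by simp)).differentiable (by simp)
  have key : ∀ u v x, dirDeriv u (dirDeriv v f) x = fderiv ℝ (fderiv ℝ f) x u v := by
    intro u v x
    unfold dirDeriv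
    rw [fderiv_clm_apply (hd x) (differentiableAt_const _)]
    simp
  funext x
  rw [key, key]
  refine (hf.contDiffAt.isSymmSndFDerivAt ?_) u v
  simp only [minSmoothness_of_isRCLikeNormedField]
  exact WithTop.coe_le_coe.2 (le_top (a := (2 : ℕ∞)))

theorem dirDeriv_mul (v : V) {f g : V → ℂ} (hf : ContDiff ℝ ∞ f) (hg : ContDiff ℝ ∞ g) :
    dirDeriv v (f * g) = dirDeriv v f * g + f * dirDeriv v g := by
  funext x
  simp only [dirDeriv, Pi.add_apply, Pi.mul_apply]
  rw [fderiv_mul (hf.differentiable (by simp) x) (hg.differentiable (by simp) x)]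
  simp
  ring

theorem dirDeriv_comp_affine (B : W →L[ℝ] V) (p : V) (v : W) {f : V → ℂ} (hf : ContDiff ℝ ∞ f) :
    dirDeriv v (fun w => f (p + B w)) = fun w => dirDeriv (B v) f (p + B w) := by
  funext w
  have h1 : HasFDerivAt (fun w => p + B w) B w := (B.hasFDerivAt).const_add p
  have h2 := (hf.differentiable (by simp) (p + B w)).hasFDerivAt
  have h3 : HasFDerivAt (fun w => f (p + B w)) ((fderiv ℝ f (p + B w)).comp B) w := h2.comp w h1
  simp [dirDeriv, h3.fderiv]

theorem contDiff_comp_affine (B : W →L[ℝ] V) (p : V) {f : V → ℂ} (hf : ContDiff ℝ ∞ f) :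
    ContDiff ℝ ∞ (fun w => f (p + B w)) :=
  hf.comp (contDiff_const.add B.contDiff)

/-- The iterated derivative of `f` along the directions `e i`, where `i` runs through a word. -/
noncomputable def wordDeriv (e : Fin d → V) : List (Fin d) → (V → ℂ) → V → ℂ
  | [], f => f
  | i :: L, f => wordDeriv e L (dirDeriv (e i) f)

@[simp] theorem wordDeriv_nil (e : Fin d → V) (f : V → ℂ) : wordDeriv e [] f = f := rfl

@[simp] theorem wordDeriv_cons (e : Fin d → V) (i : Fin d) (L : List (Fin d)) (f : V → ℂ) :
    wordDeriv e (i :: L) f = wordDeriv e L (dirDeriv (e i) f) := rfl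

theorem contDiff_wordDeriv (e : Fin d → V) (L : List (Fin d)) {f : V → ℂ} (hf : ContDiff ℝ ∞ f) :
    ContDiff ℝ ∞ (wordDeriv e L f) := by
  induction L generalizing f with
  | nil => exact hf
  | cons i L ih => exact ih (contDiff_dirDeriv _ hf)

theorem wordDeriv_append (e : Fin d → V) (L M : List (Fin d)) (f : V → ℂ) :
    wordDeriv e (L ++ M) f = wordDeriv e M (wordDeriv e L f) := by
  induction L generalizing f with
  | nil => rfl
  | cons i L ih => exact ih _

theorem wordDeriv_replicate (e : Fin d → V) (n : ℕ) (i : Fin d) (f : V → ℂ) :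
    wordDeriv e (List.replicate n i) f = (dirDeriv (e i))^[n] f := by
  induction n generalizing f with
  | zero => rfl
  | succ n ih => exact ih _

theorem wordDeriv_add (e : Fin d → V) (L : List (Fin d)) {f g : V → ℂ} (hf : ContDiff ℝ ∞ f)
    (hg : ContDiff ℝ ∞ g) : wordDeriv e L (f + g) = wordDeriv e L f + wordDeriv e L g := by
  induction L generalizing f g with
  | nil => rfl
  | cons i L ih =>
    rw [wordDeriv_cons, dirDeriv_add _ hf hg, ih (contDiff_dirDeriv _ hf) (contDiff_dirDeriv _ hg)]
    rfl

theorem wordDeriv_smul (e : Fin d → V) (L : List (Fin d)) (c : ℂ) {f : V → ℂ}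
    (hf : ContDiff ℝ ∞ f) : wordDeriv e L (c • f) = c • wordDeriv e L f := by
  induction L generalizing f with
  | nil => rfl
  | cons i L ih =>
    rw [wordDeriv_cons, dirDeriv_smul _ _ hf, ih (contDiff_dirDeriv _ hf)]
    rfl

theorem dirDeriv_wordDeriv (v : V) (e : Fin d → V) (L : List (Fin d)) {f : V → ℂ}
    (hf : ContDiff ℝ ∞ f) :
    dirDeriv v (wordDeriv e L f) = wordDeriv e L (dirDeriv v f) := by
  induction L generalizing f with
  | nil => rfl
  | cons i L ih =>
    rw [wordDeriv_cons, ih (contDiff_dirDeriv _ hf), dirDeriv_comm _ _ hf]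
    rfl

theorem wordDeriv_comm {d' : ℕ} (e : Fin d → V) (e' : Fin d' → V) (L : List (Fin d))
    (M : List (Fin d')) {f : V → ℂ} (hf : ContDiff ℝ ∞ f) :
    wordDeriv e L (wordDeriv e' M f) = wordDeriv e' M (wordDeriv e L f) := by
  induction L generalizing f with
  | nil => rfl
  | cons i L ih =>
    rw [wordDeriv_cons, dirDeriv_wordDeriv _ _ _ hf, ih (contDiff_dirDeriv _ hf)]
    rfl

/-! ### From words to multi-indices -/

theorem dirDeriv_iterate_comm (u v : V) (n : ℕ) {f : V → ℂ} (hf : ContDiff ℝ ∞ f) :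
    dirDeriv u ((dirDeriv v)^[n] f) = (dirDeriv v)^[n] (dirDeriv u f) := by
  have := dirDeriv_wordDeriv u (fun _ : Fin 1 => v) (List.replicate n 0) hf
  rwa [wordDeriv_replicate, wordDeriv_replicate] at this

theorem dirDeriv_foldr (u : V) (e : Fin d → V) (α : Fin d → ℕ) (l : List (Fin d)) {f : V → ℂ}
    (hf : ContDiff ℝ ∞ f) :
    l.foldr (fun i g => (dirDeriv (e i))^[α i] g) (dirDeriv u f) =
      dirDeriv u (l.foldr (fun i g => (dirDeriv (e i))^[α i] g) f) := by
  induction l with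
  | nil => rfl
  | cons i l ih =>
    simp only [List.foldr_cons]
    rw [ih, dirDeriv_iterate_comm _ _ _ (contDiff_foldr e α l hf)]

theorem foldr_add_single_of_notMem (e : Fin d → V) (α : Fin d → ℕ) (i : Fin d) (l : List (Fin d))
    (hi : i ∉ l) (f : V → ℂ) :
    l.foldr (fun j g => (dirDeriv (e j))^[(α + Pi.single i 1 : Fin d → ℕ) j] g) f =
      l.foldr (fun j g => (dirDeriv (e j))^[α j] g) f := by
  induction l with
  | nil => rfl
  | cons j l ih =>
    simp only [List.mem_cons, not_or] at hi
    simp only [List.foldr_cons, ih hi.2]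
    simp [Ne.symm hi.1]

/-- The extra derivative commutes past the other directions until it meets the block of direction i.
Without repetitions in the list there is exactly one such block. -/
theorem dirDeriv_foldr_of_mem (e : Fin d → V) (α : Fin d → ℕ) (i : Fin d) (l : List (Fin d))
    (hl : l.Nodup) (hi : i ∈ l) {f : V → ℂ} (hf : ContDiff ℝ ∞ f) :
    dirDeriv (e i) (l.foldr (fun j g => (dirDeriv (e j))^[α j] g) f) =
      l.foldr (fun j g => (dirDeriv (e j))^[(α + Pi.single i 1 : Fin d → ℕ) j] g) f := by
  induction l with
  | nil => simp at hi
  | cons j l ih =>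
    rw [List.nodup_cons] at hl
    simp only [List.foldr_cons]
    by_cases hij : j = i
    · subst hij
      rw [foldr_add_single_of_notMem e α j l hl.1]
      simp only [Pi.add_apply, Pi.single_eq_same]
      rw [Function.iterate_succ_apply']
    · have hi' : i ∈ l := by
        rcases List.mem_cons.1 hi with h | h
        · exact absurd h.symm hij
        · exact h
      rw [dirDeriv_iterate_comm _ _ _ (contDiff_foldr e α l hf), ih hl.2 hi']
      simp [Pi.single_apply, hij]

theorem multiDeriv_dirDeriv (e : Fin d → V) (α : Fin d → ℕ) (i : Fin d) {f : V → ℂ}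
    (hf : ContDiff ℝ ∞ f) :
    multiDeriv e α (dirDeriv (e i) f) = multiDeriv e (α + Pi.single i 1) f := by
  unfold multiDeriv
  rw [dirDeriv_foldr _ _ _ _ hf]
  exact dirDeriv_foldr_of_mem e α i _ (List.nodup_finRange d) (List.mem_finRange i) hf

/-- Mixed derivatives along a word only depend on the multiplicities of the letters. -/
theorem wordDeriv_eq_multiDeriv (e : Fin d → V) (L : List (Fin d)) {f : V → ℂ}
    (hf : ContDiff ℝ ∞ f) : wordDeriv e L f = multiDeriv e (fun i => L.count i) f := by
  induction L generalizing f with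
  | nil => exact (multiDeriv_zero_index e f).symm
  | cons i L ih =>
    rw [wordDeriv_cons, ih (contDiff_dirDeriv _ hf), multiDeriv_dirDeriv _ _ _ hf]
    congr 1
    funext j
    by_cases h : i = j
    · subst h; simp
    · simp [h, Ne.symm h]

theorem len_count (L : List (Fin d)) : len (fun i => L.count i) = L.length := by
  unfold len
  have := Multiset.sum_count_eq_card (s := Finset.univ) (m := (L : Multiset (Fin d))) (by simp)
  simpa using this

theorem exists_word (α : Fin d → ℕ) : ∃ L : List (Fin d), (fun i => L.count i) = α := by
  refine ⟨(∑ i, α i • ({i} : Multiset (Fin d))).toList, ?_⟩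
  funext j
  rw [← Multiset.coe_count, Multiset.coe_toList, Multiset.count_sum']
  simp [Multiset.count_singleton]

theorem fact_le_factorial_len (α : Fin d → ℕ) : fact α ≤ (len α).factorial := by
  unfold fact len
  exact_mod_cast Nat.le_of_dvd (Nat.factorial_pos _) (Nat.prod_factorial_dvd_factorial_sum _ _)

theorem fact_rpow_le {s : ℝ} (hs : 0 < s) (α : Fin d → ℕ) : fact α ^ s ≤ facPow s (len α) :=
  Real.rpow_le_rpow (fact_pos α).le (fact_le_factorial_len α) hs.le

/-- The multinomial coefficient |α|!/α! is one term in the expansion of (1 + ⋯ + 1)^{|α|} = d^{|α|}.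
Together with `fact_rpow_le` this makes α!^s and |α|!^s interchangeable up to a geometric factor. -/
theorem facPow_len_le {s : ℝ} (hs : 0 < s) (α : Fin d → ℕ) :
    facPow s (len α) ≤ (((d + 1 : ℝ)) ^ s) ^ len α * fact α ^ s := by
  have h1 : (len α).factorial ≤ (d + 1) ^ len α * ∏ i, (α i).factorial := by
    have h2 := Nat.multinomial_spec Finset.univ α
    have h3 : Nat.multinomial Finset.univ α ≤ d ^ len α := by
      have h4 := Finset.sum_pow_eq_sum_piAntidiag Finset.univ (fun _ : Fin d => 1) (len α)
      simp only [Finset.sum_const, Finset.card_univ, Fintype.card_fin, smul_eq_mul, mul_one,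
        one_pow, Finset.prod_const_one] at h4
      rw [h4]
      exact Finset.single_le_sum (f := fun k => Nat.multinomial Finset.univ k)
        (fun _ _ => Nat.zero_le _) (by simp [len])
    have h5 : d ^ len α ≤ (d + 1) ^ len α := Nat.pow_le_pow_left (Nat.le_succ d) _
    calc (len α).factorial = (∏ i, (α i).factorial) * Nat.multinomial Finset.univ α := h2.symm
      _ ≤ (∏ i, (α i).factorial) * (d + 1) ^ len α := Nat.mul_le_mul_left _ (h3.trans h5)
      _ = _ := mul_comm _ _
  have h2 : ((len α).factorial : ℝ) ≤ (d + 1 : ℝ) ^ len α * fact α := by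
    unfold fact; exact_mod_cast h1
  calc facPow s (len α) ≤ ((d + 1 : ℝ) ^ len α * fact α) ^ s :=
        Real.rpow_le_rpow (by positivity) h2 hs.le
    _ = _ := by
        rw [Real.mul_rpow (by positivity) (fact_pos α).le, ← Real.rpow_natCast, ← Real.rpow_mul
          (by positivity), mul_comm, mul_comm (len α : ℝ), Real.rpow_mul (by positivity),
          Real.rpow_natCast, mul_comm]

/-- A bound for all splittings of a word bounds the derivative of a product. -/
theorem norm_wordDeriv_mul_le (e : Fin d → V) (L : List (Fin d)) {φ ψ : V → ℂ}
    (hφ : ContDiff ℝ ∞ φ) (hψ : ContDiff ℝ ∞ ψ) (x : V) (Y : ℝ)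
    (h : ∀ M N : List (Fin d), M.length + N.length = L.length →
      ‖wordDeriv e M φ x‖ * ‖wordDeriv e N ψ x‖ ≤ Y) :
    ‖wordDeriv e L (φ * ψ) x‖ ≤ 2 ^ L.length * Y := by
  induction L generalizing φ ψ with
  | nil => simpa using h [] [] rfl
  | cons i L ih =>
    have h1 := contDiff_dirDeriv (e i) hφ
    have h2 := contDiff_dirDeriv (e i) hψ
    rw [wordDeriv_cons, dirDeriv_mul _ hφ hψ, wordDeriv_add _ _
      (show ContDiff ℝ ∞ (dirDeriv (e i) φ * ψ) from h1.mul hψ)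
      (show ContDiff ℝ ∞ (φ * dirDeriv (e i) ψ) from hφ.mul h2)]
    calc _ ≤ ‖wordDeriv e L (dirDeriv (e i) φ * ψ) x‖ + ‖wordDeriv e L (φ * dirDeriv (e i) ψ) x‖ :=
          norm_add_le _ _
      _ ≤ 2 ^ L.length * Y + 2 ^ L.length * Y := by
          refine add_le_add (ih h1 hψ fun M N hMN => h (i :: M) N ?_)
            (ih hφ h2 fun M N hMN => h M (i :: N) ?_)
          · simp only [List.length_cons]; omega
          · simp only [List.length_cons]; omega
      _ = _ := by rw [List.length_cons]; ring

/-- Derivatives of the composition of `f` with an affine map. -/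
theorem norm_wordDeriv_comp_affine_le {d' : ℕ} (e : Fin d → V) (e' : Fin d' → W) (B : W →L[ℝ] V)
    (p : V) (m : Fin d' → Fin d → ℝ) (hB : ∀ i, B (e' i) = ∑ j, m i j • e j) {K : ℝ} (hK : 0 ≤ K)
    (hm : ∀ i, ∑ j, |m i j| ≤ K) (L : List (Fin d')) {f : V → ℂ} (hf : ContDiff ℝ ∞ f) (w : W)
    {Y : ℝ} (hY : 0 ≤ Y) (h : ∀ M : List (Fin d), M.length = L.length → ‖wordDeriv e M f (p + B w)‖ ≤ Y) :
    ‖wordDeriv e' L (fun w => f (p + B w)) w‖ ≤ K ^ L.length * Y := by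
  induction L generalizing f with
  | nil => simpa using h [] rfl
  | cons i L ih =>
    have h1 : dirDeriv (e' i) (fun w => f (p + B w)) =
        ∑ j, (m i j : ℂ) • fun w => dirDeriv (e j) f (p + B w) := by
      rw [dirDeriv_comp_affine B p _ hf, hB]
      funext w
      simp only [dirDeriv, map_sum, map_smul, Finset.sum_apply, Pi.smul_apply, smul_eq_mul,
        Complex.real_smul]
    -- Smoothness is carried along with the bound, since additivity of `wordDeriv` needs it for the
    -- partial sums.
    have hsum : ∀ S : Finset (Fin d),
        ‖wordDeriv e' L (∑ j ∈ S, (m i j : ℂ) • fun w => dirDeriv (e j) f (p + B w)) w‖ ≤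
          (∑ j ∈ S, |m i j|) * (K ^ L.length * Y) ∧
        ContDiff ℝ ∞ (∑ j ∈ S, (m i j : ℂ) • fun w => dirDeriv (e j) f (p + B w)) := by
      intro S
      induction S using Finset.induction_on with
      | empty =>
        have := wordDeriv_smul e' L 0 (contDiff_const (c := (0 : ℂ)))
        have h0 : wordDeriv e' L (0 : W → ℂ) = 0 := by simpa using this
        simp only [Finset.sum_empty, h0]
        exact ⟨by simp, contDiff_const⟩
      | insert j S hj ihS =>
        have hc := contDiff_comp_affine B p (contDiff_dirDeriv (e j) hf)
        have hc' : ContDiff ℝ ∞ ((m i j : ℂ) • fun w => dirDeriv (e j) f (p + B w)) :=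
          contDiff_const.smul hc
        rw [Finset.sum_insert hj, Finset.sum_insert hj, wordDeriv_add _ _ hc' ihS.2,
          wordDeriv_smul _ _ _ hc, add_mul]
        refine ⟨(norm_add_le _ _).trans (add_le_add ?_ ihS.1), hc'.add ihS.2⟩
        rw [Pi.smul_apply, norm_smul, Complex.norm_real, Real.norm_eq_abs]
        refine mul_le_mul_of_nonneg_left ?_ (abs_nonneg _)
        exact ih (contDiff_dirDeriv _ hf) fun M hM => h (j :: M) (by simp [hM])
    rw [wordDeriv_cons, h1, List.length_cons, pow_succ']
    refine (hsum Finset.univ).1.trans ?_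
    rw [mul_assoc]
    exact mul_le_mul_of_nonneg_right (hm i) (by positivity)

end Words

/-! ### Exponential decay of Gelfand–Shilov functions -/

section Bounds

variable {d : ℕ} {s σ : ℝ}

/-- `|∂^L g(y)| ≤ X H^{|L|} |L|!^σ exp(-c |y|^{1/s})` for all words `L`. -/
def GSBound (s σ X H c : ℝ) (g : E d → ℂ) : Prop :=
  ContDiff ℝ ∞ g ∧ ∀ (L : List (Fin d)) (y : E d), ‖wordDeriv (stdDir d) L g y‖ ≤
    X * (H ^ L.length * facPow σ L.length * Real.exp (-c * ‖y‖ ^ (1 / s)))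

/-- `g` has Gelfand–Shilov regularity and decays exponentially. -/
def IsGSDecay (s σ : ℝ) (g : E d → ℂ) : Prop :=
  ∃ X H c : ℝ, 0 < H ∧ 0 < c ∧ GSBound s σ X H c g

/-- The symbol estimates for fixed constants, along words. -/
def SymBound (s σ X h r : ℝ) (b : E d × E d → ℂ) : Prop :=
  ContDiff ℝ ∞ b ∧ ∀ (L M : List (Fin d)) (z ξ : E d),
    ‖wordDeriv (dirX d) L (wordDeriv (dirXi d) M b) (z, ξ)‖ ≤
      X * (h ^ (L.length + M.length) * facPow σ L.length * facPow s M.length *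
        Real.exp (r * (‖z‖ ^ (1 / s) + ‖ξ‖ ^ (1 / σ))))

/-- The symbol class, with derivatives along words. -/
def IsWordSymbol (s σ : ℝ) (b : E d × E d → ℂ) : Prop :=
  ∃ h : ℝ, 0 < h ∧ ∀ r : ℝ, 0 < r → ∃ X : ℝ, SymBound s σ X h r b

theorem GSBound.const_nonneg {X H c : ℝ} {g : E d → ℂ} (hg : GSBound s σ X H c g) : 0 ≤ X := by
  have h1 := (norm_nonneg _).trans (hg.2 [] 0)
  simp only [List.length_nil, pow_zero, facPow_zero, one_mul] at h1
  exact nonneg_of_mul_nonneg_left h1 (Real.exp_pos _)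

theorem SymBound.const_nonneg {X h r : ℝ} {b : E d × E d → ℂ} (hb : SymBound s σ X h r b) :
    0 ≤ X := by
  have h1 := (norm_nonneg _).trans (hb.2 [] [] 0 0)
  simp only [List.length_nil, pow_zero, facPow_zero, one_mul, mul_one, add_zero] at h1
  exact nonneg_of_mul_nonneg_left h1 (Real.exp_pos _)

theorem GSBound.mono {X X' H H' c : ℝ} {g : E d → ℂ} (hg : GSBound s σ X H c g) (hH : 0 < H)
    (hXX : X ≤ X') (hHH : H ≤ H') : GSBound s σ X' H' c g := by
  refine ⟨hg.1, fun L y => (hg.2 L y).trans ?_⟩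
  have := hg.const_nonneg
  have := this.trans hXX
  have := facPow_pos σ L.length
  gcongr

theorem SymBound.mono {X X' h h' r : ℝ} {b : E d × E d → ℂ} (hb : SymBound s σ X h r b)
    (hh : 0 < h) (hXX : X ≤ X') (hhh : h ≤ h') : SymBound s σ X' h' r b := by
  refine ⟨hb.1, fun L M z ξ => (hb.2 L M z ξ).trans ?_⟩
  have := hb.const_nonneg
  have := this.trans hXX
  have := facPow_pos σ L.length
  have := facPow_pos s M.length
  gcongr

theorem IsWordSymbol.contDiff {b : E d × E d → ℂ} (hb : IsWordSymbol s σ b) : ContDiff ℝ ∞ b := by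
  obtain ⟨h, -, hr⟩ := hb
  obtain ⟨X, hX⟩ := hr 1 one_pos
  exact hX.1

theorem IsGSDecay.contDiff {g : E d → ℂ} (hg : IsGSDecay s σ g) : ContDiff ℝ ∞ g := by
  obtain ⟨X, H, c, -, -, h⟩ := hg
  exact h.1

theorem IsSymbol.isWordSymbol (hs : 0 < s) (hσ : 0 < σ) {a : E d × E d → ℂ}
    (ha : IsSymbol s σ a) : IsWordSymbol s σ a := by
  obtain ⟨hsm, h, hh, hr⟩ := ha
  refine ⟨h, hh, fun r hr0 => ?_⟩
  obtain ⟨C, hC⟩ := hr r hr0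
  refine ⟨C, hsm, fun L M z ξ => ?_⟩
  have hC0 : 0 ≤ C := by
    have h1 := (norm_nonneg _).trans (hC 0 0 0 0)
    refine nonneg_of_mul_nonneg_left h1 ?_
    have := Real.rpow_pos_of_pos (fact_pos (0 : Fin d → ℕ)) σ
    have := Real.rpow_pos_of_pos (fact_pos (0 : Fin d → ℕ)) s
    positivity
  rw [wordDeriv_eq_multiDeriv _ _ (contDiff_wordDeriv _ _ hsm), wordDeriv_eq_multiDeriv _ _ hsm]
  refine (hC _ _ z ξ).trans ?_
  rw [len_count, len_count]
  have h1 := fact_rpow_le hσ (fun i => L.count i)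
  have h2 := fact_rpow_le hs (fun i => M.count i)
  rw [len_count] at h1 h2
  have := facPow_pos σ L.length
  have := Real.rpow_pos_of_pos (fact_pos (fun i => M.count i)) s
  gcongr

/-- The factorials of the combined orders split at the cost of powers of 2^σ and 2^s. The exponent r
is unchanged and the dependence on L and M sits in the leading constant alone, so the basic estimate
for the operator can be applied to all derivatives of a symbol with the same h and r. -/
theorem SymBound.deriv_word (hs : 0 < s) (hσ : 0 < σ) {X h r : ℝ} (hh : 0 < h)
    {b : E d × E d → ℂ} (hb : SymBound s σ X h r b) (L M : List (Fin d)) :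
    SymBound s σ (X * ((h * 2 ^ σ * 2 ^ s) ^ (L.length + M.length) * facPow σ L.length *
      facPow s M.length)) (h * 2 ^ σ * 2 ^ s) r
      (wordDeriv (dirX d) L (wordDeriv (dirXi d) M b)) := by
  refine ⟨contDiff_wordDeriv _ _ (contDiff_wordDeriv _ _ hb.1), fun L' M' z ξ => ?_⟩
  rw [wordDeriv_comm (dirXi d) (dirX d) M' L (contDiff_wordDeriv _ _ hb.1), ← wordDeriv_append,
    ← wordDeriv_append]
  refine (hb.2 _ _ z ξ).trans ?_
  have h1 := facPow_add_le hσ L.length L'.length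
  have h2 := facPow_add_le hs M.length M'.length
  have hX := hb.const_nonneg
  have p1 := facPow_pos σ (L.length + L'.length)
  have p2 := facPow_pos s (M.length + M'.length)
  have p3 := facPow_pos σ L.length
  have p4 := facPow_pos σ L'.length
  have p5 := facPow_pos s M.length
  have p6 := facPow_pos s M'.length
  have q1 : (1 : ℝ) ≤ 2 ^ σ := Real.one_le_rpow one_le_two hσ.le
  have q2 : (1 : ℝ) ≤ 2 ^ s := Real.one_le_rpow one_le_two hs.le
  simp only [List.length_append]
  set l := L.length
  set l' := L'.length
  set m := M.length
  set m' := M'.length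
  -- Both powers are raised to the total order, so that they merge with h into a single base.
  have e1 : ((2 : ℝ) ^ σ) ^ (l + l') ≤ (2 ^ σ) ^ (l + l' + (m + m')) :=
    pow_le_pow_right₀ q1 (by omega)
  have e2 : ((2 : ℝ) ^ s) ^ (m + m') ≤ (2 ^ s) ^ (l + l' + (m + m')) :=
    pow_le_pow_right₀ q2 (by omega)
  calc X * (h ^ (l + l' + (m + m')) * facPow σ (l + l') * facPow s (m + m') *
        Real.exp (r * (‖z‖ ^ (1 / s) + ‖ξ‖ ^ (1 / σ))))
      ≤ X * (h ^ (l + l' + (m + m')) *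
        ((2 ^ σ) ^ (l + l' + (m + m')) * (facPow σ l * facPow σ l')) *
        ((2 ^ s) ^ (l + l' + (m + m')) * (facPow s m * facPow s m')) *
        Real.exp (r * (‖z‖ ^ (1 / s) + ‖ξ‖ ^ (1 / σ)))) := by
        gcongr
        · exact h1.trans (by gcongr)
        · exact h2.trans (by gcongr)
    _ = _ := by
        have : l + l' + (m + m') = (l + m) + (l' + m') := by ring
        rw [this, mul_pow, mul_pow, mul_pow, mul_pow]
        ring

theorem IsWordSymbol.deriv_word (hs : 0 < s) (hσ : 0 < σ) {b : E d × E d → ℂ}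
    (hb : IsWordSymbol s σ b) (L M : List (Fin d)) :
    IsWordSymbol s σ (wordDeriv (dirX d) L (wordDeriv (dirXi d) M b)) := by
  obtain ⟨h, hh, hr⟩ := hb
  refine ⟨h * 2 ^ σ * 2 ^ s, by positivity, fun r hr0 => ?_⟩
  obtain ⟨X, hX⟩ := hr r hr0
  exact ⟨_, hX.deriv_word hs hσ hh L M⟩

theorem IsWordSymbol.dirDeriv_dirX (hs : 0 < s) (hσ : 0 < σ) {b : E d × E d → ℂ}
    (hb : IsWordSymbol s σ b) (i : Fin d) : IsWordSymbol s σ (dirDeriv (dirX d i) b) :=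
  hb.deriv_word hs hσ [i] []

theorem IsWordSymbol.dirDeriv_dirXi (hs : 0 < s) (hσ : 0 < σ) {b : E d × E d → ℂ}
    (hb : IsWordSymbol s σ b) (i : Fin d) : IsWordSymbol s σ (dirDeriv (dirXi d i) b) :=
  hb.deriv_word hs hσ [] [i]

theorem GSBound.deriv_word (hσ : 0 < σ) {X H c : ℝ} (hH : 0 < H) {g : E d → ℂ}
    (hg : GSBound s σ X H c g) (L : List (Fin d)) :
    GSBound s σ (X * ((H * 2 ^ σ) ^ L.length * facPow σ L.length)) (H * 2 ^ σ) c
      (wordDeriv (stdDir d) L g) := by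
  refine ⟨contDiff_wordDeriv _ _ hg.1, fun L' y => ?_⟩
  rw [← wordDeriv_append]
  refine (hg.2 _ y).trans ?_
  have h1 := facPow_add_le hσ L.length L'.length
  have hX := hg.const_nonneg
  rw [List.length_append]
  calc X * (H ^ (L.length + L'.length) * facPow σ (L.length + L'.length) *
        Real.exp (-c * ‖y‖ ^ (1 / s)))
      ≤ X * (H ^ (L.length + L'.length) * ((2 ^ σ) ^ (L.length + L'.length) *
        (facPow σ L.length * facPow σ L'.length)) * Real.exp (-c * ‖y‖ ^ (1 / s))) := by gcongr
    _ = _ := by rw [mul_pow, mul_pow]; ring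

theorem IsGSDecay.deriv (hσ : 0 < σ) {g : E d → ℂ} (hg : IsGSDecay s σ g) (i : Fin d) :
    IsGSDecay s σ (dirDeriv (stdDir d i) g) := by
  obtain ⟨X, H, c, hH, hc, h⟩ := hg
  exact ⟨_, _, c, by positivity, hc, h.deriv_word hσ hH [i]⟩

/-- The coordinate `x ↦ x j` as a complex-valued function. -/
noncomputable def coordFun (j : Fin d) : E d → ℂ := fun x => (x j : ℂ)

theorem contDiff_coordFun (j : Fin d) : ContDiff ℝ ∞ (coordFun j) :=
  Complex.ofRealCLM.contDiff.comp (EuclideanSpace.proj (𝕜 := ℝ) j).contDiff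

theorem contDiff_coordFun_pow (j : Fin d) (k : ℕ) : ContDiff ℝ ∞ (coordFun j ^ k) :=
  (contDiff_coordFun j).pow k

theorem dirDeriv_coordFun_pow (i j : Fin d) (k : ℕ) :
    dirDeriv (stdDir d i) (coordFun j ^ k) =
      (if i = j then (k : ℂ) else 0) • coordFun j ^ (k - 1) := by
  funext x
  have h1 : HasFDerivAt (coordFun j) (Complex.ofRealCLM.comp (EuclideanSpace.proj (𝕜 := ℝ) j)) x :=
    (Complex.ofRealCLM.comp (EuclideanSpace.proj (𝕜 := ℝ) j)).hasFDerivAt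
  have h2 : HasFDerivAt (coordFun j ^ k) _ x := h1.pow k
  simp only [dirDeriv]
  rw [h2.fderiv]
  by_cases h : i = j
  · subst h; simp [stdDir]
  · simp [stdDir, h, Ne.symm h]

/-- For |L| > k the falling factorial vanishes, so the truncated exponent k - |L| does no harm. -/
theorem norm_wordDeriv_coordFun_pow_le (j : Fin d) (L : List (Fin d)) (k : ℕ) (y : E d) :
    ‖wordDeriv (stdDir d) L (coordFun j ^ k) y‖ ≤
      k.descFactorial L.length * ‖y‖ ^ (k - L.length) := by
  induction L generalizing k with
  | nil =>
    simp only [wordDeriv_nil, Pi.pow_apply, norm_pow, List.length_nil, Nat.descFactorial_zero,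
      Nat.cast_one, one_mul, Nat.sub_zero]
    gcongr
    simpa [coordFun] using PiLp.norm_apply_le y j
  | cons i L ih =>
    have hk : k.descFactorial (L.length + 1) = k * (k - 1).descFactorial L.length := by
      rcases k with _ | k
      · simp
      · exact Nat.succ_descFactorial_succ k L.length
    rw [wordDeriv_cons, dirDeriv_coordFun_pow,
      wordDeriv_smul _ _ _ (contDiff_coordFun_pow j (k - 1)), Pi.smul_apply, norm_smul,
      List.length_cons, hk, Nat.cast_mul, mul_assoc]
    have h1 : ‖(if i = j then (k : ℂ) else 0)‖ ≤ k := by split_ifs <;> simp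
    refine mul_le_mul h1 ((ih (k - 1)).trans_eq ?_) (norm_nonneg _) (by positivity)
    rw [Nat.sub_sub, add_comm 1]

/-- The constant for multiplication by powers of coordinates. -/
noncomputable def mulConst (s H c : ℝ) : ℝ := 2 * (1 + (s / (c / 2)) ^ s) * (1 + H)

theorem mulConst_pos {H c : ℝ} (hs : 0 < s) (hH : 0 < H) (hc : 0 < c) : 0 < mulConst s H c := by
  unfold mulConst; positivity

/-- This is where s + σ ≥ 1 enters. A derivative of order m of x_j^k produces the factor k!/(k-m)! =
m! binom(k,m), and m! ≤ m!^s m!^σ. Here m!^s combines with (k-m)!^s into k!^s, while m!^σ combines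
with the factorial of the derivatives of g into |L|!^σ. The remaining power |y|^{k-m} is paid for by
half of the exponential decay, at the cost of (k-m)!^s. -/
theorem GSBound.coordFun_pow_mul (hs : 0 < s) (hσ : 0 < σ) (hsσ : 1 ≤ s + σ) {X H c : ℝ}
    (hH : 0 < H) (hc : 0 < c) {g : E d → ℂ} (hg : GSBound s σ X H c g) (j : Fin d) (k : ℕ) :
    GSBound s σ (X * (mulConst s H c ^ k * facPow s k)) (mulConst s H c) (c / 2)
      (coordFun j ^ k * g) := by
  have hk := contDiff_coordFun_pow j k
  have hX := hg.const_nonneg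
  refine ⟨hk.mul hg.1, fun L y => ?_⟩
  set B := (s / (c / 2)) ^ s with hB
  have hB0 : 0 ≤ B := by positivity
  have hfk := facPow_pos s k
  have hfl := facPow_pos σ L.length
  set ε := Real.exp (-(c / 2) * ‖y‖ ^ (1 / s)) with hε
  refine (norm_wordDeriv_mul_le (stdDir d) L hk hg.1 y
    (X * ((2 * (1 + B)) ^ k * facPow s k * ((1 + H) ^ L.length * facPow σ L.length) * ε)) ?_).trans ?_
  · intro M N hMN
    set m := M.length
    set n := N.length
    rcases lt_or_ge k m with hkm | hkm
    · have h1 := norm_wordDeriv_coordFun_pow_le j M k y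
      rw [Nat.descFactorial_of_lt hkm, Nat.cast_zero, zero_mul] at h1
      rw [le_antisymm h1 (norm_nonneg _), zero_mul]
      positivity
    have h1 : (k.descFactorial m : ℝ) ≤ 2 ^ k * (facPow s m * facPow σ m) := by
      rw [Nat.descFactorial_eq_factorial_mul_choose, Nat.cast_mul, mul_comm]
      have h2 : (m.factorial : ℝ) ≤ facPow s m * facPow σ m := by
        unfold facPow
        rw [← Real.rpow_add (by exact_mod_cast m.factorial_pos)]
        have := Real.rpow_le_rpow_of_exponent_le
          (show (1 : ℝ) ≤ m.factorial by exact_mod_cast m.factorial_pos) hsσ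
        rwa [Real.rpow_one] at this
      gcongr
      exact_mod_cast Nat.choose_le_two_pow k m
    have h3 : ‖y‖ ^ (k - m) * Real.exp (-c * ‖y‖ ^ (1 / s)) ≤ (1 + B) ^ k * facPow s (k - m) * ε := by
      have h4 := pow_le_factorial_mul_exp hs (half_pos hc) (norm_nonneg y) (k - m)
      have h5 : B ^ (k - m) ≤ (1 + B) ^ k :=
        (pow_le_pow_left₀ hB0 (by linarith) _).trans
          (pow_le_pow_right₀ (by linarith) (Nat.sub_le _ _))
      calc ‖y‖ ^ (k - m) * Real.exp (-c * ‖y‖ ^ (1 / s))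
          ≤ (B ^ (k - m) * facPow s (k - m) * Real.exp (c / 2 * ‖y‖ ^ (1 / s))) *
            Real.exp (-c * ‖y‖ ^ (1 / s)) := by gcongr; exact h4
        _ = B ^ (k - m) * facPow s (k - m) * ε := by
            rw [mul_assoc, ← Real.exp_add, hε]; congr 2; ring
        _ ≤ _ := by
            have := facPow_pos s (k - m)
            gcongr
    have h6 : H ^ n ≤ (1 + H) ^ L.length :=
      (pow_le_pow_left₀ hH.le (by linarith) _).trans
        (pow_le_pow_right₀ (by linarith) (by omega))
    have h7 := facPow_mul_le hσ m n
    have h8 := facPow_mul_le hs m (k - m)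
    rw [Nat.add_sub_cancel' hkm] at h8
    rw [hMN] at h7
    have p1 := facPow_pos s m
    have p2 := facPow_pos σ m
    have p3 := facPow_pos σ n
    have p4 := facPow_pos s (k - m)
    calc ‖wordDeriv (stdDir d) M (coordFun j ^ k) y‖ * ‖wordDeriv (stdDir d) N g y‖
        ≤ (k.descFactorial m * ‖y‖ ^ (k - m)) *
          (X * (H ^ n * facPow σ n * Real.exp (-c * ‖y‖ ^ (1 / s)))) := by
          gcongr
          · exact norm_wordDeriv_coordFun_pow_le j M k y
          · exact hg.2 N y
      _ = X * (k.descFactorial m * (H ^ n * facPow σ n) *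
          (‖y‖ ^ (k - m) * Real.exp (-c * ‖y‖ ^ (1 / s)))) := by ring
      _ ≤ X * ((2 ^ k * (facPow s m * facPow σ m)) * ((1 + H) ^ L.length * facPow σ n) *
          ((1 + B) ^ k * facPow s (k - m) * ε)) := by gcongr
      _ = X * ((2 * (1 + B)) ^ k * (facPow s m * facPow s (k - m)) *
          ((1 + H) ^ L.length * (facPow σ m * facPow σ n)) * ε) := by rw [mul_pow]; ring
      _ ≤ _ := by gcongr
  · have h1 : (2 * (1 + B)) ^ k ≤ mulConst s H c ^ k :=
      pow_le_pow_left₀ (by positivity) (le_mul_of_one_le_right (by positivity) (by linarith)) _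
    have h2 : (2 * (1 + H)) ^ L.length ≤ mulConst s H c ^ L.length := by
      refine pow_le_pow_left₀ (by positivity) ?_ _
      unfold mulConst
      rw [← hB]
      nlinarith [mul_nonneg hB0 hH.le]
    have p := (mulConst_pos hs hH hc).le
    calc 2 ^ L.length * (X * ((2 * (1 + B)) ^ k * facPow s k *
          ((1 + H) ^ L.length * facPow σ L.length) * ε))
        = X * ((2 * (1 + B)) ^ k * facPow s k *
          ((2 * (1 + H)) ^ L.length * facPow σ L.length) * ε) := by rw [mul_pow 2 (1 + H)]; ring
      _ ≤ X * (mulConst s H c ^ k * facPow s k *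
          (mulConst s H c ^ L.length * facPow σ L.length) * ε) := by gcongr
      _ = _ := by ring

theorem IsGSDecay.coordFun_mul (hs : 0 < s) (hσ : 0 < σ) (hsσ : 1 ≤ s + σ) {g : E d → ℂ}
    (hg : IsGSDecay s σ g) (j : Fin d) : IsGSDecay s σ (coordFun j * g) := by
  obtain ⟨X, H, c, hH, hc, h⟩ := hg
  have := h.coordFun_pow_mul hs hσ hsσ hH hc j 1
  rw [pow_one (coordFun j)] at this
  exact ⟨_, _, _, mulConst_pos hs hH hc, half_pos hc, this⟩

/-- Elements of a step space decay exponentially. -/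
theorem gsBound_of_gsQuot_le (hs : 0 < s) (hσ : 0 < σ) {h N : ℝ} (hh : 0 < h) {f : E d → ℂ}
    (hf : ContDiff ℝ ∞ f) (hN : ∀ p, gsQuot s σ h f p ≤ N) :
    GSBound s σ (N * 2 ^ s) h (rate s ((d + 1) * h)) f := by
  refine ⟨hf, fun L y => ?_⟩
  have hN0 : 0 ≤ N := (gsQuot_nonneg s σ hh f (0, 0, 0)).trans (hN _)
  have p1 := facPow_pos σ L.length
  have key : ∀ (i : Fin d) (n : ℕ), |y i| ^ n * ‖wordDeriv (stdDir d) L f y‖ ≤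
      N * (h ^ L.length * facPow σ L.length) * (h ^ n * facPow s n) := by
    intro i n
    -- A monomial in the single coordinate i turns the seminorm into a moment of the derivative
    -- along L.
    have h1 := hN (Pi.single i n, fun i => L.count i, y)
    rw [gsQuot, div_le_iff₀ (gsDenom_pos s σ hh _ _)] at h1
    simp only [monom_single, len_count, abs_pow, ← wordDeriv_eq_multiDeriv _ _ hf] at h1
    have h2 : len (Pi.single i n) = n := by simp [len]
    have h3 := fact_rpow_le hs (Pi.single i n)
    have h4 := fact_rpow_le hσ (fun i => L.count i)
    rw [h2] at h1 h3
    rw [len_count] at h4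
    refine h1.trans ?_
    have p2 := facPow_pos s n
    have := (Real.rpow_pos_of_pos (fact_pos (fun i => L.count i)) σ).le
    calc N * (h ^ (n + L.length) * fact (Pi.single i n) ^ s * fact (fun i => L.count i) ^ σ)
        ≤ N * (h ^ (n + L.length) * facPow s n * facPow σ L.length) := by gcongr
      _ = _ := by ring
  have h0 : ‖wordDeriv (stdDir d) L f y‖ ≤ N * (h ^ L.length * facPow σ L.length) := by
    have h1 := hN (0, fun i => L.count i, y)
    rw [gsQuot, div_le_iff₀ (gsDenom_pos s σ hh _ _)] at h1
    simp only [len_count, ← wordDeriv_eq_multiDeriv _ _ hf] at h1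
    have h4 := fact_rpow_le hσ (fun i => L.count i)
    rw [len_count] at h4
    simp only [monom, fact, len, Pi.zero_apply, pow_zero, Finset.prod_const_one, abs_one, one_mul,
      Nat.factorial_zero, Nat.cast_one, Real.one_rpow, mul_one, Finset.sum_const_zero,
      zero_add] at h1
    exact h1.trans (by unfold fact at h4; gcongr)
  refine (le_exp_of_coord_moments hs hh y (norm_nonneg _) h0 key).trans_eq ?_
  ring

theorem Step.gsBound (hs : 0 < s) (hσ : 0 < σ) {h : Set.Ioi (0 : ℝ)} (f : Step d s σ h) :
    GSBound s σ (‖f‖ * 2 ^ s) h (rate s ((d + 1) * h)) (f : E d → ℂ) :=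
  gsBound_of_gsQuot_le hs hσ h.2 f.2.1 f.gsQuot_le

theorem Space.isGSDecay (hs : 0 < s) (hσ : 0 < σ) (f : Space d s σ) :
    IsGSDecay s σ (f : E d → ℂ) := by
  obtain ⟨h, hh, hf⟩ := f.2
  obtain ⟨N, hN⟩ := hf.2
  exact ⟨_, h, _, hh, rate_pos hs (by positivity),
    gsBound_of_gsQuot_le hs hσ hh hf.1 fun p => hN ⟨p, rfl⟩⟩

/-- The index of the step space that contains functions with given decay. -/
noncomputable def stepIndex (d : ℕ) (s σ H c : ℝ) : ℝ :=
  1 + (s / c) ^ s * (d + 1) ^ s + H * (d + 1) ^ σ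

theorem stepIndex_pos (hs : 0 < s) {H c : ℝ} (hH : 0 < H) (hc : 0 < c) :
    0 < stepIndex d s σ H c := by
  unfold stepIndex; positivity

theorem abs_monom_le (α : Fin d → ℕ) (x : E d) : |monom α x| ≤ ‖x‖ ^ len α := by
  unfold monom len
  rw [Finset.abs_prod, ← Finset.prod_pow_eq_pow_sum]
  refine Finset.prod_le_prod (fun _ _ => abs_nonneg _) fun i _ => ?_
  rw [abs_pow]
  gcongr
  simpa using PiLp.norm_apply_le x i

/-- Converse of `gsBound_of_gsQuot_le`: trading |x|^{|α|} for |α|!^s costs e^{c|x|^{1/s}}, which is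
precisely the available decay. The powers of d + 1 in `stepIndex` come from replacing |α|! and |β|!
by α! and β!. -/
theorem GSBound.gsQuot_le (hs : 0 < s) (hσ : 0 < σ) {X H c : ℝ} (hH : 0 < H) (hc : 0 < c)
    {f : E d → ℂ} (hf : GSBound s σ X H c f) (p : (Fin d → ℕ) × (Fin d → ℕ) × E d) :
    gsQuot s σ (stepIndex d s σ H c) f p ≤ X := by
  obtain ⟨α, β, x⟩ := p
  have hX := hf.const_nonneg
  rw [gsQuot, div_le_iff₀ (gsDenom_pos s σ (stepIndex_pos hs hH hc) _ _)]
  obtain ⟨L, hL⟩ := exists_word β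
  have hlen : L.length = len β := by rw [← hL, len_count]
  simp only
  have h1 : |monom α x| ≤ ((s / c) ^ s) ^ len α * ((((d + 1 : ℝ)) ^ s) ^ len α * fact α ^ s) *
      Real.exp (c * ‖x‖ ^ (1 / s)) := by
    refine (abs_monom_le α x).trans ((pow_le_factorial_mul_exp hs hc (norm_nonneg x) _).trans ?_)
    gcongr
    exact facPow_len_le hs α
  have h2 : ‖multiDeriv (stdDir d) β f x‖ ≤ X * (H ^ len β *
      ((((d + 1 : ℝ)) ^ σ) ^ len β * fact β ^ σ) * Real.exp (-c * ‖x‖ ^ (1 / s))) := by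
    rw [← hL, ← wordDeriv_eq_multiDeriv _ _ hf.1, hL]
    refine (hf.2 L x).trans ?_
    rw [hlen]
    gcongr
    exact facPow_len_le hσ β
  have p1 := (Real.rpow_pos_of_pos (fact_pos α) s).le
  have p2 := (Real.rpow_pos_of_pos (fact_pos β) σ).le
  have q1 : ((s / c) ^ s * (d + 1 : ℝ) ^ s) ^ len α ≤ stepIndex d s σ H c ^ len α := by
    refine pow_le_pow_left₀ (by positivity) ?_ _
    unfold stepIndex
    have : 0 ≤ H * (d + 1 : ℝ) ^ σ := by positivity
    linarith
  have q2 : (H * (d + 1 : ℝ) ^ σ) ^ len β ≤ stepIndex d s σ H c ^ len β := by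
    refine pow_le_pow_left₀ (by positivity) ?_ _
    unfold stepIndex
    have : 0 ≤ (s / c) ^ s * (d + 1 : ℝ) ^ s := by positivity
    linarith
  have p3 := (stepIndex_pos (d := d) (σ := σ) hs hH hc).le
  calc |monom α x| * ‖multiDeriv (stdDir d) β f x‖
      ≤ (((s / c) ^ s) ^ len α * ((((d + 1 : ℝ)) ^ s) ^ len α * fact α ^ s) *
        Real.exp (c * ‖x‖ ^ (1 / s))) * (X * (H ^ len β *
        ((((d + 1 : ℝ)) ^ σ) ^ len β * fact β ^ σ) * Real.exp (-c * ‖x‖ ^ (1 / s)))) := by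
        gcongr
    _ = X * (((s / c) ^ s * (d + 1 : ℝ) ^ s) ^ len α * (H * (d + 1 : ℝ) ^ σ) ^ len β *
        fact α ^ s * fact β ^ σ) *
        (Real.exp (c * ‖x‖ ^ (1 / s)) * Real.exp (-c * ‖x‖ ^ (1 / s))) := by
        rw [mul_pow, mul_pow]; ring
    _ = X * (((s / c) ^ s * (d + 1 : ℝ) ^ s) ^ len α * (H * (d + 1 : ℝ) ^ σ) ^ len β *
        fact α ^ s * fact β ^ σ) := by
        rw [← Real.exp_add]; simp
    _ ≤ X * (stepIndex d s σ H c ^ len α * stepIndex d s σ H c ^ len β *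
        fact α ^ s * fact β ^ σ) := by gcongr
    _ = _ := by rw [pow_add]

end Bounds

/-! ### Fourier integrals -/

section Fourier

variable {d : ℕ}

/-- The oscillating factor `e^{i⟨w,ξ⟩}`. -/
noncomputable def phase (w ξ : E d) : ℂ := Complex.exp (Complex.I * (inner ℝ w ξ : ℝ))

theorem norm_phase (w ξ : E d) : ‖phase w ξ‖ = 1 := by
  rw [phase, mul_comm, Complex.norm_exp_ofReal_mul_I]

theorem phase_comm (w ξ : E d) : phase w ξ = phase ξ w := by
  rw [phase, phase, real_inner_comm]

theorem phase_neg_neg (w ξ : E d) : phase (-w) (-ξ) = phase w ξ := by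
  simp [phase]

theorem continuous_phase : Continuous fun p : E d × E d => phase p.1 p.2 := by
  unfold phase
  fun_prop

theorem contDiff_phase (ξ : E d) : ContDiff ℝ ∞ fun w => phase w ξ := by
  unfold phase
  refine Complex.contDiff_exp.comp (contDiff_const.mul (Complex.ofRealCLM.contDiff.comp ?_))
  exact contDiff_id.inner ℝ contDiff_const

theorem dirDeriv_phase (i : Fin d) (ξ : E d) :
    dirDeriv (stdDir d i) (fun w => phase w ξ) = fun w => Complex.I * (ξ i : ℂ) * phase w ξ := by
  funext w
  have h1 : HasFDerivAt (fun w : E d => ((inner ℝ w ξ : ℝ) : ℂ))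
      (Complex.ofRealCLM.comp (innerSL ℝ ξ)) w := by
    have := (Complex.ofRealCLM.comp (innerSL ℝ ξ)).hasFDerivAt (x := w)
    refine this.congr_of_eventuallyEq (Filter.Eventually.of_forall fun y => ?_)
    simp [real_inner_comm]
  have h2 := (h1.const_mul Complex.I).cexp
  rw [dirDeriv]
  unfold phase
  rw [h2.fderiv]
  have h3 : inner ℝ ξ (stdDir d i) = ξ i := by
    simp [stdDir, EuclideanSpace.inner_single_right]
  simp [h3]
  ring

/-- Integration by parts against the constant function 1. -/
theorem integral_dirDeriv_eq_zero (v : E d) {φ : E d → ℂ} (hd : Differentiable ℝ φ)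
    (hφ : Integrable φ) (hφ' : Integrable (dirDeriv v φ)) : ∫ w, dirDeriv v φ w = 0 := by
  have := integral_mul_fderiv_eq_neg_fderiv_mul_of_integrable (μ := (volume : Measure (E d)))
    (f := fun _ : E d => (1 : ℂ)) (g := φ) (v := v) (by simp) (by simp only [one_mul]; exact hφ')
    (by simpa using hφ) (fun x _ => differentiableAt_const _) (fun x _ => hd x)
  simpa [dirDeriv] using this

theorem Integrable.mul_phase {φ : E d → ℂ} (hφ : Integrable φ) (ξ : E d) :
    Integrable fun w => φ w * phase w ξ :=
  hφ.mul_bdd (c := 1) (contDiff_phase ξ).continuous.aestronglyMeasurable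
    (Filter.Eventually.of_forall fun w => (norm_phase w ξ).le)

theorem integral_dirDeriv_mul_phase (i : Fin d) {φ : E d → ℂ} (hd : ContDiff ℝ ∞ φ)
    (hφ : Integrable φ) (hφ' : Integrable (dirDeriv (stdDir d i) φ)) (ξ : E d) :
    ∫ w, dirDeriv (stdDir d i) φ w * phase w ξ =
      -(Complex.I * (ξ i : ℂ)) * ∫ w, φ w * phase w ξ := by
  have h1 := dirDeriv_mul (stdDir d i) hd (contDiff_phase ξ)
  rw [dirDeriv_phase] at h1
  have e : ∀ w, dirDeriv (stdDir d i) (φ * fun w => phase w ξ) w =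
      dirDeriv (stdDir d i) φ w * phase w ξ + Complex.I * (ξ i : ℂ) * (φ w * phase w ξ) := by
    intro w
    rw [h1]
    simp only [Pi.add_apply, Pi.mul_apply]
    ring
  have i1 := Integrable.mul_phase hφ' ξ
  have i2 := (Integrable.mul_phase hφ ξ).const_mul (Complex.I * (ξ i : ℂ))
  have h2 := integral_dirDeriv_eq_zero (stdDir d i)
    ((hd.mul (contDiff_phase ξ)).differentiable (by simp)) (Integrable.mul_phase hφ ξ)
    ((i1.add i2).congr (Filter.Eventually.of_forall fun w => (e w).symm))
  have h3 : ∫ w, dirDeriv (stdDir d i) (φ * fun w => phase w ξ) w = 0 := h2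
  rw [integral_congr_ae (Filter.Eventually.of_forall e), integral_add i1 i2,
    integral_const_mul] at h3
  linear_combination h3

/-- Gevrey regularity of `φ` gives exponential decay of its Fourier transform. -/
theorem norm_integral_mul_phase_le {σ X H : ℝ} (hσ : 0 < σ) (hH : 0 < H)
    {φ : E d → ℂ} (hd : ContDiff ℝ ∞ φ) {ψ : E d → ℝ} (hψ : Integrable ψ)
    (hb : ∀ (L : List (Fin d)) (w : E d),
      ‖wordDeriv (stdDir d) L φ w‖ ≤ X * (H ^ L.length * facPow σ L.length) * ψ w) (ξ : E d) :
    ‖∫ w, φ w * phase w ξ‖ ≤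
      X * (∫ w, ψ w) * 2 ^ σ * Real.exp (-rate σ ((d + 1) * H) * ‖ξ‖ ^ (1 / σ)) := by
  have hint : ∀ L, Integrable (wordDeriv (stdDir d) L φ) := fun L =>
    (hψ.const_mul _).mono' (contDiff_wordDeriv _ _ hd).continuous.aestronglyMeasurable
      (Filter.Eventually.of_forall (hb L))
  have hnorm : ∀ L, ‖∫ w, wordDeriv (stdDir d) L φ w * phase w ξ‖ ≤
      X * (∫ w, ψ w) * (H ^ L.length * facPow σ L.length) := by
    intro L
    calc _ ≤ ∫ w, X * (H ^ L.length * facPow σ L.length) * ψ w := by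
          refine norm_integral_le_of_norm_le (hψ.const_mul _)
            (Filter.Eventually.of_forall fun w => ?_)
          rw [norm_mul, norm_phase, mul_one]
          exact hb L w
      _ = _ := by rw [integral_const_mul]; ring
  -- Integrating by parts n times in direction i trades |ξ_i|^n for n derivatives of φ. Thus `hnorm`
  -- bounds the coordinate moments of the integral.
  have hpow : ∀ (i : Fin d) (n : ℕ),
      ‖∫ w, wordDeriv (stdDir d) (List.replicate n i) φ w * phase w ξ‖ =
        |ξ i| ^ n * ‖∫ w, φ w * phase w ξ‖ := by
    intro i n
    induction n with
    | zero => simp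
    | succ n ih =>
      have h1 : wordDeriv (stdDir d) (List.replicate (n + 1) i) φ =
          dirDeriv (stdDir d i) (wordDeriv (stdDir d) (List.replicate n i) φ) := by
        rw [dirDeriv_wordDeriv _ _ _ hd]; rfl
      have h2 := hint (List.replicate (n + 1) i)
      rw [h1] at h2
      rw [h1, integral_dirDeriv_mul_phase i (contDiff_wordDeriv _ _ hd)
        (hint (List.replicate n i)) h2 ξ, norm_mul, ih]
      simp only [norm_neg, norm_mul, Complex.norm_I, Complex.norm_real, Real.norm_eq_abs]
      ring
  refine le_exp_of_coord_moments hσ hH ξ (norm_nonneg _) (by simpa using hnorm []) fun i n => ?_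
  have := hnorm (List.replicate n i)
  rwa [hpow, List.length_replicate] at this

theorem eq_sum_smulRight (l : E d →L[ℝ] ℂ) :
    l = ∑ i, (EuclideanSpace.proj (𝕜 := ℝ) i).smulRight (l (stdDir d i)) := by
  ext x
  have hx : x = ∑ i, x i • stdDir d i := by
    ext j
    simp [stdDir, Pi.single_apply]
  conv_lhs => rw [hx]
  simp [map_sum]

/-- Differentiation under the integral sign. -/
theorem differentiable_integral {F : E d → E d → ℂ} {F' : Fin d → E d → E d → ℂ}
    (hF : ∀ w, Differentiable ℝ fun x => F x w)
    (hF' : ∀ i x w, dirDeriv (stdDir d i) (fun x => F x w) x = F' i x w)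
    (hint : ∀ x, Integrable (F x)) (hmeas : ∀ i x, AEStronglyMeasurable (F' i x))
    (hb : ∀ R : ℝ, ∃ ψ : E d → ℝ, Integrable ψ ∧ ∀ i x w, ‖x‖ ≤ R → ‖F' i x w‖ ≤ ψ w) :
    (Differentiable ℝ fun x => ∫ w, F x w) ∧
      ∀ i x, dirDeriv (stdDir d i) (fun x => ∫ w, F x w) x = ∫ w, F' i x w := by
  have hfd : ∀ x w, fderiv ℝ (fun x => F x w) x =
      ∑ i, (EuclideanSpace.proj (𝕜 := ℝ) i).smulRight (F' i x w) := by
    intro x w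
    rw [eq_sum_smulRight (fderiv ℝ (fun x => F x w) x)]
    refine Finset.sum_congr rfl fun i _ => ?_
    rw [← hF' i x w]
    rfl
  have hm : ∀ x, AEStronglyMeasurable (fun w => fderiv ℝ (fun x => F x w) x) := by
    intro x
    simp only [hfd]
    refine Finset.aestronglyMeasurable_fun_sum _ fun i _ => ?_
    exact ((ContinuousLinearMap.smulRightL ℝ (E d) ℂ
      (EuclideanSpace.proj (𝕜 := ℝ) i)).continuous.comp_aestronglyMeasurable (hmeas i x))
  have key : ∀ x₀, Integrable (fun w => fderiv ℝ (fun x => F x w) x₀) ∧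
      HasFDerivAt (fun x => ∫ w, F x w) (∫ w, fderiv ℝ (fun x => F x w) x₀) x₀ := by
    intro x₀
    -- The unit ball around `x₀`, on which domination is needed, lies in the ball of this radius
    -- around the origin. Hence the majorant may depend on R.
    obtain ⟨ψ, hψ, hψb⟩ := hb (‖x₀‖ + 1)
    set Ψ : E d → ℝ := fun w => ∑ i : Fin d, ‖(EuclideanSpace.proj i : E d →L[ℝ] ℝ)‖ * ψ w
    have hΨ : Integrable Ψ := integrable_finsetSum _ fun i _ => hψ.const_mul _
    have hbd : ∀ w, ∀ x ∈ Metric.ball x₀ 1, ‖fderiv ℝ (fun x => F x w) x‖ ≤ Ψ w := by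
      intro w x hx
      rw [hfd]
      refine (norm_sum_le _ _).trans (Finset.sum_le_sum fun i _ => ?_)
      rw [ContinuousLinearMap.norm_smulRight_apply]
      gcongr
      refine hψb i x w ?_
      have := norm_le_norm_add_norm_sub' x x₀
      rw [mem_ball_iff_norm] at hx
      linarith
    refine ⟨hΨ.mono' (hm x₀) (Filter.Eventually.of_forall fun w =>
      hbd w x₀ (Metric.mem_ball_self one_pos)), ?_⟩
    exact hasFDerivAt_integral_of_dominated_of_fderiv_le (Metric.ball_mem_nhds x₀ one_pos)
      (Filter.Eventually.of_forall fun x => (hint x).aestronglyMeasurable) (hint x₀) (hm x₀)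
      (Filter.Eventually.of_forall hbd) hΨ
      (Filter.Eventually.of_forall fun w x _ => (hF w x).hasFDerivAt)
  refine ⟨fun x => (key x).2.differentiableAt, fun i x => ?_⟩
  rw [dirDeriv, (key x).2.fderiv, ContinuousLinearMap.integral_apply (key x).1]
  exact integral_congr_ae (Filter.Eventually.of_forall fun w => hF' i x w)

theorem contDiff_succ_of_dirDeriv {n : ℕ} {F : E d → ℂ} (hF : Differentiable ℝ F)
    (h : ∀ i, ContDiff ℝ n (dirDeriv (stdDir d i) F)) : ContDiff ℝ (n + 1 : ℕ) F := by
  rw [Nat.cast_add, Nat.cast_one, contDiff_succ_iff_fderiv]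
  refine ⟨hF, by simp, ?_⟩
  have : fderiv ℝ F = fun x => ∑ i, (EuclideanSpace.proj (𝕜 := ℝ) i).smulRight
      (dirDeriv (stdDir d i) F x) := by
    funext x
    exact eq_sum_smulRight _
  rw [this]
  exact ContDiff.sum fun i _ => (ContinuousLinearMap.smulRightL ℝ (E d) ℂ
      (EuclideanSpace.proj (𝕜 := ℝ) i)).contDiff.comp (h i)

end Fourier

/-! ### The amplitude of a pseudo-differential operator -/

section Amplitude

variable {d : ℕ} {s σ : ℝ}

/-- The integrand of `ampl`, without the oscillating factor. -/
noncomputable def amplFun (A : E d →L[ℝ] E d) (b : E d × E d → ℂ) (g : E d → ℂ) (x ξ w : E d) : ℂ :=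
  b (x - A w, ξ) * g (x - w)

/-- `∫ b(x - Aw, ξ) g(x - w) e^{i⟨w,ξ⟩} dw`. -/
noncomputable def ampl (A : E d →L[ℝ] E d) (b : E d × E d → ℂ) (g : E d → ℂ) (x ξ : E d) : ℂ :=
  ∫ w, amplFun A b g x ξ w * phase w ξ

/-- The growth constant of `|x - Aw|^{1/s}`. -/
noncomputable def growthConst (s : ℝ) (A : E d →L[ℝ] E d) : ℝ := (2 * (1 + ‖A‖)) ^ (1 / s)

theorem growthConst_pos (s : ℝ) (A : E d →L[ℝ] E d) : 0 < growthConst s A := by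
  unfold growthConst; positivity

theorem norm_rpow_le_growthConst (hs : 0 < s) (A : E d →L[ℝ] E d) {u x y : E d}
    (h : ‖u‖ ≤ (1 + ‖A‖) * (‖x‖ + ‖y‖)) :
    ‖u‖ ^ (1 / s) ≤ growthConst s A * (‖x‖ ^ (1 / s) + ‖y‖ ^ (1 / s)) :=
  rpow_le_of_le_mul_add hs (by positivity) (norm_nonneg _) (norm_nonneg _) (norm_nonneg _) h

/-- Writing x - Aw = (x - Ax) + A(x - w) controls the argument of the symbol by x and by x - w, the
variable in which g decays. -/
theorem norm_sub_apply_le (A : E d →L[ℝ] E d) (x w : E d) :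
    ‖x - A w‖ ≤ (1 + ‖A‖) * (‖x‖ + ‖x - w‖) := by
  have h1 : x - A w = x - A x + A (x - w) := by rw [map_sub]; abel
  have h2 := A.le_opNorm x
  have h3 := A.le_opNorm (x - w)
  have h4 : ‖x - A w‖ ≤ ‖x‖ + ‖A x‖ + ‖A (x - w)‖ := by
    rw [h1]; exact (norm_add_le _ _).trans (add_le_add_left (norm_sub_le _ _) _)
  nlinarith [norm_nonneg (x - w), norm_nonneg x]

/-- Given the same shape as `norm_sub_apply_le`, so that `growthConst` serves both. -/
theorem norm_le_add_sub (A : E d →L[ℝ] E d) (x w : E d) :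
    ‖w‖ ≤ (1 + ‖A‖) * (‖x‖ + ‖x - w‖) := by
  have h1 : ‖w‖ ≤ ‖x‖ + ‖x - w‖ := by
    have := norm_sub_le x (x - w)
    rwa [sub_sub_cancel] at this
  have := mul_nonneg (norm_nonneg A) (add_nonneg (norm_nonneg x) (norm_nonneg (x - w)))
  linarith

/-- A bound for the coefficients of `A` with respect to the coordinate directions. -/
noncomputable def coeffConst (A : E d →L[ℝ] E d) : ℝ := 1 + ∑ i, ∑ j, |A (stdDir d i) j|

theorem one_le_coeffConst (A : E d →L[ℝ] E d) : 1 ≤ coeffConst A :=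
  le_add_of_nonneg_right (Finset.sum_nonneg fun _ _ => Finset.sum_nonneg fun _ _ => abs_nonneg _)

theorem sum_abs_le_coeffConst (A : E d →L[ℝ] E d) (i : Fin d) :
    ∑ j, |A (stdDir d i) j| ≤ coeffConst A := by
  have := Finset.single_le_sum (f := fun i => ∑ j, |A (stdDir d i) j|)
    (fun _ _ => Finset.sum_nonneg fun _ _ => abs_nonneg _) (Finset.mem_univ i)
  unfold coeffConst
  linarith

theorem eq_sum_stdDir (x : E d) : x = ∑ i, x i • stdDir d i := by
  ext j
  simp [stdDir, Pi.single_apply]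

theorem norm_wordDeriv_comp_le (B : E d →L[ℝ] E d) (p : E d) (L : List (Fin d)) {g : E d → ℂ}
    (hg : ContDiff ℝ ∞ g) (w : E d) {Y : ℝ} (hY : 0 ≤ Y)
    (h : ∀ M : List (Fin d), M.length = L.length → ‖wordDeriv (stdDir d) M g (p + B w)‖ ≤ Y) :
    ‖wordDeriv (stdDir d) L (fun w => g (p + B w)) w‖ ≤ coeffConst B ^ L.length * Y :=
  norm_wordDeriv_comp_affine_le (stdDir d) (stdDir d) B p (fun i j => B (stdDir d i) j)
    (fun _ => eq_sum_stdDir _) (zero_le_one.trans (one_le_coeffConst B)) (sum_abs_le_coeffConst B)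
    L hg w hY h

theorem norm_wordDeriv_comp_fst_le (A : E d →L[ℝ] E d) (x ξ : E d) (L : List (Fin d))
    {b : E d × E d → ℂ} (hb : ContDiff ℝ ∞ b) (w : E d) {Y : ℝ} (hY : 0 ≤ Y)
    (h : ∀ M : List (Fin d), M.length = L.length →
      ‖wordDeriv (dirX d) M b (x - A w, ξ)‖ ≤ Y) :
    ‖wordDeriv (stdDir d) L (fun w => b (x - A w, ξ)) w‖ ≤ coeffConst A ^ L.length * Y := by
  set B : E d →L[ℝ] E d × E d := -((ContinuousLinearMap.inl ℝ (E d) (E d)).comp A) with hB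
  have e : ∀ w, (x - A w, ξ) = (x, ξ) + B w := by
    intro w
    ext1 <;> simp [hB, sub_eq_add_neg]
  simp only [e] at h ⊢
  refine norm_wordDeriv_comp_affine_le (dirX d) (stdDir d) B (x, ξ)
    (fun i j => -(A (stdDir d i) j)) (fun i => ?_) (zero_le_one.trans (one_le_coeffConst A))
    (fun i => by simpa using sum_abs_le_coeffConst A i) L hb w hY h
  have : B (stdDir d i) = -ContinuousLinearMap.inl ℝ (E d) (E d) (A (stdDir d i)) := rfl
  rw [this, eq_sum_stdDir (A (stdDir d i)), map_sum, ← Finset.sum_neg_distrib]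
  refine Finset.sum_congr rfl fun j _ => ?_
  rw [← eq_sum_stdDir, map_smul, neg_smul]
  rfl

theorem contDiff_amplFun (A : E d →L[ℝ] E d) {b : E d × E d → ℂ} {g : E d → ℂ}
    (hb : ContDiff ℝ ∞ b) (hg : ContDiff ℝ ∞ g) :
    ContDiff ℝ ∞ fun p : (E d × E d) × E d => amplFun A b g p.1.1 p.1.2 p.2 := by
  unfold amplFun
  have h1 : ContDiff ℝ ∞ fun p : (E d × E d) × E d => A p.2 := A.contDiff.comp contDiff_snd
  have h2 : ContDiff ℝ ∞ fun p : (E d × E d) × E d => p.1.1 := contDiff_fst.comp contDiff_fst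
  have h3 : ContDiff ℝ ∞ fun p : (E d × E d) × E d => p.1.2 := contDiff_snd.comp contDiff_fst
  exact (hb.comp ((h2.sub h1).prodMk h3)).mul (hg.comp (h2.sub contDiff_snd))

/-- Derivatives of the integrand of the amplitude. -/
theorem norm_wordDeriv_amplFun_le (hs : 0 < s) (hσ : 0 < σ) (A : E d →L[ℝ] E d) {P Q H c r : ℝ}
    (hH : 0 < H) (hr : 0 ≤ r) (hrc : r * growthConst s A ≤ c / 2) {b : E d × E d → ℂ} {g : E d → ℂ}
    (hb : SymBound s σ P H r b) (hg : GSBound s σ Q H c g) (x ξ : E d) (L : List (Fin d))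
    (w : E d) :
    ‖wordDeriv (stdDir d) L (amplFun A b g x ξ) w‖ ≤
      P * Q * Real.exp (r * growthConst s A * ‖x‖ ^ (1 / s) + r * ‖ξ‖ ^ (1 / σ)) *
        ((2 * coeffConst A * H) ^ L.length * facPow σ L.length) *
        Real.exp (-(c / 2) * ‖x - w‖ ^ (1 / s)) := by
  have hP := hb.const_nonneg
  have hQ := hg.const_nonneg
  have hA1 := one_le_coeffConst A
  have hA0 := zero_le_one.trans hA1
  have hb1 : ContDiff ℝ ∞ fun w => b (x - A w, ξ) :=
    hb.1.comp ((contDiff_const.sub A.contDiff).prodMk contDiff_const)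
  have hg1 : ContDiff ℝ ∞ fun w => g (x - w) := hg.1.comp (contDiff_const.sub contDiff_id)
  set κ := growthConst s A with hκ
  -- Half of the decay of g in x - w pays for the growth of b in that variable, because rκ ≤ c/2.
  -- Only growth in x and ξ is left.
  have hexp : Real.exp (r * (‖x - A w‖ ^ (1 / s) + ‖ξ‖ ^ (1 / σ))) *
      Real.exp (-c * ‖x - w‖ ^ (1 / s)) ≤
      Real.exp (r * κ * ‖x‖ ^ (1 / s) + r * ‖ξ‖ ^ (1 / σ)) *
        Real.exp (-(c / 2) * ‖x - w‖ ^ (1 / s)) := by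
    rw [← Real.exp_add, ← Real.exp_add]
    refine Real.exp_le_exp.2 ?_
    have h1 := norm_rpow_le_growthConst hs A (norm_sub_apply_le A x w)
    have h2 := mul_le_mul_of_nonneg_left h1 hr
    have h3 := mul_le_mul_of_nonneg_right hrc
      (Real.rpow_nonneg (norm_nonneg (x - w)) (1 / s))
    nlinarith
  have hfL := facPow_pos σ L.length
  refine (norm_wordDeriv_mul_le (stdDir d) L hb1 hg1 w
    (P * Q * ((coeffConst A * H) ^ L.length * facPow σ L.length) *
      (Real.exp (r * (‖x - A w‖ ^ (1 / s) + ‖ξ‖ ^ (1 / σ))) *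
      Real.exp (-c * ‖x - w‖ ^ (1 / s)))) fun M N hMN => ?_).trans ?_
  · have pM := facPow_pos σ M.length
    have pN := facPow_pos σ N.length
    have h1 := norm_wordDeriv_comp_fst_le A x ξ M hb.1 w
      (Y := P * (H ^ M.length * facPow σ M.length *
        Real.exp (r * (‖x - A w‖ ^ (1 / s) + ‖ξ‖ ^ (1 / σ))))) (by positivity) fun M' hM' => by
          have := hb.2 M' [] (x - A w) ξ
          simpa [hM'] using this
    -- The map w ↦ -w has coefficient rows of absolute sum 1, so this factor contributes no
    -- constant.
    have h2 := norm_wordDeriv_comp_affine_le (stdDir d) (stdDir d)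
      (-ContinuousLinearMap.id ℝ (E d)) x (fun i j => -(stdDir d i) j)
      (fun i => by
        simp only [neg_smul, Finset.sum_neg_distrib, ← eq_sum_stdDir]
        rfl)
      zero_le_one (fun i => by
        simp [stdDir, apply_ite abs]) N hg.1 w
      (Y := Q * (H ^ N.length * facPow σ N.length * Real.exp (-c * ‖x - w‖ ^ (1 / s))))
      (by positivity) fun N' hN' => by
        have := hg.2 N' (x + (-ContinuousLinearMap.id ℝ (E d)) w)
        rw [hN'] at this
        simpa [sub_eq_add_neg] using this
    have h3 : (fun w => g (x + (-ContinuousLinearMap.id ℝ (E d)) w)) = fun w => g (x - w) := by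
      funext w; simp [sub_eq_add_neg]
    rw [h3, one_pow, one_mul] at h2
    have h4 := facPow_mul_le hσ M.length N.length
    rw [hMN] at h4
    have h5 : coeffConst A ^ M.length ≤ coeffConst A ^ L.length :=
      pow_le_pow_right₀ hA1 (by omega)
    calc _ ≤ (coeffConst A ^ M.length * (P * (H ^ M.length * facPow σ M.length *
          Real.exp (r * (‖x - A w‖ ^ (1 / s) + ‖ξ‖ ^ (1 / σ)))))) *
          (Q * (H ^ N.length * facPow σ N.length * Real.exp (-c * ‖x - w‖ ^ (1 / s)))) := by
          gcongr
      _ = P * Q * (coeffConst A ^ M.length * H ^ (M.length + N.length) *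
          (facPow σ M.length * facPow σ N.length)) *
          (Real.exp (r * (‖x - A w‖ ^ (1 / s) + ‖ξ‖ ^ (1 / σ))) *
          Real.exp (-c * ‖x - w‖ ^ (1 / s))) := by rw [pow_add]; ring
      _ ≤ P * Q * (coeffConst A ^ L.length * H ^ L.length * facPow σ L.length) *
          (Real.exp (r * (‖x - A w‖ ^ (1 / s) + ‖ξ‖ ^ (1 / σ))) *
          Real.exp (-c * ‖x - w‖ ^ (1 / s))) := by rw [hMN]; gcongr
      _ = _ := by rw [mul_pow]
  · calc _ = P * Q * ((2 * coeffConst A * H) ^ L.length * facPow σ L.length) *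
          (Real.exp (r * (‖x - A w‖ ^ (1 / s) + ‖ξ‖ ^ (1 / σ))) *
          Real.exp (-c * ‖x - w‖ ^ (1 / s))) := by
          rw [mul_assoc 2, mul_pow 2 (coeffConst A * H)]; ring
      _ ≤ P * Q * ((2 * coeffConst A * H) ^ L.length * facPow σ L.length) *
          (Real.exp (r * κ * ‖x‖ ^ (1 / s) + r * ‖ξ‖ ^ (1 / σ)) *
          Real.exp (-(c / 2) * ‖x - w‖ ^ (1 / s))) := by gcongr
      _ = _ := by ring

/-- The mass of `exp(-c |y|^{1/s})`. -/
noncomputable def expMass (d : ℕ) (s c : ℝ) : ℝ := ∫ y : E d, Real.exp (-c * ‖y‖ ^ (1 / s))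

theorem expMass_nonneg (d : ℕ) (s c : ℝ) : 0 ≤ expMass d s c :=
  integral_nonneg fun _ => (Real.exp_pos _).le

/-- The rate of decay of amplitudes in the frequency variable. -/
noncomputable def amplRate (σ : ℝ) (A : E d →L[ℝ] E d) (H : ℝ) : ℝ :=
  rate σ ((d + 1) * (2 * coeffConst A * H))

theorem amplRate_pos (hσ : 0 < σ) (A : E d →L[ℝ] E d) {H : ℝ} (hH : 0 < H) :
    0 < amplRate σ A H := by
  have := zero_lt_one.trans_le (one_le_coeffConst A)
  exact rate_pos hσ (by positivity)

/-- The Gevrey bounds in w give decay in ξ at the rate `amplRate`, which involves H but not r. Half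
of it absorbs the growth e^{r|ξ|^{1/σ}} of the symbol. -/
theorem norm_ampl_le (hs : 0 < s) (hσ : 0 < σ) (A : E d →L[ℝ] E d) {P Q H c r : ℝ}
    (hH : 0 < H) (hc : 0 < c) (hr : 0 ≤ r) (hrc : r * growthConst s A ≤ c / 2)
    (hrσ : r ≤ amplRate σ A H / 2)
    {b : E d × E d → ℂ} {g : E d → ℂ} (hb : SymBound s σ P H r b) (hg : GSBound s σ Q H c g)
    (x ξ : E d) :
    ‖ampl A b g x ξ‖ ≤ P * Q * expMass d s (c / 2) * 2 ^ σ *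
      Real.exp (r * growthConst s A * ‖x‖ ^ (1 / s)) *
      Real.exp (-(amplRate σ A H / 2) * ‖ξ‖ ^ (1 / σ)) := by
  have hA1 := zero_lt_one.trans_le (one_le_coeffConst A)
  have hψ : Integrable fun w : E d => Real.exp (-(c / 2) * ‖x - w‖ ^ (1 / s)) :=
    (integrable_exp_neg_rpow hs (half_pos hc)).comp_sub_left x
  have hsm : ContDiff ℝ ∞ (amplFun A b g x ξ) :=
    (contDiff_amplFun A hb.1 hg.1).comp (contDiff_const (c := (x, ξ)) |>.prodMk contDiff_id)
  have hP := hb.const_nonneg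
  have hQ := hg.const_nonneg
  refine (norm_integral_mul_phase_le hσ (by positivity : 0 < 2 * coeffConst A * H) hsm hψ
    (fun L w => norm_wordDeriv_amplFun_le hs hσ A hH hr hrc hb hg x ξ L w) ξ).trans ?_
  have hmass : ∫ w : E d, Real.exp (-(c / 2) * ‖x - w‖ ^ (1 / s)) = expMass d s (c / 2) :=
    integral_sub_left_eq_self (fun w : E d => Real.exp (-(c / 2) * ‖w‖ ^ (1 / s))) volume x
  rw [hmass]
  have hm := expMass_nonneg d s (c / 2)
  have hexp : Real.exp (r * growthConst s A * ‖x‖ ^ (1 / s) + r * ‖ξ‖ ^ (1 / σ)) *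
      Real.exp (-amplRate σ A H * ‖ξ‖ ^ (1 / σ)) ≤
      Real.exp (r * growthConst s A * ‖x‖ ^ (1 / s)) *
      Real.exp (-(amplRate σ A H / 2) * ‖ξ‖ ^ (1 / σ)) := by
    rw [← Real.exp_add, ← Real.exp_add]
    refine Real.exp_le_exp.2 ?_
    have := mul_le_mul_of_nonneg_right hrσ (Real.rpow_nonneg (norm_nonneg ξ) (1 / σ))
    nlinarith
  calc _ = P * Q * expMass d s (c / 2) * 2 ^ σ *
        (Real.exp (r * growthConst s A * ‖x‖ ^ (1 / s) + r * ‖ξ‖ ^ (1 / σ)) *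
        Real.exp (-amplRate σ A H * ‖ξ‖ ^ (1 / σ))) := by unfold amplRate; ring
    _ ≤ P * Q * expMass d s (c / 2) * 2 ^ σ *
        (Real.exp (r * growthConst s A * ‖x‖ ^ (1 / s)) *
        Real.exp (-(amplRate σ A H / 2) * ‖ξ‖ ^ (1 / σ))) := by gcongr
    _ = _ := by ring

end Amplitude

/-! ### The operator on functions -/

section Operator

variable {d : ℕ} {s σ : ℝ} (A : E d →L[ℝ] E d) {b : E d × E d → ℂ} {g : E d → ℂ}

/-- The rate c comes from g alone and is chosen before ε; only the constant C depends on ε. -/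
theorem exists_norm_amplFun_le (hs : 0 < s) (hσ : 0 < σ) (hb : IsWordSymbol s σ b)
    (hg : IsGSDecay s σ g) : ∃ c : ℝ, 0 < c ∧ ∀ ε : ℝ, 0 < ε → ∃ C : ℝ, 0 ≤ C ∧ ∀ x ξ w,
      ‖amplFun A b g x ξ w‖ ≤ C * Real.exp (ε * ‖x‖ ^ (1 / s)) * Real.exp (ε * ‖ξ‖ ^ (1 / σ)) *
        Real.exp (-c * ‖x - w‖ ^ (1 / s)) := by
  obtain ⟨h, hh, hr⟩ := hb
  obtain ⟨Q, H, c, hH, hc, hg⟩ := hg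
  have hκ := growthConst_pos s A
  refine ⟨c / 2, half_pos hc, fun ε hε => ?_⟩
  -- The three constraints keep the growth below half of the decay of g, below ε in x, and below ε
  -- in ξ.
  set r := min (c / 2 / growthConst s A) (min (ε / growthConst s A) ε)
  have hr0 : 0 < r := by positivity
  have hr1 : r * growthConst s A ≤ c / 2 := (le_div_iff₀ hκ).1 (min_le_left _ _)
  have hr2 : r * growthConst s A ≤ ε :=
    (le_div_iff₀ hκ).1 ((min_le_right _ _).trans (min_le_left _ _))
  have hr3 : r ≤ ε := (min_le_right _ _).trans (min_le_right _ _)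
  obtain ⟨P, hP⟩ := hr r hr0
  have hmax : 0 < max h H := lt_max_of_lt_left hh
  have key := norm_wordDeriv_amplFun_le hs hσ A hmax hr0.le hr1
    (hP.mono hh le_rfl (le_max_left h H)) (hg.mono hH le_rfl (le_max_right h H))
  have hP0 := hP.const_nonneg
  have hQ0 := hg.const_nonneg
  refine ⟨P * Q, by positivity, fun x ξ w => (key x ξ [] w).trans ?_⟩
  simp only [List.length_nil, pow_zero, facPow_zero, mul_one]
  rw [Real.exp_add, ← mul_assoc]
  gcongr

/-- Provides an integrable majorant in w, uniform for bounded x and ξ, as needed for differentiation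
under the integral sign. Decay in x - w becomes decay in w through `norm_le_add_sub`. -/
theorem exists_norm_amplFun_le_of_norm_le (hs : 0 < s) (hσ : 0 < σ) (hb : IsWordSymbol s σ b)
    (hg : IsGSDecay s σ g) (R : ℝ) : ∃ C c : ℝ, 0 ≤ C ∧ 0 < c ∧ ∀ x ξ w, ‖x‖ ≤ R → ‖ξ‖ ≤ R →
      ‖amplFun A b g x ξ w‖ ≤ C * Real.exp (-c * ‖w‖ ^ (1 / s)) := by
  obtain ⟨c, hc, h⟩ := exists_norm_amplFun_le A hs hσ hb hg
  obtain ⟨C, hC0, hC⟩ := h 1 one_pos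
  have hκ := growthConst_pos s A
  refine ⟨C * Real.exp (1 * R ^ (1 / s)) * Real.exp (1 * R ^ (1 / σ)) * Real.exp (c * R ^ (1 / s)),
    c / growthConst s A, by positivity, by positivity, fun x ξ w hx hξ => (hC x ξ w).trans ?_⟩
  have h1 := norm_rpow_le_growthConst hs A (norm_le_add_sub A x w)
  have hx1 : ‖x‖ ^ (1 / s) ≤ R ^ (1 / s) :=
    Real.rpow_le_rpow (norm_nonneg _) hx (by positivity)
  have hξ1 : ‖ξ‖ ^ (1 / σ) ≤ R ^ (1 / σ) :=
    Real.rpow_le_rpow (norm_nonneg _) hξ (by positivity)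
  have h2 : Real.exp (-c * ‖x - w‖ ^ (1 / s)) ≤
      Real.exp (c * R ^ (1 / s)) * Real.exp (-(c / growthConst s A) * ‖w‖ ^ (1 / s)) := by
    rw [← Real.exp_add]
    refine Real.exp_le_exp.2 ?_
    have h3 : c / growthConst s A * ‖w‖ ^ (1 / s) ≤ c * (‖x‖ ^ (1 / s) + ‖x - w‖ ^ (1 / s)) := by
      rw [div_mul_eq_mul_div, div_le_iff₀ hκ]
      nlinarith
    nlinarith
  calc _ ≤ C * Real.exp (1 * R ^ (1 / s)) * Real.exp (1 * R ^ (1 / σ)) *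
        (Real.exp (c * R ^ (1 / s)) * Real.exp (-(c / growthConst s A) * ‖w‖ ^ (1 / s))) := by
        gcongr
    _ = _ := by ring

theorem contDiff_amplFun_right (hb : ContDiff ℝ ∞ b) (hg : ContDiff ℝ ∞ g) (x ξ : E d) :
    ContDiff ℝ ∞ (amplFun A b g x ξ) :=
  (contDiff_amplFun A hb hg).comp (contDiff_const (c := (x, ξ)) |>.prodMk contDiff_id)

theorem integrable_amplFun (hs : 0 < s) (hσ : 0 < σ) (hb : IsWordSymbol s σ b)
    (hg : IsGSDecay s σ g) (x ξ : E d) : Integrable (amplFun A b g x ξ) := by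
  obtain ⟨C, c, -, hc, h⟩ := exists_norm_amplFun_le_of_norm_le A hs hσ hb hg (max ‖x‖ ‖ξ‖)
  exact ((integrable_exp_neg_rpow hs hc).const_mul C).mono'
    (contDiff_amplFun_right A hb.contDiff hg.contDiff x ξ).continuous.aestronglyMeasurable
    (Filter.Eventually.of_forall fun w => h x ξ w (le_max_left _ _) (le_max_right _ _))

/-- The order of the quantifiers is the point: the decay in ξ is fixed by h and by the regularity of
g, while the growth in x can still be made arbitrarily slow. -/
theorem exists_norm_ampl_le (hs : 0 < s) (hσ : 0 < σ) (hb : IsWordSymbol s σ b)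
    (hg : IsGSDecay s σ g) : ∃ c : ℝ, 0 < c ∧ ∀ ε : ℝ, 0 < ε → ∃ C : ℝ, 0 ≤ C ∧ ∀ x ξ,
      ‖ampl A b g x ξ‖ ≤ C * Real.exp (ε * ‖x‖ ^ (1 / s)) * Real.exp (-c * ‖ξ‖ ^ (1 / σ)) := by
  obtain ⟨h, hh, hr⟩ := hb
  obtain ⟨Q, H, c, hH, hc, hg⟩ := hg
  have hκ := growthConst_pos s A
  have hmax : 0 < max h H := lt_max_of_lt_left hh
  have hρ := amplRate_pos hσ A hmax
  refine ⟨amplRate σ A (max h H) / 2, by positivity, fun ε hε => ?_⟩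
  set r := min (c / 2 / growthConst s A) (min (ε / growthConst s A) (amplRate σ A (max h H) / 2))
  have hr0 : 0 < r := by positivity
  have hr1 : r * growthConst s A ≤ c / 2 := (le_div_iff₀ hκ).1 (min_le_left _ _)
  have hr2 : r * growthConst s A ≤ ε :=
    (le_div_iff₀ hκ).1 ((min_le_right _ _).trans (min_le_left _ _))
  have hr3 : r ≤ amplRate σ A (max h H) / 2 := (min_le_right _ _).trans (min_le_right _ _)
  obtain ⟨P, hP⟩ := hr r hr0
  have key := norm_ampl_le hs hσ A hmax hc hr0.le hr1 hr3
    (hP.mono hh le_rfl (le_max_left h H)) (hg.mono hH le_rfl (le_max_right h H))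
  have hP0 := hP.const_nonneg
  have hQ0 := hg.const_nonneg
  have hm := expMass_nonneg d s (c / 2)
  refine ⟨P * Q * expMass d s (c / 2) * 2 ^ σ, by positivity, fun x ξ => (key x ξ).trans ?_⟩
  gcongr

theorem stronglyMeasurable_ampl (hb : ContDiff ℝ ∞ b) (hg : ContDiff ℝ ∞ g) :
    StronglyMeasurable fun p : E d × E d => ampl A b g p.1 p.2 := by
  have hc : Continuous fun q : (E d × E d) × E d =>
      amplFun A b g q.1.1 q.1.2 q.2 * phase q.2 q.1.2 :=
    (contDiff_amplFun A hb hg).continuous.mul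
      (continuous_phase.comp (continuous_snd.prodMk (continuous_snd.comp continuous_fst)))
  exact hc.stronglyMeasurable.integral_prod_right'

theorem stronglyMeasurable_ampl_right (hb : ContDiff ℝ ∞ b) (hg : ContDiff ℝ ∞ g) (x : E d) :
    StronglyMeasurable (ampl A b g x) :=
  (stronglyMeasurable_ampl A hb hg).comp_measurable (g := fun ξ : E d => (x, ξ))
    measurable_prodMk_left

theorem integrable_ampl (hs : 0 < s) (hσ : 0 < σ) (hb : IsWordSymbol s σ b)
    (hg : IsGSDecay s σ g) (x : E d) : Integrable (ampl A b g x) := by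
  obtain ⟨c, hc, h⟩ := exists_norm_ampl_le A hs hσ hb hg
  obtain ⟨C, -, hC⟩ := h 1 one_pos
  exact ((integrable_exp_neg_rpow hσ hc).const_mul _).mono'
    (stronglyMeasurable_ampl_right A hb.contDiff hg.contDiff x).aestronglyMeasurable
    (Filter.Eventually.of_forall fun ξ => hC x ξ)

/-! ### Derivatives of amplitudes and the commutation rules -/

theorem dirDeriv_amplFun_mul_phase (hb : ContDiff ℝ ∞ b) (hg : ContDiff ℝ ∞ g) (i : Fin d)
    (x ξ w : E d) :
    dirDeriv (stdDir d i) (fun x => amplFun A b g x ξ w * phase w ξ) x =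
      amplFun A (dirDeriv (dirX d i) b) g x ξ w * phase w ξ +
        amplFun A b (dirDeriv (stdDir d i) g) x ξ w * phase w ξ := by
  set B := ContinuousLinearMap.inl ℝ (E d) (E d) with hB
  have e1 : (fun x => b (x - A w, ξ)) = fun x => b ((-(A w), ξ) + B x) := by
    funext x
    congr 1
    ext1
    · simp [hB]; abel
    · simp [hB]
  have e2 : (fun x => g (x - w)) = fun x => g (-w + ContinuousLinearMap.id ℝ (E d) x) := by
    funext x
    congr 1
    simp; abel
  have c1 : ContDiff ℝ ∞ fun x => b (x - A w, ξ) := e1 ▸ contDiff_comp_affine B _ hb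
  have c2 : ContDiff ℝ ∞ fun x => g (x - w) := e2 ▸ contDiff_comp_affine _ _ hg
  have d1 : dirDeriv (stdDir d i) (fun x => b (x - A w, ξ)) x =
      dirDeriv (dirX d i) b (x - A w, ξ) := by
    rw [e1, dirDeriv_comp_affine B _ _ hb]
    have : (-(A w), ξ) + B x = (x - A w, ξ) := by
      ext1
      · simp [hB]; abel
      · simp [hB]
    simp only [this]
    rfl
  have d2 : dirDeriv (stdDir d i) (fun x => g (x - w)) x = dirDeriv (stdDir d i) g (x - w) := by
    rw [e2, dirDeriv_comp_affine _ _ _ hg]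
    have : -w + ContinuousLinearMap.id ℝ (E d) x = x - w := by simp; abel
    simp only [this]
    rfl
  have e3 : (fun x => amplFun A b g x ξ w * phase w ξ) =
      phase w ξ • ((fun x => b (x - A w, ξ)) * fun x => g (x - w)) := by
    funext x
    simp [amplFun, mul_comm]
  have c3 : ContDiff ℝ ∞ ((fun x => b (x - A w, ξ)) * fun x => g (x - w)) := c1.mul c2
  rw [e3, dirDeriv_smul _ _ c3, dirDeriv_mul _ c1 c2]
  simp only [Pi.smul_apply, Pi.add_apply, Pi.mul_apply, d1, d2, smul_eq_mul, amplFun]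
  ring

/-- The phase contributes i w_i, rewritten as i x_i - i (x - w)_i. The first part leaves the
integral over w, and the second is absorbed into g as a multiplication by a coordinate. -/
theorem dirDeriv_frequency_amplFun_mul_phase (hb : ContDiff ℝ ∞ b) (i : Fin d) (x ξ w : E d) :
    dirDeriv (stdDir d i) (fun ξ => amplFun A b g x ξ w * phase w ξ) ξ =
      amplFun A (dirDeriv (dirXi d i) b) g x ξ w * phase w ξ +
        Complex.I * (x i : ℂ) * (amplFun A b g x ξ w * phase w ξ) -
        Complex.I * (amplFun A b (coordFun i * g) x ξ w * phase w ξ) := by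
  set B := ContinuousLinearMap.inr ℝ (E d) (E d) with hB
  have e0 : ∀ ξ, (x - A w, 0) + B ξ = (x - A w, ξ) := by
    intro ξ
    ext1 <;> simp [hB]
  have e1 : (fun ξ => b (x - A w, ξ)) = fun ξ => b ((x - A w, 0) + B ξ) := by
    funext ξ
    rw [e0]
  have c1 : ContDiff ℝ ∞ fun ξ => b (x - A w, ξ) := e1 ▸ contDiff_comp_affine B _ hb
  have c2 : ContDiff ℝ ∞ fun ξ => phase ξ w := contDiff_phase w
  have d1 : dirDeriv (stdDir d i) (fun ξ => b (x - A w, ξ)) ξ =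
      dirDeriv (dirXi d i) b (x - A w, ξ) := by
    rw [e1, dirDeriv_comp_affine B _ _ hb]
    simp only [e0]
    rfl
  have e3 : (fun ξ => amplFun A b g x ξ w * phase w ξ) =
      g (x - w) • ((fun ξ => b (x - A w, ξ)) * fun ξ => phase ξ w) := by
    funext ξ
    simp only [amplFun, Pi.smul_apply, Pi.mul_apply, smul_eq_mul, phase_comm ξ w]
    ring
  have c3 : ContDiff ℝ ∞ ((fun ξ => b (x - A w, ξ)) * fun ξ => phase ξ w) := c1.mul c2
  rw [e3, dirDeriv_smul _ _ c3, dirDeriv_mul _ c1 c2, dirDeriv_phase]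
  simp only [Pi.smul_apply, Pi.add_apply, Pi.mul_apply, d1, smul_eq_mul, amplFun, coordFun,
    phase_comm ξ w, PiLp.sub_apply, Complex.ofReal_sub]
  ring

theorem differentiable_ampl (hs : 0 < s) (hσ : 0 < σ) (hb : IsWordSymbol s σ b)
    (hg : IsGSDecay s σ g) (ξ : E d) :
    (Differentiable ℝ fun x => ampl A b g x ξ) ∧ ∀ i x,
      dirDeriv (stdDir d i) (fun x => ampl A b g x ξ) x =
        ampl A (dirDeriv (dirX d i) b) g x ξ + ampl A b (dirDeriv (stdDir d i) g) x ξ := by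
  have hbi := fun i => hb.dirDeriv_dirX hs hσ i
  have hgi := fun i => hg.deriv hσ i
  have key := differentiable_integral (d := d) (F := fun x w => amplFun A b g x ξ w * phase w ξ)
    (F' := fun i x w => amplFun A (dirDeriv (dirX d i) b) g x ξ w * phase w ξ +
      amplFun A b (dirDeriv (stdDir d i) g) x ξ w * phase w ξ) (fun w => ?_)
    (fun i x w => dirDeriv_amplFun_mul_phase A hb.contDiff hg.contDiff i x ξ w)
    (fun x => Integrable.mul_phase (integrable_amplFun A hs hσ hb hg x ξ) ξ) (fun i x =>
      ((Integrable.mul_phase (integrable_amplFun A hs hσ (hbi i) hg x ξ) ξ).add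
      (Integrable.mul_phase (integrable_amplFun A hs hσ hb (hgi i) x ξ) ξ)).aestronglyMeasurable)
    (fun R => ?_)
  · refine ⟨key.1, fun i x => (key.2 i x).trans ?_⟩
    exact integral_add (Integrable.mul_phase (integrable_amplFun A hs hσ (hbi i) hg x ξ) ξ)
      (Integrable.mul_phase (integrable_amplFun A hs hσ hb (hgi i) x ξ) ξ)
  · refine Differentiable.mul_const ?_ _
    exact ((contDiff_amplFun A hb.contDiff hg.contDiff).comp
      ((contDiff_id.prodMk (contDiff_const (c := ξ))).prodMk
        (contDiff_const (c := w)))).differentiable (by simp)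
  · choose C₁ c₁ h₁ k₁ H₁ using fun i =>
      exists_norm_amplFun_le_of_norm_le A hs hσ (hbi i) hg (max R ‖ξ‖)
    choose C₂ c₂ h₂ k₂ H₂ using fun i =>
      exists_norm_amplFun_le_of_norm_le A hs hσ hb (hgi i) (max R ‖ξ‖)
    -- Summing over the directions gives one majorant valid for all of them.
    refine ⟨fun w => ∑ i, (C₁ i * Real.exp (-c₁ i * ‖w‖ ^ (1 / s)) +
      C₂ i * Real.exp (-c₂ i * ‖w‖ ^ (1 / s))), integrable_finsetSum _ fun i _ =>
      ((integrable_exp_neg_rpow hs (k₁ i)).const_mul _).add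
        ((integrable_exp_neg_rpow hs (k₂ i)).const_mul _), fun i x w hx => ?_⟩
    refine le_trans ?_ (Finset.single_le_sum (f := fun i =>
      C₁ i * Real.exp (-c₁ i * ‖w‖ ^ (1 / s)) + C₂ i * Real.exp (-c₂ i * ‖w‖ ^ (1 / s)))
      (fun i _ => add_nonneg (mul_nonneg (h₁ i) (Real.exp_pos _).le)
        (mul_nonneg (h₂ i) (Real.exp_pos _).le)) (Finset.mem_univ i))
    refine (norm_add_le _ _).trans (add_le_add ?_ ?_)
    · rw [norm_mul, norm_phase, mul_one]
      exact H₁ i x ξ w (hx.trans (le_max_left _ _)) (le_max_right _ _)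
    · rw [norm_mul, norm_phase, mul_one]
      exact H₂ i x ξ w (hx.trans (le_max_left _ _)) (le_max_right _ _)

theorem differentiable_frequency_ampl (hs : 0 < s) (hσ : 0 < σ) (hsσ : 1 ≤ s + σ)
    (hb : IsWordSymbol s σ b) (hg : IsGSDecay s σ g) (x : E d) :
    (Differentiable ℝ (ampl A b g x)) ∧ ∀ i ξ,
      dirDeriv (stdDir d i) (ampl A b g x) ξ =
        ampl A (dirDeriv (dirXi d i) b) g x ξ + Complex.I * (x i : ℂ) * ampl A b g x ξ -
          Complex.I * ampl A b (coordFun i * g) x ξ := by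
  have hbi := fun i => hb.dirDeriv_dirXi hs hσ i
  have hgi := fun i => hg.coordFun_mul hs hσ hsσ i
  have i1 := fun i ξ => Integrable.mul_phase (integrable_amplFun A hs hσ (hbi i) hg x ξ) ξ
  have i2 := fun (i : Fin d) ξ => (Integrable.mul_phase
    (integrable_amplFun A hs hσ hb hg x ξ) ξ).const_mul (Complex.I * (x i : ℂ))
  have i3 := fun i ξ => (Integrable.mul_phase
    (integrable_amplFun A hs hσ hb (hgi i) x ξ) ξ).const_mul Complex.I
  have key := differentiable_integral (d := d) (F := fun ξ w => amplFun A b g x ξ w * phase w ξ)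
    (F' := fun i ξ w => amplFun A (dirDeriv (dirXi d i) b) g x ξ w * phase w ξ +
        Complex.I * (x i : ℂ) * (amplFun A b g x ξ w * phase w ξ) -
        Complex.I * (amplFun A b (coordFun i * g) x ξ w * phase w ξ)) (fun w => ?_)
    (fun i ξ w => dirDeriv_frequency_amplFun_mul_phase A hb.contDiff i x ξ w)
    (fun ξ => Integrable.mul_phase (integrable_amplFun A hs hσ hb hg x ξ) ξ)
    (fun i ξ => (((i1 i ξ).add (i2 i ξ)).sub (i3 i ξ)).aestronglyMeasurable) (fun R => ?_)
  · refine ⟨key.1, fun i ξ => (key.2 i ξ).trans ?_⟩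
    have h1 := integral_sub ((i1 i ξ).add (i2 i ξ)) (i3 i ξ)
    have h2 := integral_add (i1 i ξ) (i2 i ξ)
    rw [integral_const_mul] at h1 h2
    simp only [Pi.add_apply] at h1
    rw [h1, h2]
    rfl
  · refine Differentiable.mul ?_ ?_
    · exact ((contDiff_amplFun A hb.contDiff hg.contDiff).comp
        (((contDiff_const (c := x)).prodMk contDiff_id).prodMk
          (contDiff_const (c := w)))).differentiable (by simp)
    · change Differentiable ℝ (phase w)
      rw [show phase w = fun ξ => phase ξ w from funext (phase_comm w)]
      exact (contDiff_phase w).differentiable (by simp)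
  · choose C₁ c₁ h₁ k₁ H₁ using fun i =>
      exists_norm_amplFun_le_of_norm_le A hs hσ (hbi i) hg (max R ‖x‖)
    obtain ⟨C₂, c₂, h₂, k₂, H₂⟩ := exists_norm_amplFun_le_of_norm_le A hs hσ hb hg (max R ‖x‖)
    choose C₃ c₃ h₃ k₃ H₃ using fun i =>
      exists_norm_amplFun_le_of_norm_le A hs hσ hb (hgi i) (max R ‖x‖)
    refine ⟨fun w => ∑ i, (C₁ i * Real.exp (-c₁ i * ‖w‖ ^ (1 / s)) +
      |x i| * (C₂ * Real.exp (-c₂ * ‖w‖ ^ (1 / s))) + C₃ i * Real.exp (-c₃ i * ‖w‖ ^ (1 / s))),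
      integrable_finsetSum _ fun i _ =>
      (((integrable_exp_neg_rpow hs (k₁ i)).const_mul _).add
        (((integrable_exp_neg_rpow hs k₂).const_mul _).const_mul _)).add
        ((integrable_exp_neg_rpow hs (k₃ i)).const_mul _), fun i ξ w hξ => ?_⟩
    refine le_trans ?_ (Finset.single_le_sum (f := fun i =>
      C₁ i * Real.exp (-c₁ i * ‖w‖ ^ (1 / s)) + |x i| * (C₂ * Real.exp (-c₂ * ‖w‖ ^ (1 / s))) +
      C₃ i * Real.exp (-c₃ i * ‖w‖ ^ (1 / s)))
      (fun i _ => add_nonneg (add_nonneg (mul_nonneg (h₁ i) (Real.exp_pos _).le)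
        (mul_nonneg (abs_nonneg _) (mul_nonneg h₂ (Real.exp_pos _).le)))
        (mul_nonneg (h₃ i) (Real.exp_pos _).le)) (Finset.mem_univ i))
    refine (norm_sub_le _ _).trans (add_le_add ((norm_add_le _ _).trans (add_le_add ?_ ?_)) ?_)
    · rw [norm_mul, norm_phase, mul_one]
      exact H₁ i x ξ w (le_max_right _ _) (hξ.trans (le_max_left _ _))
    · simp only [norm_mul, norm_phase, mul_one, Complex.norm_I, one_mul, Complex.norm_real,
        Real.norm_eq_abs]
      gcongr
      exact H₂ x ξ w (le_max_right _ _) (hξ.trans (le_max_left _ _))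
    · simp only [norm_mul, norm_phase, mul_one, Complex.norm_I, one_mul]
      exact H₃ i x ξ w (le_max_right _ _) (hξ.trans (le_max_left _ _))

/-- The factor `(2π)^{-d/2}`. -/
noncomputable def fourierConst (d : ℕ) : ℂ := (((2 * Real.pi) ^ (-(d : ℝ) / 2) : ℝ) : ℂ)

/-- The function `Op_A(b) g`. -/
noncomputable def opFun (b : E d × E d → ℂ) (g : E d → ℂ) (x : E d) : ℂ :=
  fourierConst d * (fourierConst d * ∫ ξ, ampl A b g x ξ)

theorem differentiable_opFun (hs : 0 < s) (hσ : 0 < σ) (hb : IsWordSymbol s σ b)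
    (hg : IsGSDecay s σ g) :
    Differentiable ℝ (opFun A b g) ∧ ∀ i, dirDeriv (stdDir d i) (opFun A b g) =
      opFun A (dirDeriv (dirX d i) b) g + opFun A b (dirDeriv (stdDir d i) g) := by
  have hbi := fun i => hb.dirDeriv_dirX hs hσ i
  have hgi := fun i => hg.deriv hσ i
  have key := differentiable_integral (d := d) (F := fun x ξ => ampl A b g x ξ)
    (F' := fun i x ξ => ampl A (dirDeriv (dirX d i) b) g x ξ +
      ampl A b (dirDeriv (stdDir d i) g) x ξ)
    (fun ξ => (differentiable_ampl A hs hσ hb hg ξ).1)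
    (fun i x ξ => (differentiable_ampl A hs hσ hb hg ξ).2 i x)
    (fun x => integrable_ampl A hs hσ hb hg x) (fun i x =>
      ((integrable_ampl A hs hσ (hbi i) hg x).add
        (integrable_ampl A hs hσ hb (hgi i) x)).aestronglyMeasurable)
    (fun R => ?_)
  · refine ⟨(key.1.const_mul _).const_mul _, fun i => ?_⟩
    funext x
    have h1 := key.2 i x
    rw [integral_add (integrable_ampl A hs hσ (hbi i) hg x)
      (integrable_ampl A hs hσ hb (hgi i) x)] at h1
    simp only [dirDeriv] at h1
    unfold opFun
    simp only [dirDeriv, Pi.add_apply]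
    rw [fderiv_const_mul ((key.1 x).const_mul _), fderiv_const_mul (key.1 x)]
    simp only [smul_apply, smul_eq_mul, h1]
    ring
  · choose c₁ k₁ H₁ using fun i => exists_norm_ampl_le A hs hσ (hbi i) hg
    choose c₂ k₂ H₂ using fun i => exists_norm_ampl_le A hs hσ hb (hgi i)
    choose C₁ h₁ H₁ using fun i => H₁ i 1 one_pos
    choose C₂ h₂ H₂ using fun i => H₂ i 1 one_pos
    refine ⟨fun ξ => ∑ i, (C₁ i * Real.exp (1 * R ^ (1 / s)) * Real.exp (-c₁ i * ‖ξ‖ ^ (1 / σ)) +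
      C₂ i * Real.exp (1 * R ^ (1 / s)) * Real.exp (-c₂ i * ‖ξ‖ ^ (1 / σ))),
      integrable_finsetSum _ fun i _ => ((integrable_exp_neg_rpow hσ (k₁ i)).const_mul _).add
        ((integrable_exp_neg_rpow hσ (k₂ i)).const_mul _), fun i x ξ hx => ?_⟩
    refine le_trans ?_ (Finset.single_le_sum (f := fun i =>
      C₁ i * Real.exp (1 * R ^ (1 / s)) * Real.exp (-c₁ i * ‖ξ‖ ^ (1 / σ)) +
      C₂ i * Real.exp (1 * R ^ (1 / s)) * Real.exp (-c₂ i * ‖ξ‖ ^ (1 / σ)))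
      (fun i _ => add_nonneg
        (mul_nonneg (mul_nonneg (h₁ i) (Real.exp_pos _).le) (Real.exp_pos _).le)
        (mul_nonneg (mul_nonneg (h₂ i) (Real.exp_pos _).le) (Real.exp_pos _).le))
      (Finset.mem_univ i))
    have hx1 : ‖x‖ ^ (1 / s) ≤ R ^ (1 / s) :=
      Real.rpow_le_rpow (norm_nonneg _) hx (by positivity)
    have := h₁ i
    have := h₂ i
    refine (norm_add_le _ _).trans (add_le_add ((H₁ i x ξ).trans ?_) ((H₂ i x ξ).trans ?_))
    · gcongr
    · gcongr

/-- Each first derivative is a sum of two functions of the same form, so the induction has to run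
over all symbols and all functions simultaneously. -/
theorem contDiff_opFun (hs : 0 < s) (hσ : 0 < σ) (hb : IsWordSymbol s σ b)
    (hg : IsGSDecay s σ g) : ContDiff ℝ ∞ (opFun A b g) := by
  rw [contDiff_infty]
  intro n
  induction n generalizing b g with
  | zero =>
    rw [Nat.cast_zero, contDiff_zero]
    exact (differentiable_opFun A hs hσ hb hg).1.continuous
  | succ n ih =>
    refine contDiff_succ_of_dirDeriv (differentiable_opFun A hs hσ hb hg).1 fun i => ?_
    rw [(differentiable_opFun A hs hσ hb hg).2 i]
    exact (ih (hb.dirDeriv_dirX hs hσ i) hg).add (ih hb (hg.deriv hσ i))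

/-- The ξ_i-derivative of the amplitude integrates to zero over ξ. Solving the resulting identity
for the term with x_i gives the rule. -/
theorem coord_mul_opFun (hs : 0 < s) (hσ : 0 < σ) (hsσ : 1 ≤ s + σ) (hb : IsWordSymbol s σ b)
    (hg : IsGSDecay s σ g) (i : Fin d) (x : E d) :
    (x i : ℂ) * opFun A b g x =
      Complex.I * opFun A (dirDeriv (dirXi d i) b) g x + opFun A b (coordFun i * g) x := by
  obtain ⟨hd, hd'⟩ := differentiable_frequency_ampl A hs hσ hsσ hb hg x
  have i0 := integrable_ampl A hs hσ hb hg x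
  have i1 := integrable_ampl A hs hσ (hb.dirDeriv_dirXi hs hσ i) hg x
  have i2 := i0.const_mul (Complex.I * (x i : ℂ))
  have i3 := (integrable_ampl A hs hσ hb (hg.coordFun_mul hs hσ hsσ i) x).const_mul Complex.I
  have h0 := integral_dirDeriv_eq_zero (stdDir d i) hd i0 (((i1.add i2).sub i3).congr
    (Filter.Eventually.of_forall fun ξ => (hd' i ξ).symm))
  have h1 := integral_sub (i1.add i2) i3
  have h2 := integral_add i1 i2
  rw [integral_const_mul] at h1 h2
  simp only [Pi.add_apply] at h1
  rw [integral_congr_ae (Filter.Eventually.of_forall (hd' i)), h1, h2] at h0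
  unfold opFun
  have hI := Complex.I_mul_I
  linear_combination (-Complex.I * fourierConst d * fourierConst d) * h0 +
    fourierConst d * fourierConst d * ((x i : ℂ) * (∫ ξ, ampl A b g x ξ) -
      ∫ ξ, ampl A b (coordFun i * g) x ξ) * hI

end Operator

/-! ### Continuity on the Gelfand–Shilov space -/

section Continuity

variable {d : ℕ} {s σ : ℝ} (A : E d →L[ℝ] E d)

theorem GSBound.mono_rate {X H c c' : ℝ} {g : E d → ℂ} (hg : GSBound s σ X H c g) (hH : 0 < H)
    (hcc : c' ≤ c) : GSBound s σ X H c' g := by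
  refine ⟨hg.1, fun L y => (hg.2 L y).trans ?_⟩
  have := hg.const_nonneg
  have := facPow_pos σ L.length
  have : -c ≤ -c' := neg_le_neg hcc
  gcongr

/-- Iterated Leibniz rule with 2^{|L|} terms. The weight t is there to carry a power of a coordinate
of x. -/
theorem norm_wordDeriv_opFun_le (hs : 0 < s) (hσ : 0 < σ) {b : E d × E d → ℂ} {g : E d → ℂ}
    (hb : IsWordSymbol s σ b) (hg : IsGSDecay s σ g) (L : List (Fin d)) (x : E d) {t Y : ℝ}
    (ht : 0 ≤ t) (h : ∀ M N : List (Fin d), M.length + N.length = L.length →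
      t * ‖opFun A (wordDeriv (dirX d) M b) (wordDeriv (stdDir d) N g) x‖ ≤ Y) :
    t * ‖wordDeriv (stdDir d) L (opFun A b g) x‖ ≤ 2 ^ L.length * Y := by
  induction L generalizing b g with
  | nil => simpa using h [] [] rfl
  | cons i L ih =>
    have hb' := hb.dirDeriv_dirX hs hσ i
    have hg' := hg.deriv hσ i
    rw [wordDeriv_cons, (differentiable_opFun A hs hσ hb hg).2 i, wordDeriv_add _ _
      (contDiff_opFun A hs hσ hb' hg) (contDiff_opFun A hs hσ hb hg'), List.length_cons]
    have h1 := ih hb' hg fun M N hMN => h (i :: M) N (by simp only [List.length_cons]; omega)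
    have h2 := ih hb hg' fun M N hMN => h M (i :: N) (by simp only [List.length_cons]; omega)
    calc _ ≤ t * (‖wordDeriv (stdDir d) L (opFun A (dirDeriv (dirX d i) b) g) x‖ +
          ‖wordDeriv (stdDir d) L (opFun A b (dirDeriv (stdDir d i) g)) x‖) :=
          mul_le_mul_of_nonneg_left (norm_add_le _ _) ht
      _ ≤ 2 ^ L.length * Y + 2 ^ L.length * Y := by rw [mul_add]; exact add_le_add h1 h2
      _ = _ := by ring

/-- Iteration of `coord_mul_opFun`: every factor x_j becomes either a ξ_j-derivative of the symbol
or a factor on g, hence 2^k terms. -/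
theorem abs_coord_pow_mul_norm_opFun_le (hs : 0 < s) (hσ : 0 < σ) (hsσ : 1 ≤ s + σ)
    {b : E d × E d → ℂ} {g : E d → ℂ} (hb : IsWordSymbol s σ b) (hg : IsGSDecay s σ g) (j : Fin d)
    (k : ℕ) (x : E d) {Y : ℝ} (h : ∀ m l : ℕ, m + l = k →
      ‖opFun A (wordDeriv (dirXi d) (List.replicate m j) b) (coordFun j ^ l * g) x‖ ≤ Y) :
    |x j| ^ k * ‖opFun A b g x‖ ≤ 2 ^ k * Y := by
  induction k generalizing b g with
  | zero => simpa using h 0 0 rfl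
  | succ k ih =>
    have h1 := ih (hb.dirDeriv_dirXi hs hσ j) hg fun m l hml => h (m + 1) l (by omega)
    have h2 := ih hb (hg.coordFun_mul hs hσ hsσ j) fun m l hml => by
      have := h m (l + 1) (by omega)
      rwa [pow_succ, mul_assoc] at this
    have h3 : |x j| * ‖opFun A b g x‖ ≤ ‖opFun A (dirDeriv (dirXi d j) b) g x‖ +
        ‖opFun A b (coordFun j * g) x‖ := by
      have h4 := congrArg norm (coord_mul_opFun A hs hσ hsσ hb hg j x)
      rw [norm_mul, Complex.norm_real, Real.norm_eq_abs] at h4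
      rw [h4]
      refine (norm_add_le _ _).trans_eq ?_
      rw [norm_mul, Complex.norm_I, one_mul]
    calc |x j| ^ (k + 1) * ‖opFun A b g x‖ = |x j| ^ k * (|x j| * ‖opFun A b g x‖) := by ring
      _ ≤ |x j| ^ k * (‖opFun A (dirDeriv (dirXi d j) b) g x‖ +
          ‖opFun A b (coordFun j * g) x‖) := by gcongr
      _ ≤ 2 ^ k * Y + 2 ^ k * Y := by rw [mul_add]; exact add_le_add h1 h2
      _ = _ := by ring

theorem norm_opFun_le (hs : 0 < s) (hσ : 0 < σ) {P Q H c r : ℝ}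
    (hH : 0 < H) (hc : 0 < c) (hr : 0 ≤ r) (hrc : r * growthConst s A ≤ c / 2)
    (hrσ : r ≤ amplRate σ A H / 2)
    {b : E d × E d → ℂ} {g : E d → ℂ} (hb : SymBound s σ P H r b) (hg : GSBound s σ Q H c g)
    (x : E d) :
    ‖opFun A b g x‖ ≤ ‖fourierConst d‖ ^ 2 * expMass d s (c / 2) * 2 ^ σ *
      expMass d σ (amplRate σ A H / 2) *
        (P * Q * Real.exp (r * growthConst s A * ‖x‖ ^ (1 / s))) := by
  have h1 : ‖∫ ξ, ampl A b g x ξ‖ ≤ P * Q * expMass d s (c / 2) * 2 ^ σ *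
      Real.exp (r * growthConst s A * ‖x‖ ^ (1 / s)) * expMass d σ (amplRate σ A H / 2) := by
    rw [expMass, expMass, ← integral_const_mul]
    exact norm_integral_le_of_norm_le
      ((integrable_exp_neg_rpow hσ (half_pos (amplRate_pos hσ A hH))).const_mul _)
      (Filter.Eventually.of_forall fun ξ => norm_ampl_le hs hσ A hH hc hr hrc hrσ hb hg x ξ)
  unfold opFun
  rw [norm_mul, norm_mul]
  calc _ ≤ ‖fourierConst d‖ * (‖fourierConst d‖ * (P * Q * expMass d s (c / 2) * 2 ^ σ *
      Real.exp (r * growthConst s A * ‖x‖ ^ (1 / s)) * expMass d σ (amplRate σ A H / 2))) := by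
        gcongr
    _ = _ := by ring

/-- `Op_A(a)` maps functions with given regularity and decay into functions of the same type, with
control of the constants. -/
theorem exists_gsBound_opFun (hs : 0 < s) (hσ : 0 < σ) (hsσ : 1 ≤ s + σ) {a : E d × E d → ℂ}
    (ha : IsWordSymbol s σ a) {H c : ℝ} (hH : 0 < H) (hc : 0 < c) :
    ∃ C H' c' : ℝ, 0 < H' ∧ 0 < c' ∧ ∀ (f : E d → ℂ) (Q : ℝ),
      GSBound s σ Q H c f → GSBound s σ (C * Q) H' c' (opFun A a f) := by
  obtain ⟨h, hh, hr⟩ := id ha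
  set h₂ := h * 2 ^ σ * 2 ^ s with hh₂
  set H₁ := H * 2 ^ σ with hH₁
  have H₁pos : 0 < H₁ := by positivity
  have h₂pos : 0 < h₂ := by positivity
  set H₂ := mulConst s H₁ c with hH₂
  have H₂pos : 0 < H₂ := mulConst_pos hs H₁pos hc
  -- A single base dominating all the geometric constants that occur.
  set Z := 1 + h₂ + H₁ + H₂ with hZ
  have hZ1 : 1 ≤ Z := by linarith
  have hZ0 : 0 < Z := by linarith
  have hκ := growthConst_pos s A
  have hρ := amplRate_pos hσ A hZ0
  have hR : 0 < rate s ((d + 1) * (2 * Z)) := rate_pos hs (by positivity)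
  set R := rate s ((d + 1) * (2 * Z)) with hRdef
  -- The rate R does not depend on r, so r can be adapted to it. The first constraint uses half of
  -- the decay c/2 left after multiplication by coordinate powers, the second keeps the growth in x
  -- below R/2, and the third serves the decay in ξ.
  set r := min (c / 2 / 2 / growthConst s A) (min (R / 2 / growthConst s A) (amplRate σ A Z / 2))
  have hr0 : 0 < r := by positivity
  have hr1 : r * growthConst s A ≤ c / 2 / 2 := (le_div_iff₀ hκ).1 (min_le_left _ _)
  have hr2 : r * growthConst s A ≤ R / 2 :=
    (le_div_iff₀ hκ).1 ((min_le_right _ _).trans (min_le_left _ _))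
  have hr3 : r ≤ amplRate σ A Z / 2 := (min_le_right _ _).trans (min_le_right _ _)
  obtain ⟨P, hP⟩ := hr r hr0
  have hP0 := hP.const_nonneg
  set K := ‖fourierConst d‖ ^ 2 * expMass d s (c / 2 / 2) * 2 ^ σ *
    expMass d σ (amplRate σ A Z / 2) with hK
  have hK0 : 0 ≤ K := by
    have := expMass_nonneg d s (c / 2 / 2)
    have := expMass_nonneg d σ (amplRate σ A Z / 2)
    positivity
  -- The 2 in 2Z comes from the number 2^{k+|L|} of terms, the 2^s from `le_exp_of_coord_moments`,
  -- and R/2 is the decay left after paying for the growth in x.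
  refine ⟨K * P * 2 ^ s, 2 * Z, R / 2, by positivity, half_pos hR, fun f Q hf => ?_⟩
  have hQ0 := hf.const_nonneg
  have hfd : IsGSDecay s σ f := ⟨Q, H, c, hH, hc, hf⟩
  refine ⟨contDiff_opFun A hs hσ ha hfd, fun L x => ?_⟩
  set ε := Real.exp (r * growthConst s A * ‖x‖ ^ (1 / s)) with hε
  have hε0 : 0 < ε := Real.exp_pos _
  have hfL := facPow_pos σ L.length
  -- A typical term: the symbol carries M derivatives in x and m in ξ, and φ stands for x_j^l ∂^N f.
  have term : ∀ (M N : List (Fin d)) (m : ℕ) (M' : List (Fin d)) (l k : ℕ) (Q' : ℝ) (φ : E d → ℂ),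
      M.length + N.length = L.length → M'.length = m → m + l = k →
      GSBound s σ (Q' * (H₂ ^ l * facPow s l)) H₂ (c / 2) φ →
      Q' = Q * (H₁ ^ N.length * facPow σ N.length) →
      ‖opFun A (wordDeriv (dirXi d) M' (wordDeriv (dirX d) M a)) φ x‖ ≤
        K * P * Q * ε * (Z ^ k * facPow s k) * (Z ^ L.length * facPow σ L.length) := by
    intro M N m M' l k Q' φ hMN hm hml hφ hQ'
    have hsym := hP.deriv_word hs hσ hh M M'
    rw [wordDeriv_comm _ _ _ _ hP.1, ← hh₂] at hsym
    have key := norm_opFun_le A hs hσ hZ0 (half_pos hc) hr0.le hr1 hr3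
      (hsym.mono h₂pos le_rfl (by linarith)) (hφ.mono H₂pos le_rfl (by linarith)) x
    refine key.trans ?_
    rw [← hK, ← hε, hm, hQ']
    have p1 := facPow_pos σ M.length
    have p2 := facPow_pos σ N.length
    have p3 := facPow_pos s m
    have p4 := facPow_pos s l
    have p5 := facPow_pos s k
    have q1 := facPow_mul_le hσ M.length N.length
    have q2 := facPow_mul_le hs m l
    rw [hMN] at q1
    rw [hml] at q2
    have z1 : h₂ ≤ Z := by linarith
    have z2 : H₁ ≤ Z := by linarith
    have z3 : H₂ ≤ Z := by linarith
    calc _ ≤ K * (P * (Z ^ (M.length + m) * facPow σ M.length * facPow s m) *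
          (Q * (Z ^ N.length * facPow σ N.length) * (Z ^ l * facPow s l)) * ε) := by gcongr
      _ = K * P * Q * ε * (Z ^ (m + l) * (facPow s m * facPow s l)) *
          (Z ^ (M.length + N.length) * (facPow σ M.length * facPow σ N.length)) := by
          rw [pow_add, pow_add, pow_add]; ring
      _ ≤ _ := by rw [hMN, hml]; gcongr
  have hword : ∀ N, GSBound s σ (Q * (H₁ ^ N.length * facPow σ N.length)) H₁ c
      (wordDeriv (stdDir d) N f) := fun N => hf.deriv_word hσ hH N
  have hsymb : ∀ M, IsWordSymbol s σ (wordDeriv (dirX d) M a) := fun M =>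
    ha.deriv_word hs hσ M []
  have hH12 : H₁ ≤ H₂ := by
    rw [hH₂, mulConst]
    have h1 : 0 ≤ (s / (c / 2)) ^ s := by positivity
    nlinarith [mul_nonneg h1 H₁pos.le]
  have hmom : ∀ (j : Fin d) (k : ℕ), |x j| ^ k * ‖wordDeriv (stdDir d) L (opFun A a f) x‖ ≤
      K * P * Q * ε * ((2 * Z) ^ L.length * facPow σ L.length) *
        ((2 * Z) ^ k * facPow s k) := by
    intro j k
    have h1 := norm_wordDeriv_opFun_le A hs hσ ha hfd L x (t := |x j| ^ k)
      (Y := 2 ^ k * (K * P * Q * ε * (Z ^ k * facPow s k) * (Z ^ L.length * facPow σ L.length)))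
      (by positivity) fun M N hMN =>
        abs_coord_pow_mul_norm_opFun_le A hs hσ hsσ (hsymb M) ⟨_, _, _, H₁pos, hc, hword N⟩ j k x
          fun m l hml => term M N m (List.replicate m j) l k _ _ hMN (by simp) hml
            ((hword N).coordFun_pow_mul hs hσ hsσ H₁pos hc j l) rfl
    refine h1.trans_eq ?_
    rw [mul_pow, mul_pow]
    ring
  -- Proved apart from `hmom`, which says nothing for d = 0. The bound for ∂^N f is weakened to the
  -- constants that `term` expects.
  have hzero : ‖wordDeriv (stdDir d) L (opFun A a f) x‖ ≤
      K * P * Q * ε * ((2 * Z) ^ L.length * facPow σ L.length) := by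
    have h1 := norm_wordDeriv_opFun_le A hs hσ ha hfd L x (t := 1)
      (Y := K * P * Q * ε * (Z ^ 0 * facPow s 0) * (Z ^ L.length * facPow σ L.length))
      zero_le_one fun M N hMN => by
        rw [one_mul]
        refine term M N 0 [] 0 0 _ _ hMN rfl rfl ?_ rfl
        have h2 := (hword N).mono_rate H₁pos (half_le_self hc.le)
        exact h2.mono H₁pos (by simp) hH12
    rw [one_mul] at h1
    refine h1.trans_eq ?_
    rw [mul_pow, facPow_zero, pow_zero]
    ring
  refine (le_exp_of_coord_moments hs (by positivity : 0 < 2 * Z) x (norm_nonneg _) hzero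
    hmom).trans ?_
  rw [← hRdef]
  have hfin : ε * Real.exp (-R * ‖x‖ ^ (1 / s)) ≤ Real.exp (-(R / 2) * ‖x‖ ^ (1 / s)) := by
    rw [hε, ← Real.exp_add]
    refine Real.exp_le_exp.2 ?_
    have := mul_le_mul_of_nonneg_right hr2 (Real.rpow_nonneg (norm_nonneg x) (1 / s))
    nlinarith
  calc _ = K * P * 2 ^ s * Q * ((2 * Z) ^ L.length * facPow σ L.length *
        (ε * Real.exp (-R * ‖x‖ ^ (1 / s)))) := by ring
    _ ≤ _ := by gcongr

/-! ### The operator on the Gelfand–Shilov space -/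

theorem opFun_add (hs : 0 < s) (hσ : 0 < σ) {a : E d × E d → ℂ} (ha : IsWordSymbol s σ a)
    {f g : E d → ℂ} (hf : IsGSDecay s σ f) (hg : IsGSDecay s σ g) :
    opFun A a (f + g) = opFun A a f + opFun A a g := by
  funext x
  have h1 : ∀ ξ, ampl A a (f + g) x ξ = ampl A a f x ξ + ampl A a g x ξ := by
    intro ξ
    unfold ampl
    rw [← integral_add (Integrable.mul_phase (integrable_amplFun A hs hσ ha hf x ξ) ξ)
      (Integrable.mul_phase (integrable_amplFun A hs hσ ha hg x ξ) ξ)]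
    refine integral_congr_ae (Filter.Eventually.of_forall fun w => ?_)
    simp only [amplFun, Pi.add_apply]
    ring
  simp only [opFun, Pi.add_apply, h1]
  rw [integral_add (integrable_ampl A hs hσ ha hf x) (integrable_ampl A hs hσ ha hg x)]
  ring

theorem opFun_smul (a : E d × E d → ℂ) (c : ℂ) (f : E d → ℂ) :
    opFun A a (c • f) = c • opFun A a f := by
  funext x
  have h1 : ∀ ξ, ampl A a (c • f) x ξ = c * ampl A a f x ξ := by
    intro ξ
    unfold ampl
    rw [← integral_const_mul]
    refine integral_congr_ae (Filter.Eventually.of_forall fun w => ?_)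
    simp only [amplFun, Pi.smul_apply, smul_eq_mul]
    ring
  simp only [opFun, Pi.smul_apply, smul_eq_mul, h1]
  rw [integral_const_mul]
  ring

theorem GSBound.isGS (hs : 0 < s) (hσ : 0 < σ) {X H c : ℝ} (hH : 0 < H) (hc : 0 < c)
    {f : E d → ℂ} (hf : GSBound s σ X H c f) : IsGS s σ (stepIndex d s σ H c) f := by
  refine ⟨hf.1, X, ?_⟩
  rintro _ ⟨p, rfl⟩
  exact hf.gsQuot_le hs hσ hH hc p

/-- `Op_A(a)` as a linear map on the Gelfand–Shilov space. -/
noncomputable def opLinear (hs : 0 < s) (hσ : 0 < σ) (hsσ : 1 ≤ s + σ) {a : E d × E d → ℂ}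
    (ha : IsWordSymbol s σ a) : Space d s σ →ₗ[ℂ] Space d s σ where
  toFun f := ⟨opFun A a f, by
    obtain ⟨Q, H, c, hH, hc, hf⟩ := f.isGSDecay hs hσ
    obtain ⟨C, H', c', hH', hc', h⟩ := exists_gsBound_opFun A hs hσ hsσ ha hH hc
    exact ⟨_, stepIndex_pos hs hH' hc', (h _ _ hf).isGS hs hσ hH' hc'⟩⟩
  map_add' f g := Subtype.ext (opFun_add A hs hσ ha (f.isGSDecay hs hσ) (g.isGSDecay hs hσ))
  map_smul' c f := Subtype.ext (opFun_smul A a c f)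

/-- `Op_A(a)` between step spaces. -/
noncomputable def opStep (hs : 0 < s) (hσ : 0 < σ) {a : E d × E d → ℂ} (ha : IsWordSymbol s σ a)
    {h h' : Set.Ioi (0 : ℝ)} (hmap : ∀ f : Step d s σ h, IsGS s σ h' (opFun A a f)) :
    Step d s σ h →ₗ[ℂ] Step d s σ h' where
  toFun f := ⟨opFun A a f, hmap f⟩
  map_add' f g := Subtype.ext (opFun_add A hs hσ ha
    (Space.isGSDecay hs hσ (incl d s σ h f)) (Space.isGSDecay hs hσ (incl d s σ h g)))
  map_smul' c f := Subtype.ext (opFun_smul A a c f)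

/-- By the universal property of the inductive limit it suffices to treat one step space. There
`exists_gsBound_opFun` yields a common target index with a bound linear in the norm, so the
restriction factors through a bounded map of step spaces. -/
theorem continuous_opLinear (hs : 0 < s) (hσ : 0 < σ) (hsσ : 1 ≤ s + σ) {a : E d × E d → ℂ}
    (ha : IsWordSymbol s σ a) : Continuous (opLinear A hs hσ hsσ ha) := by
  refine continuous_of_comp_incl _ fun h => ?_
  have hh : 0 < (h : ℝ) := h.2
  obtain ⟨C, H', c', hH', hc', hC⟩ := exists_gsBound_opFun A hs hσ hsσ ha hh
    (rate_pos hs (by positivity : 0 < (d + 1) * (h : ℝ)))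
  have hb : ∀ f : Step d s σ h, GSBound s σ (C * (‖f‖ * 2 ^ s)) H' c' (opFun A a f) := fun f =>
    hC _ _ (f.gsBound hs hσ)
  obtain ⟨h', hh'⟩ : ∃ h' : Set.Ioi (0 : ℝ), (h' : ℝ) = stepIndex d s σ H' c' :=
    ⟨⟨_, stepIndex_pos hs hH' hc'⟩, rfl⟩
  have hmap : ∀ f : Step d s σ h, IsGS s σ h' (opFun A a f) := fun f =>
    hh' ▸ (hb f).isGS hs hσ hH' hc'
  have hS : Continuous (opStep A hs hσ ha hmap) := by
    refine AddMonoidHomClass.continuous_of_bound _ (C * 2 ^ s) fun f => ?_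
    rw [Step.norm_def]
    refine ciSup_le fun p => ?_
    rw [hh']
    refine ((hb f).gsQuot_le hs hσ hH' hc' p).trans_eq ?_
    ring
  have e : ⇑(opLinear A hs hσ hsσ ha ∘ₗ incl d s σ h) =
      ⇑(incl d s σ h') ∘ ⇑(opStep A hs hσ ha hmap) := funext fun f => Subtype.ext rfl
  rw [e]
  exact (continuous_incl h').comp hS

/-- `Op_A(a)` as a continuous linear map on the Gelfand–Shilov space. -/
noncomputable def opCLM (hs : 0 < s) (hσ : 0 < σ) (hsσ : 1 ≤ s + σ) {a : E d × E d → ℂ}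
    (ha : IsWordSymbol s σ a) : Space d s σ →L[ℂ] Space d s σ :=
  ⟨opLinear A hs hσ hsσ ha, continuous_opLinear A hs hσ hsσ ha⟩

end Continuity

/-! ### Duality -/

section Duality

variable {d : ℕ} {s σ : ℝ} (A : E d →L[ℝ] E d)

/-- `∫ g(z + Aw) f(z + Aw - w) e^{i⟨w,ξ⟩} dw`. -/
noncomputable def wigner (f g : E d → ℂ) (p : E d × E d) : ℂ :=
  ∫ w, (g (p.1 + A w) * f (p.1 + A w - w)) * phase w p.2

/-- The bilinear action of `Op_A(a)` on pairs of functions. -/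
noncomputable def opPair (a : E d × E d → ℂ) (f g : E d → ℂ) : ℂ :=
  fourierConst d * ∫ p : E d × E d, a p * (fourierConst d * wigner A f g p)

/-- Each of u and v is dominated by κ(a + b), so half of the exponent can be spent on either. -/
theorem exp_mul_exp_le {κ m a b u v : ℝ} (hκ : 0 < κ) (hm : 0 ≤ m) (hu : u ≤ κ * (a + b))
    (hv : v ≤ κ * (a + b)) :
    Real.exp (-m * a) * Real.exp (-m * b) ≤
      Real.exp (-(m / (2 * κ)) * u) * Real.exp (-(m / (2 * κ)) * v) := by
  rw [← Real.exp_add, ← Real.exp_add]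
  refine Real.exp_le_exp.2 ?_
  have h1 : m / (2 * κ) * (u + v) ≤ m * (a + b) := by
    rw [div_mul_eq_mul_div, div_le_iff₀ (by positivity)]
    nlinarith
  linarith

theorem IsGSDecay.exists_common {f g : E d → ℂ} (hf : IsGSDecay s σ f) (hg : IsGSDecay s σ g) :
    ∃ X Y H c : ℝ, 0 < H ∧ 0 < c ∧ GSBound s σ X H c f ∧ GSBound s σ Y H c g := by
  obtain ⟨X, H, c, hH, hc, hf⟩ := hf
  obtain ⟨Y, K, e, hK, he, hg⟩ := hg
  have hmax : 0 < max H K := lt_max_of_lt_left hH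
  exact ⟨X, Y, max H K, min c e, hmax, lt_min hc he,
    (hf.mono hH le_rfl (le_max_left _ _)).mono_rate hmax (min_le_left _ _),
    (hg.mono hK le_rfl (le_max_right _ _)).mono_rate hmax (min_le_right _ _)⟩

theorem contDiff_wignerFun {f g : E d → ℂ} (hf : ContDiff ℝ ∞ f) (hg : ContDiff ℝ ∞ g) :
    ContDiff ℝ ∞ fun q : E d × E d => g (q.1 + A q.2) * f (q.1 + A q.2 - q.2) := by
  have h1 : ContDiff ℝ ∞ fun q : E d × E d => q.1 + A q.2 :=
    contDiff_fst.add (A.contDiff.comp contDiff_snd)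
  exact (hg.comp h1).mul (hf.comp (h1.sub contDiff_snd))

/-- The points z + Aw and z + Aw - w together determine z and w linearly. Joint decay in the former
pair is therefore joint decay in the latter. -/
theorem exists_norm_wordDeriv_wignerFun_le (hs : 0 < s) (hσ : 0 < σ) {f g : E d → ℂ}
    (hf : IsGSDecay s σ f) (hg : IsGSDecay s σ g) :
    ∃ C H c : ℝ, 0 ≤ C ∧ 0 < H ∧ 0 < c ∧ ∀ (L : List (Fin d)) (z w : E d),
      ‖wordDeriv (stdDir d) L (fun w => g (z + A w) * f (z + A w - w)) w‖ ≤
        C * Real.exp (-c * ‖z‖ ^ (1 / s)) * (H ^ L.length * facPow σ L.length) *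
          Real.exp (-c * ‖w‖ ^ (1 / s)) := by
  obtain ⟨X, Y, H, c, hH, hc, hf, hg⟩ := hf.exists_common hg
  have hX := hf.const_nonneg
  have hY := hg.const_nonneg
  have hκ := growthConst_pos s A
  set B := A - ContinuousLinearMap.id ℝ (E d) with hB
  set K := max (coeffConst A) (coeffConst B) with hK
  have hK1 : 1 ≤ K := (one_le_coeffConst A).trans (le_max_left _ _)
  have hA0 := zero_le_one.trans (one_le_coeffConst A)
  have hB0 := zero_le_one.trans (one_le_coeffConst B)
  have hKA : coeffConst A ≤ K := le_max_left _ _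
  have hKB : coeffConst B ≤ K := le_max_right _ _
  refine ⟨Y * X, 2 * (K * H), c / (2 * growthConst s A), by positivity, by positivity,
    by positivity, fun L z w => ?_⟩
  have hBw : ∀ w, z + B w = z + A w - w := by intro w; simp [hB]; abel
  have c1 : ContDiff ℝ ∞ fun w => g (z + A w) := contDiff_comp_affine A z hg.1
  have c2 : ContDiff ℝ ∞ fun w => f (z + B w) := contDiff_comp_affine B z hf.1
  have e1 : (fun w => g (z + A w) * f (z + A w - w)) =
      (fun w => g (z + A w)) * fun w => f (z + B w) := by
    funext w
    simp [hBw]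
  have hfL := facPow_pos σ L.length
  set u := z + A w with hu
  have hexp : Real.exp (-c * ‖u‖ ^ (1 / s)) * Real.exp (-c * ‖u - w‖ ^ (1 / s)) ≤
      Real.exp (-(c / (2 * growthConst s A)) * ‖z‖ ^ (1 / s)) *
        Real.exp (-(c / (2 * growthConst s A)) * ‖w‖ ^ (1 / s)) := by
    refine exp_mul_exp_le hκ hc.le (norm_rpow_le_growthConst hs A ?_)
      (norm_rpow_le_growthConst hs A (norm_le_add_sub A u w))
    have := norm_sub_apply_le A u w
    rwa [hu, add_sub_cancel_right] at this
  rw [e1]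
  refine (norm_wordDeriv_mul_le (stdDir d) L c1 c2 w (Y * X * ((K * H) ^ L.length *
    facPow σ L.length) * (Real.exp (-c * ‖u‖ ^ (1 / s)) * Real.exp (-c * ‖u - w‖ ^ (1 / s))))
    fun M N hMN => ?_).trans ?_
  · have pM := facPow_pos σ M.length
    have pN := facPow_pos σ N.length
    have h1 := norm_wordDeriv_comp_le A z M hg.1 w
      (Y := Y * (H ^ M.length * facPow σ M.length * Real.exp (-c * ‖u‖ ^ (1 / s))))
      (by positivity) fun M' hM' => hM' ▸ hg.2 M' u
    have h2 := norm_wordDeriv_comp_le B z N hf.1 w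
      (Y := X * (H ^ N.length * facPow σ N.length * Real.exp (-c * ‖u - w‖ ^ (1 / s))))
      (by positivity) fun N' hN' => by
        rw [hBw]
        exact hN' ▸ hf.2 N' (u - w)
    have h3 := facPow_mul_le hσ M.length N.length
    rw [hMN] at h3
    calc _ ≤ (K ^ M.length * (Y * (H ^ M.length * facPow σ M.length *
          Real.exp (-c * ‖u‖ ^ (1 / s))))) * (K ^ N.length * (X * (H ^ N.length *
          facPow σ N.length * Real.exp (-c * ‖u - w‖ ^ (1 / s))))) := by
          refine mul_le_mul (h1.trans ?_) (h2.trans ?_) (norm_nonneg _) (by positivity)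
          · gcongr
          · gcongr
      _ = Y * X * ((K * H) ^ (M.length + N.length) * (facPow σ M.length * facPow σ N.length)) *
          (Real.exp (-c * ‖u‖ ^ (1 / s)) * Real.exp (-c * ‖u - w‖ ^ (1 / s))) := by
          rw [pow_add, mul_pow, mul_pow]; ring
      _ ≤ _ := by rw [hMN]; gcongr
  · calc _ = Y * X * ((2 * (K * H)) ^ L.length * facPow σ L.length) *
          (Real.exp (-c * ‖u‖ ^ (1 / s)) * Real.exp (-c * ‖u - w‖ ^ (1 / s))) := by
          rw [mul_pow 2]; ring
      _ ≤ Y * X * ((2 * (K * H)) ^ L.length * facPow σ L.length) *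
          (Real.exp (-(c / (2 * growthConst s A)) * ‖z‖ ^ (1 / s)) *
          Real.exp (-(c / (2 * growthConst s A)) * ‖w‖ ^ (1 / s))) := by gcongr
      _ = _ := by ring

theorem exists_norm_wigner_le (hs : 0 < s) (hσ : 0 < σ) {f g : E d → ℂ}
    (hf : IsGSDecay s σ f) (hg : IsGSDecay s σ g) :
    ∃ C c : ℝ, 0 ≤ C ∧ 0 < c ∧ ∀ p, ‖wigner A f g p‖ ≤
      C * (Real.exp (-c * ‖p.1‖ ^ (1 / s)) * Real.exp (-c * ‖p.2‖ ^ (1 / σ))) := by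
  obtain ⟨C, H, c, hC, hH, hc, h⟩ := exists_norm_wordDeriv_wignerFun_le A hs hσ hf hg
  have hρ : 0 < rate σ ((d + 1) * H) := rate_pos hσ (by positivity)
  have hm := expMass_nonneg d s c
  refine ⟨C * expMass d s c * 2 ^ σ, min c (rate σ ((d + 1) * H)), by positivity, by positivity,
    fun p => ?_⟩
  have hsm : ContDiff ℝ ∞ fun w => g (p.1 + A w) * f (p.1 + A w - w) :=
    (contDiff_wignerFun A hf.contDiff hg.contDiff).comp
      ((contDiff_const (c := p.1)).prodMk contDiff_id)
  refine (norm_integral_mul_phase_le hσ hH hsm (integrable_exp_neg_rpow hs hc)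
    (fun L w => h L p.1 w) p.2).trans ?_
  have h1 : -c ≤ -min c (rate σ ((d + 1) * H)) := neg_le_neg (min_le_left _ _)
  have h2 : -rate σ ((d + 1) * H) ≤ -min c (rate σ ((d + 1) * H)) := neg_le_neg (min_le_right _ _)
  calc _ = C * expMass d s c * 2 ^ σ * (Real.exp (-c * ‖p.1‖ ^ (1 / s)) *
        Real.exp (-rate σ ((d + 1) * H) * ‖p.2‖ ^ (1 / σ))) := by unfold expMass; ring
    _ ≤ _ := by gcongr

theorem stronglyMeasurable_wigner {f g : E d → ℂ} (hf : ContDiff ℝ ∞ f) (hg : ContDiff ℝ ∞ g) :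
    StronglyMeasurable (wigner A f g) := by
  have hc : Continuous fun q : (E d × E d) × E d =>
      (g (q.1.1 + A q.2) * f (q.1.1 + A q.2 - q.2)) * phase q.2 q.1.2 :=
    ((contDiff_wignerFun A hf hg).continuous.comp
      ((continuous_fst.comp continuous_fst).prodMk continuous_snd)).mul
      (continuous_phase.comp (continuous_snd.prodMk (continuous_snd.comp continuous_fst)))
  exact hc.stronglyMeasurable.integral_prod_right'

theorem SymBound.norm_le {X h r : ℝ} {a : E d × E d → ℂ} (ha : SymBound s σ X h r a)
    (p : E d × E d) :
    ‖a p‖ ≤ X * (Real.exp (r * ‖p.1‖ ^ (1 / s)) * Real.exp (r * ‖p.2‖ ^ (1 / σ))) := by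
  have := ha.2 [] [] p.1 p.2
  simpa [mul_add, Real.exp_add] using this

theorem integrable_exp_mul_exp (hs : 0 < s) (hσ : 0 < σ) {c e : ℝ} (hc : 0 < c) (he : 0 < e) :
    Integrable fun p : E d × E d =>
      Real.exp (-c * ‖p.1‖ ^ (1 / s)) * Real.exp (-e * ‖p.2‖ ^ (1 / σ)) :=
  (integrable_exp_neg_rpow hs hc).mul_prod (integrable_exp_neg_rpow hσ he)

theorem exp_mul_exp_half (c t : ℝ) :
    Real.exp (c / 2 * t) * Real.exp (-c * t) = Real.exp (-(c / 2) * t) := by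
  rw [← Real.exp_add]; congr 1; ring

/-- The Wigner-type integral decays exponentially in both variables at some rate c, and the symbol
estimate with r = c/2 leaves half of that decay. -/
theorem integrable_mul_wigner (hs : 0 < s) (hσ : 0 < σ) {a : E d × E d → ℂ}
    (ha : IsWordSymbol s σ a) {f g : E d → ℂ} (hf : IsGSDecay s σ f) (hg : IsGSDecay s σ g) :
    Integrable fun p => a p * wigner A f g p := by
  obtain ⟨C, c, hC, hc, hw⟩ := exists_norm_wigner_le A hs hσ hf hg
  obtain ⟨h, hh, hr⟩ := id ha
  obtain ⟨P, hP⟩ := hr (c / 2) (half_pos hc)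
  have hP0 := hP.const_nonneg
  refine ((integrable_exp_mul_exp hs hσ (half_pos hc) (half_pos hc)).const_mul (P * C)).mono'
    (ha.contDiff.continuous.aestronglyMeasurable.mul
      (stronglyMeasurable_wigner A hf.contDiff hg.contDiff).aestronglyMeasurable)
    (Filter.Eventually.of_forall fun p => ?_)
  rw [norm_mul]
  refine (mul_le_mul (hP.norm_le p) (hw p) (norm_nonneg _) (by positivity)).trans_eq ?_
  rw [← exp_mul_exp_half, ← exp_mul_exp_half]
  ring

/-- Fubini's theorem and a change of variables at fixed frequency. -/
theorem integral_ampl_mul (hs : 0 < s) (hσ : 0 < σ) {a : E d × E d → ℂ} (ha : IsWordSymbol s σ a)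
    {f g : E d → ℂ} (hf : IsGSDecay s σ f) (hg : IsGSDecay s σ g) (ξ : E d) :
    ∫ x, ampl A a f x ξ * g x = ∫ z, a (z, ξ) * wigner A f g (z, ξ) := by
  have hκ := growthConst_pos s A
  have i1 : Integrable (Function.uncurry fun x w => amplFun A a f x ξ w * phase w ξ * g x)
      (volume.prod volume) := by
    obtain ⟨c, hc, h⟩ := exists_norm_amplFun_le A hs hσ ha hf
    obtain ⟨Q, H, e, hH, he, hg⟩ := hg
    -- With this ε the growth in x uses half of the decay of g. The decay left in x and x - w is
    -- then converted into decay in x and w.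
    obtain ⟨C, hC, hC'⟩ := h (e / 2) (half_pos he)
    have hQ := hg.const_nonneg
    set m := min c (e / 2) with hm
    have hm0 : 0 < m := by positivity
    have hcont : Continuous fun p : E d × E d =>
        amplFun A a f p.1 ξ p.2 * phase p.2 ξ * g p.1 :=
      (((contDiff_amplFun A ha.contDiff hf.contDiff).continuous.comp
        ((continuous_fst.prodMk continuous_const).prodMk continuous_snd)).mul
        ((contDiff_phase ξ).continuous.comp continuous_snd)).mul
        (hg.1.continuous.comp continuous_fst)
    refine ((integrable_exp_mul_exp (c := m / (2 * growthConst s A))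
      (e := m / (2 * growthConst s A)) hs hs (by positivity) (by positivity)).const_mul
      (C * Real.exp (e / 2 * ‖ξ‖ ^ (1 / σ)) * Q)).mono' hcont.aestronglyMeasurable
      (Filter.Eventually.of_forall fun p => ?_)
    obtain ⟨x, w⟩ := p
    simp only [Function.uncurry, norm_mul, norm_phase, mul_one]
    have h1 := hC' x ξ w
    have h2 := hg.2 [] x
    simp only [wordDeriv_nil, List.length_nil, pow_zero, facPow_zero, one_mul] at h2
    have h3 := exp_mul_exp_le hκ hm0.le
      (norm_rpow_le_growthConst hs A (u := x) (x := x) (y := x - w) ?_)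
      (norm_rpow_le_growthConst hs A (norm_le_add_sub A x w))
    · have h4 : Real.exp (-(e / 2) * ‖x‖ ^ (1 / s)) ≤ Real.exp (-m * ‖x‖ ^ (1 / s)) := by
        have : -(e / 2) ≤ -m := neg_le_neg (min_le_right _ _)
        gcongr
      have h5 : Real.exp (-c * ‖x - w‖ ^ (1 / s)) ≤ Real.exp (-m * ‖x - w‖ ^ (1 / s)) := by
        have : -c ≤ -m := neg_le_neg (min_le_left _ _)
        gcongr
      calc _ ≤ (C * Real.exp (e / 2 * ‖x‖ ^ (1 / s)) * Real.exp (e / 2 * ‖ξ‖ ^ (1 / σ)) *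
            Real.exp (-c * ‖x - w‖ ^ (1 / s))) * (Q * Real.exp (-e * ‖x‖ ^ (1 / s))) := by
            gcongr
        _ = C * Real.exp (e / 2 * ‖ξ‖ ^ (1 / σ)) * Q * ((Real.exp (e / 2 * ‖x‖ ^ (1 / s)) *
            Real.exp (-e * ‖x‖ ^ (1 / s))) * Real.exp (-c * ‖x - w‖ ^ (1 / s))) := by ring
        _ = C * Real.exp (e / 2 * ‖ξ‖ ^ (1 / σ)) * Q * (Real.exp (-(e / 2) * ‖x‖ ^ (1 / s)) *
            Real.exp (-c * ‖x - w‖ ^ (1 / s))) := by rw [exp_mul_exp_half]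
        _ ≤ C * Real.exp (e / 2 * ‖ξ‖ ^ (1 / σ)) * Q * (Real.exp (-m * ‖x‖ ^ (1 / s)) *
            Real.exp (-m * ‖x - w‖ ^ (1 / s))) := by gcongr
        _ ≤ _ := by gcongr
    · have := mul_nonneg (norm_nonneg A) (add_nonneg (norm_nonneg x) (norm_nonneg (x - w)))
      have := norm_nonneg (x - w)
      linarith
  have i2 : Integrable (Function.uncurry fun z w =>
      a (z, ξ) * ((g (z + A w) * f (z + A w - w)) * phase w ξ)) (volume.prod volume) := by
    obtain ⟨C, H, c, hC, hH, hc, h⟩ := exists_norm_wordDeriv_wignerFun_le A hs hσ hf hg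
    obtain ⟨k, hk, hr⟩ := id ha
    obtain ⟨P, hP⟩ := hr (c / 2) (half_pos hc)
    have hP0 := hP.const_nonneg
    have hcont : Continuous fun p : E d × E d =>
        a (p.1, ξ) * ((g (p.1 + A p.2) * f (p.1 + A p.2 - p.2)) * phase p.2 ξ) :=
      (ha.contDiff.continuous.comp (continuous_fst.prodMk continuous_const)).mul
        ((contDiff_wignerFun A hf.contDiff hg.contDiff).continuous.mul
        ((contDiff_phase ξ).continuous.comp continuous_snd))
    refine ((integrable_exp_mul_exp hs hs (half_pos hc) hc).const_mul
      (P * Real.exp (c / 2 * ‖ξ‖ ^ (1 / σ)) * C)).mono' hcont.aestronglyMeasurable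
      (Filter.Eventually.of_forall fun p => ?_)
    obtain ⟨z, w⟩ := p
    have h1 := h [] z w
    have h2 := hP.norm_le (z, ξ)
    simp only [wordDeriv_nil, List.length_nil, pow_zero, facPow_zero, mul_one] at h1
    simp only [Function.uncurry]
    rw [norm_mul, norm_mul _ (phase w ξ), norm_phase, mul_one]
    refine (mul_le_mul h2 h1 (norm_nonneg _) (by positivity)).trans_eq ?_
    rw [← exp_mul_exp_half]
    ring
  calc ∫ x, ampl A a f x ξ * g x = ∫ x, ∫ w, amplFun A a f x ξ w * phase w ξ * g x := by
        refine integral_congr_ae (Filter.Eventually.of_forall fun x => ?_)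
        simp only [ampl]
        rw [integral_mul_const]
    _ = ∫ w, ∫ x, amplFun A a f x ξ w * phase w ξ * g x := integral_integral_swap i1
    _ = ∫ w, ∫ z, a (z, ξ) * ((g (z + A w) * f (z + A w - w)) * phase w ξ) := by
        refine integral_congr_ae (Filter.Eventually.of_forall fun w => ?_)
        simp only
        -- For fixed w the substitution x = z + Aw is a translation, so no determinant appears.
        rw [← integral_add_right_eq_self (fun x => amplFun A a f x ξ w * phase w ξ * g x) (A w)]
        refine integral_congr_ae (Filter.Eventually.of_forall fun z => ?_)
        simp only [amplFun, add_sub_cancel_right]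
        ring
    _ = ∫ z, ∫ w, a (z, ξ) * ((g (z + A w) * f (z + A w - w)) * phase w ξ) :=
        (integral_integral_swap i2).symm
    _ = _ := by
        refine integral_congr_ae (Filter.Eventually.of_forall fun z => ?_)
        simp only [wigner]
        rw [integral_const_mul]

/-- `Op_A(a) f` represents the action of the distribution kernel. -/
theorem integral_opFun_mul (hs : 0 < s) (hσ : 0 < σ) {a : E d × E d → ℂ} (ha : IsWordSymbol s σ a)
    {f g : E d → ℂ} (hf : IsGSDecay s σ f) (hg : IsGSDecay s σ g) :
    ∫ x, opFun A a f x * g x = opPair A a f g := by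
  have i1 : Integrable (Function.uncurry fun x ξ => ampl A a f x ξ * g x)
      (volume.prod volume) := by
    obtain ⟨c, hc, h⟩ := exists_norm_ampl_le A hs hσ ha hf
    obtain ⟨Q, H, e, hH, he, hg⟩ := hg
    obtain ⟨C, hC, hC'⟩ := h (e / 2) (half_pos he)
    have hQ := hg.const_nonneg
    refine ((integrable_exp_mul_exp hs hσ (half_pos he) hc).const_mul (C * Q)).mono'
      ((stronglyMeasurable_ampl A ha.contDiff hf.contDiff).aestronglyMeasurable.mul
        (hg.1.continuous.comp continuous_fst).aestronglyMeasurable)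
      (Filter.Eventually.of_forall fun p => ?_)
    obtain ⟨x, ξ⟩ := p
    have h2 := hg.2 [] x
    simp only [wordDeriv_nil, List.length_nil, pow_zero, facPow_zero, one_mul] at h2
    simp only [Function.uncurry, norm_mul]
    refine (mul_le_mul (hC' x ξ) h2 (norm_nonneg _) (by positivity)).trans_eq ?_
    rw [← exp_mul_exp_half]
    ring
  have i2 := integrable_mul_wigner A hs hσ ha hf hg
  calc ∫ x, opFun A a f x * g x
      = ∫ x, fourierConst d * fourierConst d * ∫ ξ, ampl A a f x ξ * g x := by
        refine integral_congr_ae (Filter.Eventually.of_forall fun x => ?_)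
        simp only [opFun]
        rw [integral_mul_const]
        ring
    _ = fourierConst d * fourierConst d * ∫ x, ∫ ξ, ampl A a f x ξ * g x :=
        integral_const_mul _ _
    _ = fourierConst d * fourierConst d * ∫ ξ, ∫ z, a (z, ξ) * wigner A f g (z, ξ) := by
        rw [integral_integral_swap i1]
        congr 1
        exact integral_congr_ae (Filter.Eventually.of_forall fun ξ =>
          integral_ampl_mul A hs hσ ha hf hg ξ)
    _ = fourierConst d * fourierConst d * ∫ p : E d × E d, a p * wigner A f g p := by
        congr 1
        exact (integral_prod_symm _ i2).symm
    _ = _ := by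
        unfold opPair
        rw [mul_assoc, ← integral_const_mul]
        congr 2
        funext p
        ring

/-! ### The transposed operator -/

/-- The reflection `(z, ξ) ↦ (z, -ξ)`. -/
noncomputable def reflectSnd (d : ℕ) : E d × E d →L[ℝ] E d × E d :=
  (ContinuousLinearMap.fst ℝ (E d) (E d)).prod (-ContinuousLinearMap.snd ℝ (E d) (E d))

theorem dirDeriv_comp_reflectSnd (v : E d × E d) {b : E d × E d → ℂ} (hb : ContDiff ℝ ∞ b) :
    dirDeriv v (b ∘ reflectSnd d) = dirDeriv (reflectSnd d v) b ∘ reflectSnd d := by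
  have := dirDeriv_comp_affine (reflectSnd d) 0 v hb
  simp only [zero_add] at this
  exact this

theorem wordDeriv_dirX_comp_reflectSnd (L : List (Fin d)) {b : E d × E d → ℂ}
    (hb : ContDiff ℝ ∞ b) :
    wordDeriv (dirX d) L (b ∘ reflectSnd d) = wordDeriv (dirX d) L b ∘ reflectSnd d := by
  induction L generalizing b with
  | nil => rfl
  | cons i L ih =>
    have h : reflectSnd d (dirX d i) = dirX d i := by ext1 <;> simp [reflectSnd, dirX]
    rw [wordDeriv_cons, dirDeriv_comp_reflectSnd _ hb, h, ih (contDiff_dirDeriv _ hb)]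
    rfl

theorem wordDeriv_dirXi_comp_reflectSnd (L : List (Fin d)) {b : E d × E d → ℂ}
    (hb : ContDiff ℝ ∞ b) :
    wordDeriv (dirXi d) L (b ∘ reflectSnd d) =
      ((-1) ^ L.length : ℂ) • (wordDeriv (dirXi d) L b ∘ reflectSnd d) := by
  induction L generalizing b with
  | nil => simp
  | cons i L ih =>
    have h : reflectSnd d (dirXi d i) = -dirXi d i := by ext1 <;> simp [reflectSnd, dirXi]
    have h2 : dirDeriv (-dirXi d i) b = (-1 : ℂ) • dirDeriv (dirXi d i) b := by
      funext x
      simp [dirDeriv]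
    have hb' : ContDiff ℝ ∞ (dirDeriv (dirXi d i) b) := contDiff_dirDeriv _ hb
    have hb'' : ContDiff ℝ ∞ (dirDeriv (dirXi d i) b ∘ reflectSnd d) :=
      hb'.comp (reflectSnd d).contDiff
    rw [wordDeriv_cons, dirDeriv_comp_reflectSnd _ hb, h, h2]
    change wordDeriv (dirXi d) L ((-1 : ℂ) • (dirDeriv (dirXi d i) b ∘ reflectSnd d)) = _
    rw [wordDeriv_smul _ _ _ hb'', ih hb', smul_smul, List.length_cons, pow_succ']
    rfl

theorem IsWordSymbol.comp_reflectSnd {a : E d × E d → ℂ} (ha : IsWordSymbol s σ a) :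
    IsWordSymbol s σ (a ∘ reflectSnd d) := by
  obtain ⟨h, hh, hr⟩ := ha
  refine ⟨h, hh, fun r hr0 => ?_⟩
  obtain ⟨X, hX⟩ := hr r hr0
  refine ⟨X, hX.1.comp (reflectSnd d).contDiff, fun L M z ξ => ?_⟩
  have c1 := contDiff_wordDeriv (dirXi d) M hX.1
  have c2 : ContDiff ℝ ∞ (wordDeriv (dirXi d) M a ∘ reflectSnd d) :=
    c1.comp (reflectSnd d).contDiff
  rw [wordDeriv_dirXi_comp_reflectSnd M hX.1, wordDeriv_smul _ _ _ c2,
    wordDeriv_dirX_comp_reflectSnd L c1, Pi.smul_apply, norm_smul, norm_pow, norm_neg, norm_one,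
    one_pow, one_mul]
  have := hX.2 L M z (-ξ)
  rw [norm_neg] at this
  exact this

/-- The transposed operator. -/
theorem opPair_transpose (a : E d × E d → ℂ) (f g : E d → ℂ) :
    opPair (ContinuousLinearMap.id ℝ (E d) - A) (a ∘ reflectSnd d) g f = opPair A a f g := by
  have hw : ∀ p, wigner (ContinuousLinearMap.id ℝ (E d) - A) g f p =
      wigner A f g (reflectSnd d p) := by
    intro p
    unfold wigner
    -- Under w ↦ -w the arguments for I - A become those for A with the two functions exchanged, and
    -- the sign in the phase moves to ξ.
    rw [← integral_neg_eq_self]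
    refine integral_congr_ae (Filter.Eventually.of_forall fun w => ?_)
    have h1 : p.1 + (ContinuousLinearMap.id ℝ (E d) - A) (-w) = p.1 + A w - w := by
      simp; abel
    have h2 : p.1 + A w - w - -w = p.1 + A w := by abel
    have h3 : phase (-w) p.2 = phase w (-p.2) := by rw [← phase_neg_neg, neg_neg]
    simp only [h1, h2, h3, mul_comm (f _)]
    rfl
  unfold opPair
  simp only [hw, Function.comp_apply]
  congr 1
  let e : E d × E d ≃ᵐ E d × E d := (MeasurableEquiv.refl (E d)).prodCongr (MeasurableEquiv.neg (E d))
  have he : MeasurePreserving e (volume.prod volume) (volume.prod volume) :=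
    (MeasurePreserving.id volume).prod (Measure.measurePreserving_neg volume)
  exact he.integral_comp' (g := fun p => a p * (fourierConst d * wigner A f g p))

end Duality

end GelfandShilov

/-- For `a` in the class `Γ_{s,σ;0}^{σ,s}`, `Op_A(a)` is a continuous operator `T` on `𝒮_s^σ` and
a continuous operator `T'` on the dual `(𝒮_s^σ)'`. The operator `T'` extends `T` and is given by
duality: `⟨T'u, g⟩ = ⟨u, R g⟩`, where `R` is the transposed operator of `Op_A(a)`, that is
`⟨f, R g⟩ = ⟨Op_A(a)f, g⟩`. -/
theorem mainTheorem1 {d : ℕ} (A : Matrix (Fin d) (Fin d) ℝ) (s σ : ℝ) (hs : 0 < s) (hσ : 0 < σ)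
    (hsσ : 1 ≤ s + σ) (a : GelfandShilov.E d × GelfandShilov.E d → ℂ)
    (ha : GelfandShilov.IsSymbol s σ a) :
    (∀ f g : GelfandShilov.Space d s σ, MeasureTheory.Integrable
      (fun p => a p * GelfandShilov.invFourier₂
        (GelfandShilov.pull A (fun q => g q.1 * f q.2)) p)) ∧
    ∃ (T R : GelfandShilov.Space d s σ →L[ℂ] GelfandShilov.Space d s σ)
      (T' : StrongDual ℂ (GelfandShilov.Space d s σ) →L[ℂ]
        StrongDual ℂ (GelfandShilov.Space d s σ)),
      (∀ f g, GelfandShilov.toDual (T f) g = GelfandShilov.opAction A a f g) ∧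
      (∀ f g, GelfandShilov.toDual f (R g) = GelfandShilov.opAction A a f g) ∧
      (∀ f, T' (GelfandShilov.toDual f) = GelfandShilov.toDual (T f)) ∧
      ∀ u g, T' u g = u (R g) := by
  open GelfandShilov in
  have hw := ha.isWordSymbol hs hσ
  set B : E d →L[ℝ] E d := LinearMap.toContinuousLinearMap A.toEuclideanLin with hB
  have hpair : ∀ f g : E d → ℂ, opAction A a f g = opPair B a f g := fun _ _ => rfl
  set T := opCLM B hs hσ hsσ hw
  set R := opCLM (ContinuousLinearMap.id ℝ (E d) - B) hs hσ hsσ hw.comp_reflectSnd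
  have hT : ∀ f g, toDual (T f) g = opAction A a f g := fun f g =>
    integral_opFun_mul B hs hσ hw (f.isGSDecay hs hσ) (g.isGSDecay hs hσ)
  have hR : ∀ f g, toDual f (R g) = opAction A a f g := by
    intro f g
    rw [hpair, ← opPair_transpose, ← integral_opFun_mul _ hs hσ hw.comp_reflectSnd
      (g.isGSDecay hs hσ) (f.isGSDecay hs hσ)]
    exact MeasureTheory.integral_congr_ae (Filter.Eventually.of_forall fun x => mul_comm _ _)
  -- The adjoint of a continuous linear map is continuous for the strong topologies. It extends T
  -- because both sides pair with g to `opAction A a f g`.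
  refine ⟨fun f g => ?_, T, R, ContinuousLinearMap.precomp ℂ R, hT, hR, fun f => ?_,
    fun u g => rfl⟩
  · refine ((integrable_mul_wigner B hs hσ hw (f.isGSDecay hs hσ) (g.isGSDecay hs hσ)).const_mul
      (fourierConst d)).congr (Filter.Eventually.of_forall fun p => ?_)
    exact mul_left_comm _ _ _
  · ext g
    exact (hR f g).trans (hT f g).symm
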